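/- **Theorem (existence and uniqueness for the discrete kernel problem).** *Data.* Let $\Omega\subset\mathbb R^2$ be a bounded connected open set (for instance polygonal with Lipschitz boundary), and let $\partial\Omega=\Gamma_D\cup\Gamma_N$ be a disjoint measurable partition with $|\Gamma_D|>0$ (length). Let $k\ge1$, $r\in[2,\infty)$, $r'=\frac r{r-1}$, $\delta\ge0$, $\alpha\in(0,\infty)$, let $\mu:\Omega\to[\mu_-,\mu_+]$ be measurable with $0<\mu_-\le\mu_+<\infty$, and let $\boldsymbol f\in L^{r'}(\Omega)^2$, $\boldsymbol g\in L^{r'}(\Gamma_N)^2$. Matrices carry the inner product $\tau:\eta=\sum_{ij}\tau_{ij}\eta_{ij}$ and its norm. The stress law $\boldsymbol\sigma$ is either the Carreau–Yasuda law $\boldsymbol\sigma(x,\tau)=\mu(x)(\delta^\alpha+|\tau|^\alpha)^{\frac{r-2}\alpha}\tau$ or, more generally, any Carathéodory function $\boldsymbol\sigma:\Omega\times\mathbb R^{2\times2}_s\to\mathbb R^{2\times2}_s$ with $\boldsymbol\sigma(\cdot,0)=0$ for which there are $\sigma_c,\sigma_m>0$ such that, for a.e. $x\in\Omega$ and all symmetric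 $\tau,\eta$, $$|\boldsymbol\sigma(x,\tau)-\boldsymbol\sigma(x,\eta)|\le\sigma_c(\delta^r+|\tau|^r+|\eta|^r)^{\frac{r-2}r}|\tau-\eta|,$$ $$(\boldsymbol\sigma(x,\tau)-\boldsymbol\sigma(x,\eta)):(\tau-\eta)\ge\sigma_m(\delta^r+|\tau|^r+|\eta|^r)^{\frac{r-2}r}|\tau-\eta|^2 .$$ *Mesh.* $\Omega_h$ is a finite family of pairwise disjoint open simple polygons $E\subset\Omega$ (consecutive edges may be aligned) whose closures cover $\overline\Omega$, such that for some $\rho>0$ each $E$ is star-shaped with respect to a ball of radius $\ge\rho h_E$ and each edge of $E$ has length $\ge\rho h_E$. Here $h_E$, $|E|$, $x_E$ are the diameter, area and centroid of $E$; $m_\beta(x)=\prod_i\big(\frac{x_i-x_{E,i}}{h_E}\big)^{\beta_i}$; $x^\perp=(x_2,-x_1)$; $\mathbb P_n$ denotes the polynomials of degree $\le n$. $\Pi^0_n$ is the elementwise (and componentwise) $L^2(E)$-projection onto $\mathbb P_n(E)$; $\Pi^{\nabla,E}_n v\in\mathbb P_n(E)$ is given by $\int_E\nabla q\cdot\nabla(v-\Pi^{\nabla,E}_nv)=0$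 for all $q\in\mathbb P_n(E)$ and $\int_{\partial E}(v-\Pi^{\nabla,E}_nv)=0$. *Spaces.* $\boldsymbol U_h(E)$ consists of the $\boldsymbol v\in C^0(\overline E)^2\cap W^{1,2}(E)^2$ such that (i) $\Delta\boldsymbol v+\nabla s\in x^\perp\mathbb P_{k-1}(E)$ in the sense of distributions for some $s\in L^2(E)$ with $\int_E s=0$; (ii) $\operatorname{div}\boldsymbol v\in\mathbb P_{k-1}(E)$; (iii) on each edge $e$, $\boldsymbol v\cdot\boldsymbol n_e\in\mathbb P_{\max\{2,k\}}(e)$ and $\boldsymbol v\cdot\boldsymbol t_e\in\mathbb P_k(e)$; (iv) $\int_E(\boldsymbol v-\Pi^{\nabla,E}_k\boldsymbol v)\cdot x^\perp m_\beta=0$ for $k-2\le|\beta|\le k-1$. The vector $\mathrm{DOF}_E(\boldsymbol v)$ lists: the values of $\boldsymbol v$ at the vertices; the edge averages of $\boldsymbol v\cdot\boldsymbol t_e\,m_j$ ($j\le k-2$) and of $\boldsymbol v\cdot\boldsymbol n_e\,m_j$ ($j\le\max\{2,k\}-2$), with $m_j$ the one-dimensional monomials centred at the midpoint of $e$ and scaled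 by its length; $\frac1{|E|}\int_E\boldsymbol v\cdot\frac{m_\beta}{h_E}(x-x_E)^\perp$ for $|\beta|\le k-3$; and $\frac{h_E}{|E|}\int_E(\operatorname{div}\boldsymbol v)\,m_\beta$ for $0<|\beta|\le k-1$. Let $$\boldsymbol U_h=\{\boldsymbol v\in C^0(\overline\Omega)^2:\ \boldsymbol v=0\text{ a.e. on }\Gamma_D,\ \boldsymbol v|_E\in\boldsymbol U_h(E)\ \forall E\in\Omega_h\},$$ $P=L^{r'}(\Omega)$ if $|\Gamma_N|>0$ and $P=\{q\in L^{r'}(\Omega):\int_\Omega q=0\}$ otherwise, $P_h=\{q\in P:\ q|_E\in\mathbb P_{k-1}(E)\ \forall E\}$, and $$\boldsymbol Z_h=\Big\{\boldsymbol v\in\boldsymbol U_h:\ b(\boldsymbol v,q):=-\int_\Omega(\operatorname{div}\boldsymbol v)\,q=0\ \ \forall q\in P_h\Big\}.$$ *Form.* With $\boldsymbol\epsilon(\boldsymbol v)=\frac12(\nabla\boldsymbol v+\nabla\boldsymbol v^T)$ and $\overline\mu_E=\frac1{|E|}\int_E\mu$, set $$S^E(\boldsymbol v,\boldsymbol w)=\overline\mu_E\big(\delta^\alpha+h_E^{-\alpha}|\mathrm{DOF}_E(\boldsymbol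 v)|^\alpha\big)^{\frac{r-2}\alpha}\,\mathrm{DOF}_E(\boldsymbol v)\cdot\mathrm{DOF}_E(\boldsymbol w),$$ $$a_h(\boldsymbol v,\boldsymbol w)=\int_\Omega\boldsymbol\sigma(\cdot,\Pi^0_{k-1}\boldsymbol\epsilon(\boldsymbol v)):\Pi^0_{k-1}\boldsymbol\epsilon(\boldsymbol w)+\sum_{E\in\Omega_h}S^E\big((I-\Pi^0_k)\boldsymbol v,(I-\Pi^0_k)\boldsymbol w\big).$$ *Claim.* There is exactly one $\boldsymbol u_h\in\boldsymbol Z_h$ such that $$a_h(\boldsymbol u_h,\boldsymbol v_h)=\int_\Omega(\Pi^0_k\boldsymbol f)\cdot\boldsymbol v_h+\int_{\Gamma_N}\boldsymbol g\cdot\boldsymbol v_h\qquad\forall\,\boldsymbol v_h\in\boldsymbol Z_h .$$ -/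

import Mathlib

open MeasureTheory Set
open scoped ContDiff

noncomputable section

namespace VEM

/-! ### The plane, polynomials and weak derivatives -/

/-- The Euclidean plane. -/
abbrev Plane : Type := EuclideanSpace ℝ (Fin 2)

/-- Real polynomials in the two coordinates. -/
abbrev Poly : Type := MvPolynomial (Fin 2) ℝ

/-- The function on the plane given by a polynomial. -/
def polyFun (p : Poly) (x : Plane) : ℝ := MvPolynomial.eval (fun i => x i) p

/-- The rotated vector `x^⊥ = (x₂, -x₁)`. -/
def perp (x : Plane) : Plane := !₂[x 1, -x 0]

/-- The classical partial derivative in the `i`-th coordinate direction. -/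
def partialDeriv (i : Fin 2) (φ : Plane → ℝ) (x : Plane) : ℝ :=
  fderiv ℝ φ x (EuclideanSpace.single i 1)

/-- `φ ∈ C_c^∞(E)`. -/
structure IsTestFunction (E : Set Plane) (φ : Plane → ℝ) : Prop where
  smooth : ContDiff ℝ ∞ φ
  compact : HasCompactSupport φ
  support : tsupport φ ⊆ E

/-- `g ∈ L²(E)` is the weak partial derivative of `f` on `E` in the `i`-th coordinate direction. -/
def IsWeakPartial (E : Set Plane) (i : Fin 2) (f g : Plane → ℝ) : Prop :=
  MemLp g 2 (volume.restrict E) ∧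
    ∀ φ : Plane → ℝ, IsTestFunction E φ →
      ∫ x in E, f x * partialDeriv i φ x = -∫ x in E, g x * φ x

/-- `f ∈ W^{1,2}(E)`. -/
def MemW12 (E : Set Plane) (f : Plane → ℝ) : Prop :=
  MemLp f 2 (volume.restrict E) ∧ ∀ i, ∃ g, IsWeakPartial E i f g

open Classical in
/-- A representative of the weak partial derivative `∂ᵢ f ∈ L²(E)` (zero if there is none). -/
def weakPartial (E : Set Plane) (i : Fin 2) (f : Plane → ℝ) : Plane → ℝ :=
  if h : ∃ g, IsWeakPartial E i f g then h.choose else 0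

/-- The symmetric gradient `ε(v) = (∇v + ∇vᵀ)/2` on `E`. -/
def strain (E : Set Plane) (v : Plane → Plane) (x : Plane) : Matrix (Fin 2) (Fin 2) ℝ :=
  Matrix.of fun i j =>
    (weakPartial E j (fun y => v y i) x + weakPartial E i (fun y => v y j) x) / 2

/-- The divergence of `v` on `E`. -/
def weakDiv (E : Set Plane) (v : Plane → Plane) (x : Plane) : ℝ :=
  ∑ i, weakPartial E i (fun y => v y i) x

/-- The inner product `A : B` of matrices. -/
def frobInner (A B : Matrix (Fin 2) (Fin 2) ℝ) : ℝ := ∑ i, ∑ j, A i j * B i j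

/-- The induced norm `|A| = (A : A)^{1/2}`. -/
def frobNorm (A : Matrix (Fin 2) (Fin 2) ℝ) : ℝ := Real.sqrt (frobInner A A)

/-! ### The `L²`-projections onto polynomials -/

/-- `p` is the `L²(E)`-projection of `f` onto the polynomials of degree at most `n`. -/
def IsL2Proj (E : Set Plane) (n : ℕ) (f : Plane → ℝ) (p : Poly) : Prop :=
  p.totalDegree ≤ n ∧
    ∀ q : Poly, q.totalDegree ≤ n → ∫ x in E, polyFun q x * (f x - polyFun p x) = 0

open Classical in
/-- The `L²`-projection `Π⁰_n f` on `E`. -/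
def l2Proj (E : Set Plane) (n : ℕ) (f : Plane → ℝ) : Plane → ℝ :=
  if h : ∃ p, IsL2Proj E n f p then polyFun h.choose else 0

/-- The `L²`-projection of a vector field. -/
def l2ProjVec (E : Set Plane) (n : ℕ) (v : Plane → Plane) (x : Plane) : Plane :=
  WithLp.toLp 2 fun i => l2Proj E n (fun y => v y i) x

/-- The `L²`-projection of a tensor field. -/
def l2ProjMat (E : Set Plane) (n : ℕ) (M : Plane → Matrix (Fin 2) (Fin 2) ℝ) (x : Plane) :
    Matrix (Fin 2) (Fin 2) ℝ :=
  Matrix.of fun i j => l2Proj E n (fun y => M y i j) x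

/-! ### Polygonal elements and decompositions -/

/-- An open polygon: a bounded domain whose boundary is a simple closed polygonal curve with the
listed vertices in cyclic order. Consecutive edges may be aligned (hanging nodes). -/
structure MeshElement where
  carrier : Set Plane
  n : ℕ
  poly : Polygon Plane n
  isOpen : IsOpen carrier
  isBounded : Bornology.IsBounded carrier
  isConnected : IsConnected carrier
  /-- the closed polygonal curve is traversed without repeating a point -/
  simple : InjOn (fun p : Fin n × ℝ => poly.edgePath ℝ p.1 p.2) (univ ×ˢ Ico (0 : ℝ) 1)
  frontier_eq : frontier carrier = poly.boundary ℝ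

namespace MeshElement

variable (K : MeshElement)

/-- The diameter `h_E`. -/
def diam : ℝ := Metric.diam K.carrier

/-- The area `|E|`. -/
def area : ℝ := (volume : Measure Plane).real K.carrier

/-- The centroid `x_E`. -/
def centroid : Plane := ⨍ x in K.carrier, x

/-- The length of the `i`-th edge. -/
def edgeLength (i : Fin K.n) : ℝ := dist (K.poly i) (K.poly (finRotate K.n i))

/-- The unit tangent to the `i`-th edge. -/
def tangent (i : Fin K.n) : Plane :=
  (K.edgeLength i)⁻¹ • (K.poly (finRotate K.n i) - K.poly i)

/-- A unit normal to the `i`-th edge. -/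
def normal (i : Fin K.n) : Plane := perp (K.tangent i)

/-- The moment `|e|⁻¹ ∫_e F m_j ds` on the `i`-th edge, where `m_j` is the normalized monomial of
degree `j` of the edge, centred at its midpoint. -/
def edgeMoment (i : Fin K.n) (F : Plane → ℝ) (j : ℕ) : ℝ :=
  ∫ θ in (0 : ℝ)..1, F (K.poly.edgePath ℝ i θ) * (θ - 1 / 2) ^ j

/-- The line integral `∫_{∂E} F ds`. -/
def boundaryIntegral (F : Plane → ℝ) : ℝ :=
  ∑ i, K.edgeLength i * ∫ θ in (0 : ℝ)..1, F (K.poly.edgePath ℝ i θ)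

/-- The normalized monomial `m_α` with `α = (α₁, α₂)`. -/
def monomial (α : ℕ × ℕ) (x : Plane) : ℝ :=
  ((x 0 - K.centroid 0) / K.diam) ^ α.1 * ((x 1 - K.centroid 1) / K.diam) ^ α.2

/-- The mesh regularity condition with constant `ρ`: star-shapedness with respect to a ball of
radius at least `ρ h_E`, and all edges of length at least `ρ h_E`. -/
def IsRegular (ρ : ℝ) : Prop :=
  (∃ (c : Plane) (R : ℝ), ρ * K.diam ≤ R ∧
    ∀ y ∈ Metric.ball c R, StarConvex ℝ y K.carrier) ∧
  ∀ i, ρ * K.diam ≤ K.edgeLength i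

/-- `p` is the elliptic projection of `f ∈ W^{1,2}(E)` onto the polynomials of degree at most
`n`. -/
def IsEllProj (n : ℕ) (f : Plane → ℝ) (p : Poly) : Prop :=
  p.totalDegree ≤ n ∧
  (∀ q : Poly, q.totalDegree ≤ n →
    ∫ x in K.carrier, ∑ i, polyFun (MvPolynomial.pderiv i q) x *
      (weakPartial K.carrier i f x - polyFun (MvPolynomial.pderiv i p) x) = 0) ∧
  K.boundaryIntegral (fun x => f x - polyFun p x) = 0

open Classical in
/-- The elliptic projection `Π^∇_n f` on `E`. -/
def ellProj (n : ℕ) (f : Plane → ℝ) : Plane → ℝ :=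
  if h : ∃ p, K.IsEllProj n f p then polyFun h.choose else 0

/-- The elliptic projection of a vector field. -/
def ellProjVec (n : ℕ) (v : Plane → Plane) (x : Plane) : Plane :=
  WithLp.toLp 2 fun i => K.ellProj n (fun y => v y i) x

/-- The span of the normalized monomials `m_α` with `k - 2 ≤ |α| ≤ k - 1`. -/
def highPoly (k : ℕ) : Submodule ℝ (Plane → ℝ) :=
  Submodule.span ℝ {m | ∃ α : ℕ × ℕ, k ≤ α.1 + α.2 + 2 ∧ α.1 + α.2 + 1 ≤ k ∧ m = K.monomial α}

/-- Membership of `v` (through its values on the closure of `E`) in the local enhanced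
divergence-free virtual element space of order `k`. -/
structure InLocalSpace (k : ℕ) (v : Plane → Plane) : Prop where
  continuousOn : ContinuousOn v (closure K.carrier)
  memW12 : ∀ i, MemW12 K.carrier (fun x => v x i)
  /-- `Δ v + ∇ s = x^⊥ p` in the sense of distributions on `E` -/
  stokes : ∃ s : Plane → ℝ, MemLp s 2 (volume.restrict K.carrier) ∧
    ∫ x in K.carrier, s x = 0 ∧
    ∃ p : Poly, p.totalDegree ≤ k - 1 ∧
      ∀ (i : Fin 2) (φ : Plane → ℝ), IsTestFunction K.carrier φ →
        -(∫ x in K.carrier, ∑ j, weakPartial K.carrier j (fun y => v y i) x * partialDeriv j φ x)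
          - ∫ x in K.carrier, s x * partialDeriv i φ x
        = ∫ x in K.carrier, perp x i * polyFun p x * φ x
  div_poly : ∃ q : Poly, q.totalDegree ≤ k - 1 ∧
    ∀ᵐ x ∂volume.restrict K.carrier, weakDiv K.carrier v x = polyFun q x
  normal_poly : ∀ i, ∃ q : Polynomial ℝ, q.natDegree ≤ max 2 k ∧
    ∀ θ ∈ Icc (0 : ℝ) 1, inner ℝ (v (K.poly.edgePath ℝ i θ)) (K.normal i) = q.eval θ
  tangent_poly : ∀ i, ∃ q : Polynomial ℝ, q.natDegree ≤ k ∧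
    ∀ θ ∈ Icc (0 : ℝ) 1, inner ℝ (v (K.poly.edgePath ℝ i θ)) (K.tangent i) = q.eval θ
  enhanced : ∀ m ∈ K.highPoly k,
    ∫ x in K.carrier, inner ℝ (v x - K.ellProjVec k v x) (m x • perp x) = 0

/-- Exponents `α` with `|α| ≤ k - 3`. -/
def perpIndex (k : ℕ) : Finset (ℕ × ℕ) :=
  (Finset.range k ×ˢ Finset.range k).filter fun α => α.1 + α.2 + 3 ≤ k

/-- Exponents `α` with `0 < |α| ≤ k - 1`. -/
def divIndex (k : ℕ) : Finset (ℕ × ℕ) :=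
  (Finset.range k ×ˢ Finset.range k).filter fun α => 0 < α.1 + α.2 ∧ α.1 + α.2 + 1 ≤ k

/-- Labels of the local degrees of freedom: vertex values, tangential edge moments of degree at
most `k - 2`, normal edge moments of degree at most `max {2, k} - 2`, moments against
`m_α (x - x_E)^⊥`, and moments of the divergence. -/
abbrev DofIndex (k : ℕ) : Type :=
  (Fin K.n × Fin 2) ⊕ (Fin K.n × Fin (k - 1)) ⊕ (Fin K.n × Fin (max 2 k - 1)) ⊕
    perpIndex k ⊕ divIndex k

/-- The vector of the local degrees of freedom of `v`. -/
def dof (k : ℕ) (v : Plane → Plane) : EuclideanSpace ℝ (K.DofIndex k) :=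
  WithLp.toLp 2 fun
    | .inl (i, c) => v (K.poly i) c
    | .inr (.inl (i, j)) => K.edgeMoment i (fun x => inner ℝ (v x) (K.tangent i)) j
    | .inr (.inr (.inl (i, j))) => K.edgeMoment i (fun x => inner ℝ (v x) (K.normal i)) j
    | .inr (.inr (.inr (.inl α))) =>
        K.area⁻¹ * ∫ x in K.carrier,
          inner ℝ (v x) ((K.monomial α x / K.diam) • perp (x - K.centroid))
    | .inr (.inr (.inr (.inr α))) =>
        K.diam / K.area * ∫ x in K.carrier, weakDiv K.carrier v x * K.monomial α x

/-- The local stabilization form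
`S^E(v, w) = μ_E (δ^α + h_E^{-α} |DOF v|^α)^{(r-2)/α} DOF v · DOF w`, with `μ_E` the mean of `μ`. -/
def stab (k : ℕ) (μ : Plane → ℝ) (δ α r : ℝ) (v w : Plane → Plane) : ℝ :=
  (⨍ x in K.carrier, μ x) *
    (δ ^ α + K.diam ^ (-α) * ‖K.dof k v‖ ^ α) ^ ((r - 2) / α) *
      inner ℝ (K.dof k v) (K.dof k w)

end MeshElement

/-- The finitely many open polygons `T i` are a decomposition of `Ω`. -/
structure IsDecomposition (Ω : Set Plane) {ι : Type*} (T : ι → MeshElement) : Prop where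
  subset : ∀ i, (T i).carrier ⊆ Ω
  disjoint : Pairwise fun i j => Disjoint (T i).carrier (T j).carrier
  cover : closure Ω = ⋃ i, closure (T i).carrier

/-! ### Stress-strain laws -/

/-- The Carreau-Yasuda law `σ(x, τ) = μ(x) (δ^α + |τ|^α)^{(r-2)/α} τ`. -/
def carreauYasuda (μ : Plane → ℝ) (δ α r : ℝ) (x : Plane) (τ : Matrix (Fin 2) (Fin 2) ℝ) :
    Matrix (Fin 2) (Fin 2) ℝ :=
  (μ x * (δ ^ α + frobNorm τ ^ α) ^ ((r - 2) / α)) • τ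

/-- `σ : Ω × ℝ_s^{2×2} → ℝ_s^{2×2}` is a Carathéodory function, vanishes at zero strain, and is
Hölder continuous and strongly monotone with exponent `r`, shift `δ` and constants `σc`, `σm`. -/
structure StressLaw (Ω : Set Plane) (r δ σc σm : ℝ)
    (σ : Plane → Matrix (Fin 2) (Fin 2) ℝ → Matrix (Fin 2) (Fin 2) ℝ) : Prop where
  symm : ∀ x ∈ Ω, ∀ τ : Matrix (Fin 2) (Fin 2) ℝ, τ.IsSymm → (σ x τ).IsSymm
  measurable : ∀ τ : Matrix (Fin 2) (Fin 2) ℝ, τ.IsSymm → ∀ i j,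
    AEStronglyMeasurable (fun x => σ x τ i j) (volume.restrict Ω)
  continuous : ∀ᵐ x ∂volume.restrict Ω, ContinuousOn (σ x) {τ | τ.IsSymm}
  zero : ∀ᵐ x ∂volume.restrict Ω, σ x 0 = 0
  holder : ∀ᵐ x ∂volume.restrict Ω, ∀ τ η : Matrix (Fin 2) (Fin 2) ℝ, τ.IsSymm → η.IsSymm →
    frobNorm (σ x τ - σ x η) ≤
      σc * (δ ^ r + frobNorm τ ^ r + frobNorm η ^ r) ^ ((r - 2) / r) * frobNorm (τ - η)
  monotone : ∀ᵐ x ∂volume.restrict Ω, ∀ τ η : Matrix (Fin 2) (Fin 2) ℝ, τ.IsSymm → η.IsSymm →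
    σm * (δ ^ r + frobNorm τ ^ r + frobNorm η ^ r) ^ ((r - 2) / r) * frobNorm (τ - η) ^ 2 ≤
      frobInner (σ x τ - σ x η) (τ - η)

/-! ### The global spaces and the discrete problem -/

/-- The global velocity space `U_h`. A field on the closure of `Ω` is represented by its extension
by zero to the plane. -/
def velocitySpace (Ω ΓD : Set Plane) {ι : Type*} (T : ι → MeshElement) (k : ℕ) :
    Set (Plane → Plane) :=
  {v | (∀ x ∉ closure Ω, v x = 0) ∧ ContinuousOn v (closure Ω) ∧
    (∀ᵐ x ∂(μH[1]).restrict ΓD, v x = 0) ∧ ∀ i, (T i).InLocalSpace k v}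

/-- The pressure space `P`: `L^{r'}(Ω)`, with zero mean if the Neumann part has no length. -/
def pressureSpace (Ω ΓN : Set Plane) (r : ℝ) : Set (Plane → ℝ) :=
  {q | MemLp q (ENNReal.ofReal (r / (r - 1))) (volume.restrict Ω) ∧
    (μH[1] ΓN = 0 → ∫ x in Ω, q x = 0)}

/-- The discrete pressure space `P_h`: pressures in `P` that are polynomial of degree at most
`k - 1` on every element. -/
def discretePressureSpace (Ω ΓN : Set Plane) {ι : Type*} (T : ι → MeshElement) (k : ℕ) (r : ℝ) :
    Set (Plane → ℝ) :=
  {q | q ∈ pressureSpace Ω ΓN r ∧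
    ∀ i, ∃ p : Poly, p.totalDegree ≤ k - 1 ∧ EqOn q (polyFun p) (T i).carrier}

/-- `b(v, q) = -∫_Ω (div v) q`, computed element by element. -/
def formB {ι : Type*} [Fintype ι] (T : ι → MeshElement) (v : Plane → Plane) (q : Plane → ℝ) : ℝ :=
  -∑ i, ∫ x in (T i).carrier, weakDiv (T i).carrier v x * q x

/-- The discrete kernel `Z_h`. -/
def discreteKernel (Ω ΓD ΓN : Set Plane) {ι : Type*} [Fintype ι] (T : ι → MeshElement) (k : ℕ)
    (r : ℝ) : Set (Plane → Plane) :=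
  {v | v ∈ velocitySpace Ω ΓD T k ∧ ∀ q ∈ discretePressureSpace Ω ΓN T k r, formB T v q = 0}

/-- The discrete form
`a_h(v, w) = ∫_Ω σ(·, Π⁰_{k-1} ε(v)) : Π⁰_{k-1} ε(w) + S((I - Π⁰_k) v, (I - Π⁰_k) w)`,
as a sum over the elements. -/
def formA {ι : Type*} [Fintype ι] (T : ι → MeshElement) (k : ℕ)
    (σ : Plane → Matrix (Fin 2) (Fin 2) ℝ → Matrix (Fin 2) (Fin 2) ℝ)
    (μ : Plane → ℝ) (δ α r : ℝ) (v w : Plane → Plane) : ℝ :=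
  ∑ i, ((∫ x in (T i).carrier,
      frobInner (σ x (l2ProjMat (T i).carrier (k - 1) (strain (T i).carrier v) x))
        (l2ProjMat (T i).carrier (k - 1) (strain (T i).carrier w) x)) +
    (T i).stab k μ δ α r (fun x => v x - l2ProjVec (T i).carrier k v x)
      (fun x => w x - l2ProjVec (T i).carrier k w x))

/-- The load `∫_Ω f_h · v + ∫_{Γ_N} g · v` with `f_h = Π⁰_k f`. -/
def load (ΓN : Set Plane) {ι : Type*} [Fintype ι] (T : ι → MeshElement) (k : ℕ)
    (f g : Plane → Plane) (v : Plane → Plane) : ℝ :=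
  (∑ i, ∫ x in (T i).carrier, inner ℝ (l2ProjVec (T i).carrier k f x) (v x)) +
    ∫ x in ΓN, inner ℝ (g x) (v x) ∂μH[1]

/-- `u` solves the discrete kernel problem: `u ∈ Z_h` and `a_h(u, v) = ∫_Ω f_h · v + ∫_{Γ_N} g · v`
for all `v ∈ Z_h`. -/
def SolvesKernelProblem (Ω ΓD ΓN : Set Plane) {ι : Type*} [Fintype ι] (T : ι → MeshElement)
    (k : ℕ) (σ : Plane → Matrix (Fin 2) (Fin 2) ℝ → Matrix (Fin 2) (Fin 2) ℝ)
    (μ : Plane → ℝ) (δ α r : ℝ) (f g : Plane → Plane) (u : Plane → Plane) : Prop :=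
  u ∈ discreteKernel Ω ΓD ΓN T k r ∧
    ∀ v ∈ discreteKernel Ω ΓD ΓN T k r, formA T k σ μ δ α r u v = load ΓN T k f g v

end VEM

end

/-!
The discrete kernel is a finite-dimensional space on which the discrete form is continuous and
strictly monotone in its first argument and linear in the second, and grows superlinearly along
every ray. Minty's argument then yields exactly one solution for every linear load
(`VEM.existsUnique_of_strictMono_form`). Its finite-dimensional core is the Debrunner–Flor
inequality, obtained by separating a compact convex set from an orthant, so that no fixed point
theorem enters. Both kinds of stress law are reduced to one notion, `VEM.IsMonotoneLaw`: a locally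
bounded Carathéodory function that is strictly monotone and dominates `c |τ|² - C`. The
stabilization is the radial map of the same kind on the vector of the degrees of freedom.

Strict monotonicity rests on the implication that a field `v` of the kernel vanishes as soon as on
every element `E` the projected strain `Π⁰_{k-1} ε(v)` and the degrees of freedom of
`(I - Π⁰_k) v` vanish. This has two parts.

*Unisolvence* (`VEM.MeshElement.InLocalSpace.eq_zero_of_dof_eq_zero`). A local field without
degrees of freedom vanishes on the boundary of the element, because its traces are polynomials
fixed by vertex values and edge moments. Its divergence vanishes, and it is orthogonal to `P_{k-2}²`
by the decomposition of the vector polynomials into gradients and `x^⊥` multiples. Hence its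
elliptic projection is zero, and the enhancement constraint makes it orthogonal to all of
`x^⊥ P_{k-1}`. Testing its Stokes equation with the field itself gives a vanishing gradient.
The test is admissible since a continuous `W^{1,2}` function with zero boundary values is a limit of
test functions: truncate near zero, then mollify. This needs no regularity of the boundary.
Unisolvence also shows that the kernel has finite dimension.

*Rigidity* (`VEM.eq_zero_of_piecewise_rigid`). By unisolvence `v` is on each element a polynomial,
whose strain is its own projection and so vanishes; thus `v` is an infinitesimal rigid motion on
each element. Along any segment in the domain the tangential component of `v` is continuous and
takes finitely many values, so it is constant. Therefore `v` is locally, and by connectedness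
globally, one rigid motion. It has two distinct zeros on the Dirichlet part, which has positive
length, and must vanish.
-/

noncomputable section

namespace VEM

/-! ### Monotone maps in finite dimension -/

open Filter Topology in
/-- Finitely many pairs `(xᵢ, yᵢ)` of a monotone relation admit a convex combination `u` of the `xᵢ`
with `⟪yᵢ, xᵢ - u⟫ ≥ 0` for all `i`. Otherwise the convex compact set of the vectors
`(⟪yᵢ, xᵢ - u⟫)ᵢ` could be separated from the nonnegative orthant, and testing the separating
weights against themselves contradicts monotonicity. -/
lemma exists_convexComb_inner_nonneg {E : Type*} [NormedAddCommGroup E] [InnerProductSpace ℝ E]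
    {ι : Type*} [Fintype ι] (i₀ : ι) (x y : ι → E)
    (hmono : ∀ i j, 0 ≤ inner ℝ (y i - y j) (x i - x j)) :
    ∃ w ∈ stdSimplex ℝ ι, ∀ i, 0 ≤ inner ℝ (y i) (x i - ∑ j, w j • x j) := by
  classical
  by_contra! hcon
  let Φ : (ι → ℝ) → (ι → ℝ) := fun w i => ∑ j, w j * inner ℝ (y i) (x i - x j)
  have hΦ : ∀ w ∈ stdSimplex ℝ ι, ∀ i, Φ w i = inner ℝ (y i) (x i - ∑ j, w j • x j) := by
    intro w hw i
    have h1 : x i - ∑ j, w j • x j = ∑ j, w j • (x i - x j) := by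
      simp only [smul_sub, Finset.sum_sub_distrib, ← Finset.sum_smul, hw.2, one_smul]
    rw [h1, inner_sum]
    simp only [Φ, inner_smul_right]
  let ΦL : (ι → ℝ) →ₗ[ℝ] (ι → ℝ) :=
    { toFun := Φ
      map_add' := fun a b => by
        ext i; simp only [Φ, Pi.add_apply, add_mul, Finset.sum_add_distrib]
      map_smul' := fun c a => by
        ext i
        simp only [Φ, Pi.smul_apply, smul_eq_mul, mul_assoc, Finset.mul_sum,
          RingHom.id_apply] }
  have hC : IsCompact (ΦL '' stdSimplex ℝ ι) :=
    (isCompact_stdSimplex ℝ ι).image (LinearMap.continuous_of_finiteDimensional ΦL)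
  have hCc : Convex ℝ (ΦL '' stdSimplex ℝ ι) := (convex_stdSimplex ℝ ι).linear_image ΦL
  have hdisj : Disjoint (ΦL '' stdSimplex ℝ ι) (Ici (0 : ι → ℝ)) := by
    rw [Set.disjoint_left]
    rintro _ ⟨w, hw, rfl⟩ h0
    obtain ⟨i, hi⟩ := hcon w hw
    rw [← hΦ w hw i] at hi
    exact absurd (h0 i) (not_le.mpr hi)
  obtain ⟨f, a, b, hfa, hab, hfb⟩ :=
    geometric_hahn_banach_compact_closed hCc hC (convex_Ici 0) isClosed_Ici hdisj
  set p : ι → ℝ := fun i => f (Pi.single i 1) with hp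
  have hf : ∀ z, f z = ∑ i, z i * p i := by
    intro z
    conv_lhs => rw [← Finset.univ_sum_single z]
    rw [map_sum]
    refine Finset.sum_congr rfl fun i _ => ?_
    have : (Pi.single i (z i) : ι → ℝ) = z i • Pi.single i (1 : ℝ) := by
      rw [← Pi.single_smul]; simp
    rw [this, map_smul, smul_eq_mul]
  have hb0 : b < 0 := by simpa using hfb 0 (by simp)
  have hp0 : ∀ i, 0 ≤ p i := by
    intro i
    by_contra! hneg
    have h1 := hfb ((b / p i) • Pi.single i (1 : ℝ)) (by
      intro j
      have : 0 ≤ b / p i := div_nonneg_of_nonpos hb0.le hneg.le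
      by_cases hj : j = i
      · subst hj; simpa using this
      · simp [hj])
    rw [map_smul, smul_eq_mul, div_mul_cancel₀ _ hneg.ne] at h1
    exact lt_irrefl _ h1
  have hneg : ∀ w ∈ stdSimplex ℝ ι, f (Φ w) < 0 := fun w hw =>
    (hfa _ ⟨w, hw, rfl⟩).trans (hab.trans hb0)
  have hsum : 0 < ∑ i, p i := by
    refine (Finset.sum_nonneg fun i _ => hp0 i).lt_of_ne fun h0 => ?_
    have hz : ∀ i, p i = 0 := fun i =>
      (Finset.sum_eq_zero_iff_of_nonneg fun i _ => hp0 i).1 h0.symm i (Finset.mem_univ i)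
    have := hneg _ (single_mem_stdSimplex ℝ i₀)
    rw [hf] at this
    simp [hz] at this
  have hmem : (fun i => (∑ i, p i)⁻¹ * p i) ∈ stdSimplex ℝ ι :=
    ⟨fun i => mul_nonneg (inv_nonneg.2 hsum.le) (hp0 i), by
      rw [← Finset.mul_sum, inv_mul_cancel₀ hsum.ne']⟩
  have h2 := hneg _ hmem
  have h3 : f (Φ fun i => (∑ i, p i)⁻¹ * p i)
      = (∑ i, p i)⁻¹ * ∑ i, ∑ j, p i * p j * inner ℝ (y i) (x i - x j) := by
    rw [hf]
    simp only [Φ, Finset.sum_mul, Finset.mul_sum]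
    exact Finset.sum_congr rfl fun i _ => Finset.sum_congr rfl fun j _ => by ring
  have h4 : 2 * ∑ i, ∑ j, p i * p j * inner ℝ (y i) (x i - x j)
      = ∑ i, ∑ j, p i * p j * inner ℝ (y i - y j) (x i - x j) := by
    rw [two_mul]
    conv_lhs => arg 2; rw [Finset.sum_comm]
    rw [← Finset.sum_add_distrib]
    refine Finset.sum_congr rfl fun i _ => ?_
    rw [← Finset.sum_add_distrib]
    refine Finset.sum_congr rfl fun j _ => ?_
    rw [inner_sub_left, ← neg_sub (x i) (x j), inner_neg_right]
    ring
  have h5 : 0 ≤ ∑ i, ∑ j, p i * p j * inner ℝ (y i - y j) (x i - x j) :=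
    Finset.sum_nonneg fun i _ => Finset.sum_nonneg fun j _ =>
      mul_nonneg (mul_nonneg (hp0 i) (hp0 j)) (hmono i j)
  rw [h3] at h2
  have h6 := (pos_iff_neg_of_mul_neg h2).1 (inv_pos.2 hsum)
  linarith

open Filter Topology in
/-- A continuous monotone map on a compact convex set solves the associated variational
inequality. -/
lemma exists_variational_inequality {E : Type*} [NormedAddCommGroup E] [InnerProductSpace ℝ E]
    {K : Set E} (hK : IsCompact K) (hKc : Convex ℝ K) (hne : K.Nonempty) {F : E → E}
    (hF : Continuous F) (hmono : ∀ x y, 0 ≤ inner ℝ (F x - F y) (x - y)) :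
    ∃ u ∈ K, ∀ v ∈ K, 0 ≤ inner ℝ (F u) (v - u) := by
  classical
  obtain ⟨x₀, hx₀⟩ := hne
  have hmin : (K ∩ ⋂ v : K, {u | 0 ≤ inner ℝ (F v) ((v : E) - u)}).Nonempty := by
    refine hK.inter_iInter_nonempty _ (fun v => ?_) fun s => ?_
    · exact isClosed_le continuous_const
        (continuous_const.inner (continuous_const.sub continuous_id))
    · let x : Option s → E := fun o => o.elim x₀ fun v => ((v : K) : E)
      have hxK : ∀ o, x o ∈ K := by
        rintro (_ | v)
        · exact hx₀
        · exact (v : K).2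
      obtain ⟨w, hw, h⟩ := exists_convexComb_inner_nonneg none x (fun i => F (x i))
        (fun i j => hmono _ _)
      refine ⟨∑ j, w j • x j, hKc.sum_mem (fun i _ => hw.1 i) hw.2 (fun i _ => hxK i), ?_⟩
      simp only [mem_iInter]
      intro v hv
      exact h (some ⟨v, hv⟩)
  obtain ⟨u, huK, hu⟩ := hmin
  simp only [mem_iInter, mem_ofPred_eq] at hu
  refine ⟨u, huK, fun v hv => ?_⟩
  -- Minty's trick: test on the segment from `u` to `v` and let the parameter tend to zero.
  have hseg : ∀ t ∈ Ioo (0 : ℝ) 1, 0 ≤ inner ℝ (F (u + t • (v - u))) (v - u) := by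
    intro t ht
    have h1 := hu ⟨u + t • (v - u), hKc.add_smul_sub_mem huK hv ⟨ht.1.le, ht.2.le⟩⟩
    simp only [add_sub_cancel_left, inner_smul_right] at h1
    exact nonneg_of_mul_nonneg_right h1 ht.1
  have hlim : Tendsto (fun t : ℝ => inner ℝ (F (u + t • (v - u))) (v - u)) (𝓝[>] 0)
      (𝓝 (inner ℝ (F u) (v - u))) := by
    have : Continuous fun t : ℝ => inner ℝ (F (u + t • (v - u))) (v - u) :=
      (hF.comp (continuous_const.add (continuous_id.smul continuous_const))).inner continuous_const
    have h2 := this.tendsto 0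
    simp only [zero_smul, add_zero] at h2
    exact h2.mono_left nhdsWithin_le_nhds
  exact ge_of_tendsto hlim
    (Filter.eventually_of_mem (Ioo_mem_nhdsGT zero_lt_one) hseg)

open Filter Topology in
/-- A continuous monotone map on a finite-dimensional space that points outwards somewhere on each
ray has a zero. -/
lemma exists_zero_of_monotone {E : Type*} [NormedAddCommGroup E] [InnerProductSpace ℝ E]
    [FiniteDimensional ℝ E] {F : E → E}
    (hF : Continuous F) (hmono : ∀ x y, 0 ≤ inner ℝ (F x - F y) (x - y))
    (hcoer : ∀ e, e ≠ 0 → ∃ t : ℝ, 0 < t ∧ 0 < inner ℝ (F (t • e)) e) : ∃ u, F u = 0 := by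
  have hray : ∀ (e : E) (t s : ℝ), t ≤ s → inner ℝ (F (t • e)) e ≤ inner ℝ (F (s • e)) e := by
    intro e t s hts
    rcases hts.eq_or_lt with rfl | hts
    · exact le_rfl
    have h := hmono (s • e) (t • e)
    rw [← sub_smul, inner_smul_right, inner_sub_left] at h
    have := nonneg_of_mul_nonneg_right h (sub_pos.2 hts)
    linarith
  obtain ⟨R, hR, hout⟩ : ∃ R : ℝ, 0 < R ∧ ∀ e ∈ Metric.sphere (0 : E) 1,
      ∀ s, R ≤ s → 0 < inner ℝ (F (s • e)) e := by
    refine (isCompact_sphere (0 : E) 1).induction_on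
      (p := fun S => ∃ R : ℝ, 0 < R ∧ ∀ e ∈ S, ∀ s, R ≤ s → 0 < inner ℝ (F (s • e)) e)
      ⟨1, one_pos, by simp⟩ ?_ ?_ ?_
    · rintro S S' hS ⟨R, hR, h⟩
      exact ⟨R, hR, fun e he => h e (hS he)⟩
    · rintro S S' ⟨R, hR, h⟩ ⟨R', hR', h'⟩
      refine ⟨max R R', lt_max_of_lt_left hR, fun e he s hs => ?_⟩
      rcases he with he | he
      · exact h e he s ((le_max_left _ _).trans hs)
      · exact h' e he s ((le_max_right _ _).trans hs)
    · intro e he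
      have he0 : e ≠ 0 := by
        rintro rfl
        simp at he
      obtain ⟨t, ht, hpos⟩ := hcoer e he0
      have hcont : Continuous fun e' : E => inner ℝ (F (t • e')) e' :=
        (hF.comp (continuous_const.smul continuous_id)).inner continuous_id
      refine ⟨{e' | 0 < inner ℝ (F (t • e')) e'},
        mem_nhdsWithin_of_mem_nhds ((isOpen_lt continuous_const hcont).mem_nhds hpos), t, ht, ?_⟩
      intro e' he' s hs
      exact lt_of_lt_of_le he' (hray e' t s hs)
  obtain ⟨u, huK, hu⟩ := exists_variational_inequality (isCompact_closedBall (0 : E) R)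
    (convex_closedBall 0 R) ⟨0, by simp [hR.le]⟩ hF hmono
  have hlt : ‖u‖ < R := by
    have huR : ‖u‖ ≤ R := by simpa using huK
    refine huR.lt_of_ne fun heq => ?_
    have h0 := hu 0 (by simp [hR.le])
    have hpos := hout (R⁻¹ • u) (by simp [norm_smul, heq, abs_of_pos hR, hR.ne']) R le_rfl
    rw [smul_smul, mul_inv_cancel₀ hR.ne', one_smul, inner_smul_right] at hpos
    rw [zero_sub, inner_neg_right] at h0
    have := pos_of_mul_pos_right hpos (inv_nonneg.2 hR.le)
    linarith
  refine ⟨u, ?_⟩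
  by_contra hne
  have hFpos : 0 < ‖F u‖ := norm_pos_iff.2 hne
  set s : ℝ := (R - ‖u‖) / ‖F u‖
  have hs : 0 < s := div_pos (sub_pos.2 hlt) hFpos
  have h1 := hu (u - s • F u) (by
    rw [mem_closedBall_zero_iff]
    calc ‖u - s • F u‖ ≤ ‖u‖ + ‖s • F u‖ := norm_sub_le _ _
      _ = R := by rw [norm_smul, Real.norm_of_nonneg hs.le, div_mul_cancel₀ _ hFpos.ne']; ring)
  rw [sub_sub_cancel_left, inner_neg_right, inner_smul_right, real_inner_self_eq_norm_sq] at h1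
  have : 0 < s * ‖F u‖ ^ 2 := by positivity
  linarith

/-- Existence and uniqueness for nonlinear equations `A u = ℓ` governed by a strictly monotone,
continuous and coercive form on a finite-dimensional space, with continuity expressed in
coordinates. -/
theorem existsUnique_of_strictMono_form {V : Type*} [AddCommGroup V] [Module ℝ V]
    [FiniteDimensional ℝ V] (A : V → V →ₗ[ℝ] ℝ) (ℓ : V →ₗ[ℝ] ℝ)
    (hcont : ∀ (n : ℕ) (e : EuclideanSpace ℝ (Fin n) →ₗ[ℝ] V) (w : V),
      Continuous fun c => A (e c) w)
    (hmono : ∀ u v, u ≠ v → 0 < A u (u - v) - A v (u - v))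
    (hcoer : ∀ u, u ≠ 0 → ∃ t : ℝ, 0 < t ∧ ℓ u < A (t • u) u) :
    ∃! u, ∀ w, A u w = ℓ w := by
  let b := Module.finBasis ℝ V
  let e : EuclideanSpace ℝ (Fin (Module.finrank ℝ V)) ≃ₗ[ℝ] V :=
    (WithLp.linearEquiv 2 ℝ _).trans b.equivFun.symm
  have he : ∀ c, e c = ∑ i, c i • b i := fun c => b.equivFun_symm_apply _
  let F : EuclideanSpace ℝ (Fin (Module.finrank ℝ V)) →
      EuclideanSpace ℝ (Fin (Module.finrank ℝ V)) :=
    fun c => WithLp.toLp 2 fun i => A (e c) (b i) - ℓ (b i)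
  have hF : ∀ c d, inner ℝ (F c) d = A (e c) (e d) - ℓ (e d) := by
    intro c d
    rw [he d, map_sum, map_sum, ← Finset.sum_sub_distrib]
    simp only [PiLp.inner_apply, map_smul, smul_eq_mul, F]
    exact Finset.sum_congr rfl fun i _ => by simp; ring
  have hmono' : ∀ u v, 0 ≤ A u (u - v) - A v (u - v) := by
    intro u v
    by_cases h : u = v
    · simp [h]
    · exact (hmono u v h).le
  obtain ⟨c, hc⟩ := exists_zero_of_monotone (F := F)
    (by
      refine (PiLp.continuous_toLp 2 _).comp (continuous_pi fun i => ?_)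
      exact (hcont _ e.toLinearMap (b i)).sub continuous_const)
    (fun x y => by
      rw [inner_sub_left, hF, hF, map_sub]
      have := hmono' (e x) (e y)
      linarith)
    (fun d hd => by
      obtain ⟨t, ht, h⟩ := hcoer (e d) (by simpa using hd)
      refine ⟨t, ht, ?_⟩
      rw [hF, map_smul]
      linarith)
  refine ⟨e c, fun w => ?_, fun u hu => ?_⟩
  · have := hF c (e.symm w)
    rw [hc] at this
    simp at this
    linarith
  · by_contra hne
    have hec : ∀ w, A (e c) w = ℓ w := fun w => by
      have := hF c (e.symm w)
      rw [hc] at this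
      simp at this
      linarith
    have := hmono u (e c) hne
    rw [hu, hec] at this
    linarith

/-! ### Polynomials on the plane -/

@[simp] lemma polyFun_zero : polyFun 0 = 0 := by ext x; simp [polyFun]
@[simp] lemma polyFun_add (p q : Poly) : polyFun (p + q) = polyFun p + polyFun q := by
  ext x; simp [polyFun]
@[simp] lemma polyFun_sub (p q : Poly) : polyFun (p - q) = polyFun p - polyFun q := by
  ext x; simp [polyFun]
@[simp] lemma polyFun_neg (p : Poly) : polyFun (-p) = -polyFun p := by
  ext x; simp [polyFun]
@[simp] lemma polyFun_mul (p q : Poly) : polyFun (p * q) = polyFun p * polyFun q := by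
  ext x; simp [polyFun]
@[simp] lemma polyFun_smul (a : ℝ) (p : Poly) : polyFun (a • p) = a • polyFun p := by
  ext x; simp [polyFun]
@[simp] lemma polyFun_C (a : ℝ) (x : Plane) : polyFun (MvPolynomial.C a) x = a := by
  simp [polyFun]
@[simp] lemma polyFun_X (i : Fin 2) (x : Plane) : polyFun (MvPolynomial.X i) x = x i := by
  simp [polyFun]
@[simp] lemma polyFun_one (x : Plane) : polyFun 1 x = 1 := by
  simp [polyFun]

lemma contDiff_polyFun (p : Poly) {n : WithTop ℕ∞} : ContDiff ℝ n (polyFun p) := by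
  induction p using MvPolynomial.induction_on with
  | C a =>
    have : polyFun (MvPolynomial.C a) = fun _ => a := by ext x; simp
    rw [this]; exact contDiff_const
  | add p q hp hq => rw [polyFun_add]; exact hp.add hq
  | mul_X p i hp =>
    rw [polyFun_mul]
    refine hp.mul ?_
    have : polyFun (MvPolynomial.X i) = fun x : Plane => x i := by ext x; simp
    rw [this]
    exact (EuclideanSpace.proj (𝕜 := ℝ) i).contDiff

lemma continuous_polyFun (p : Poly) : Continuous (polyFun p) :=
  (contDiff_polyFun p (n := 0)).continuous

lemma differentiable_polyFun (p : Poly) : Differentiable ℝ (polyFun p) :=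
  (contDiff_polyFun p (n := 1)).differentiable one_ne_zero

lemma partialDeriv_polyFun (i : Fin 2) (p : Poly) (x : Plane) :
    partialDeriv i (polyFun p) x = polyFun (MvPolynomial.pderiv i p) x := by
  unfold partialDeriv
  induction p using MvPolynomial.induction_on with
  | C a =>
    have : polyFun (MvPolynomial.C a) = fun _ => a := by ext x; simp
    rw [this]; simp
  | add p q hp hq =>
    rw [polyFun_add, fderiv_add (differentiable_polyFun p x) (differentiable_polyFun q x)]
    simp [hp, hq]
  | mul_X p j hp =>
    have hX : polyFun (MvPolynomial.X j) = EuclideanSpace.proj (𝕜 := ℝ) j := by ext x; simp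
    rw [polyFun_mul, fderiv_mul (differentiable_polyFun p x) (differentiable_polyFun _ x)]
    rw [hX, ContinuousLinearMap.fderiv]
    simp only [add_apply, smul_apply, hp,
      Derivation.leibniz, MvPolynomial.pderiv_X, PiLp.proj_apply, smul_eq_mul,
      polyFun_add, polyFun_mul, Pi.add_apply, Pi.mul_apply, polyFun_X, PiLp.single_apply,
      Pi.single_apply]
    by_cases h : i = j
    · subst h; simp
    · simp [Ne.symm h]

/-- A polynomial vanishing on a nonempty open set is zero. -/
lemma eq_zero_of_polyFun_eqOn_zero {E : Set Plane} (hE : IsOpen E) (hne : E.Nonempty) {p : Poly}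
    (h : ∀ x ∈ E, polyFun p x = 0) : p = 0 := by
  obtain ⟨x, hx⟩ := hne
  have hopen : IsOpen ((WithLp.toLp 2 : (Fin 2 → ℝ) → Plane) ⁻¹' E) :=
    hE.preimage (PiLp.continuous_toLp 2 _)
  obtain ⟨ε, hε, hball⟩ := Metric.isOpen_iff.1 hopen (WithLp.ofLp x) (by simpa using hx)
  refine MvPolynomial.funext_set (fun i => Metric.ball (x i) ε) (fun i => ?_) fun y hy => ?_
  · rw [Real.ball_eq_Ioo]
    exact Ioo_infinite (by linarith)
  · have hy' : y ∈ Metric.ball (WithLp.ofLp x) ε := by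
      rw [ball_pi _ hε]; exact hy
    simpa [polyFun] using h _ (hball hy')

lemma polyFun_injective : Function.Injective polyFun := by
  intro p q h
  have := eq_zero_of_polyFun_eqOn_zero isOpen_univ univ_nonempty (p := p - q)
    (fun x _ => by simp [h])
  exact sub_eq_zero.1 this

/-- The monomial `((x₀ - c₀)/h)^a ((x₁ - c₁)/h)^b` centred at `c` and scaled by `h`. -/
def shiftedMonomial (c : Plane) (h : ℝ) (a b : ℕ) : Poly :=
  (h⁻¹ • (MvPolynomial.X 0 - MvPolynomial.C (c 0))) ^ a *
    (h⁻¹ • (MvPolynomial.X 1 - MvPolynomial.C (c 1))) ^ b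

/-- The polynomials of degree less than `n`, as the span of the shifted monomials. -/
def polyLT (c : Plane) (h : ℝ) (n : ℕ) : Submodule ℝ Poly :=
  Submodule.span ℝ {q | ∃ a b, a + b < n ∧ q = shiftedMonomial c h a b}

lemma shiftedMonomial_mem {c : Plane} {h : ℝ} {a b n : ℕ} (hab : a + b < n) :
    shiftedMonomial c h a b ∈ polyLT c h n :=
  Submodule.subset_span ⟨a, b, hab, rfl⟩

lemma polyLT_mono (c : Plane) (h : ℝ) {m n : ℕ} (hmn : m ≤ n) : polyLT c h m ≤ polyLT c h n :=
  Submodule.span_mono fun _ ⟨a, b, hab, hq⟩ => ⟨a, b, hab.trans_le hmn, hq⟩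

lemma mul_mem_polyLT {c : Plane} {h : ℝ} {m n : ℕ} {p q : Poly} (hp : p ∈ polyLT c h (m + 1))
    (hq : q ∈ polyLT c h (n + 1)) : p * q ∈ polyLT c h (m + n + 1) := by
  have h1 := Submodule.mul_mem_mul hp hq
  rw [polyLT, polyLT, Submodule.span_mul_span] at h1
  refine Submodule.span_le.2 ?_ h1
  rintro _ ⟨_, ⟨a, b, hab, rfl⟩, _, ⟨a', b', hab', rfl⟩, rfl⟩
  have : shiftedMonomial c h a b * shiftedMonomial c h a' b'
      = shiftedMonomial c h (a + a') (b + b') := by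
    simp only [shiftedMonomial, pow_add]; ring
  simp only [this]
  exact shiftedMonomial_mem (by omega)

lemma totalDegree_shiftedMonomial_le (c : Plane) (h : ℝ) (a b : ℕ) :
    (shiftedMonomial c h a b).totalDegree ≤ a + b := by
  have h1 : ∀ i : Fin 2,
      (h⁻¹ • (MvPolynomial.X i - MvPolynomial.C (c i)) : Poly).totalDegree ≤ 1 := by
    intro i
    refine (MvPolynomial.totalDegree_smul_le _ _).trans
      ((MvPolynomial.totalDegree_sub _ _).trans ?_)
    simp
  refine (MvPolynomial.totalDegree_mul _ _).trans (add_le_add ?_ ?_)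
  · exact (MvPolynomial.totalDegree_pow _ _).trans (by nlinarith [h1 0])
  · exact (MvPolynomial.totalDegree_pow _ _).trans (by nlinarith [h1 1])

lemma mem_polyLT_iff {c : Plane} {h : ℝ} (hh : h ≠ 0) {n : ℕ} {p : Poly} :
    p ∈ polyLT c h (n + 1) ↔ p.totalDegree ≤ n := by
  constructor
  · intro hp
    rw [← MvPolynomial.mem_restrictTotalDegree]
    refine Submodule.span_le.2 ?_ hp
    rintro _ ⟨a, b, hab, rfl⟩
    rw [SetLike.mem_coe, MvPolynomial.mem_restrictTotalDegree]
    exact (totalDegree_shiftedMonomial_le c h a b).trans (by omega)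
  · intro hp
    have hone : ∀ n, (1 : Poly) ∈ polyLT c h (n + 1) := fun n => by
      have : (1 : Poly) = shiftedMonomial c h 0 0 := by simp [shiftedMonomial]
      rw [this]; exact shiftedMonomial_mem (by omega)
    have hX : ∀ i : Fin 2, (MvPolynomial.X i : Poly) ∈ polyLT c h (1 + 1) := by
      intro i
      have h1 : (MvPolynomial.X i : Poly)
          = h • (h⁻¹ • (MvPolynomial.X i - MvPolynomial.C (c i))) + c i • 1 := by
        rw [smul_smul, mul_inv_cancel₀ hh, one_smul, ← MvPolynomial.C_mul', mul_one]
        ring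
      rw [h1]
      refine add_mem (Submodule.smul_mem _ _ ?_) (Submodule.smul_mem _ _ (hone 1))
      fin_cases i
      · have : shiftedMonomial c h 1 0 = h⁻¹ • (MvPolynomial.X 0 - MvPolynomial.C (c 0)) := by
          simp [shiftedMonomial]
        exact this ▸ shiftedMonomial_mem (by omega)
      · have : shiftedMonomial c h 0 1 = h⁻¹ • (MvPolynomial.X 1 - MvPolynomial.C (c 1)) := by
          simp [shiftedMonomial]
        exact this ▸ shiftedMonomial_mem (by omega)
    have hpow : ∀ (i : Fin 2) (a : ℕ), (MvPolynomial.X i : Poly) ^ a ∈ polyLT c h (a + 1) := by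
      intro i a
      induction a with
      | zero => simpa using hone 0
      | succ a ih => rw [pow_succ]; exact mul_mem_polyLT ih (hX i)
    rw [p.as_sum]
    refine Submodule.sum_mem _ fun s hs => ?_
    have hs2 : s 0 + s 1 ≤ n := by
      have := (MvPolynomial.le_totalDegree hs).trans hp
      rwa [Finsupp.sum_fintype _ _ (fun _ => rfl), Fin.sum_univ_two] at this
    rw [MvPolynomial.monomial_eq, Finsupp.prod_fintype _ _ (fun _ => pow_zero _), Fin.prod_univ_two,
      MvPolynomial.C_mul']
    exact Submodule.smul_mem _ _
      (polyLT_mono c h (by omega) (mul_mem_polyLT (hpow 0 (s 0)) (hpow 1 (s 1))))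

lemma pderiv_shiftedMonomial_zero (c : Plane) (h : ℝ) (a b : ℕ) :
    MvPolynomial.pderiv 0 (shiftedMonomial c h a b)
      = (a * h⁻¹) • shiftedMonomial c h (a - 1) b := by
  simp [shiftedMonomial, Derivation.leibniz, Derivation.leibniz_pow, MvPolynomial.pderiv_X,
    MvPolynomial.smul_eq_C_mul]
  ring

lemma pderiv_shiftedMonomial_one (c : Plane) (h : ℝ) (a b : ℕ) :
    MvPolynomial.pderiv 1 (shiftedMonomial c h a b)
      = (b * h⁻¹) • shiftedMonomial c h a (b - 1) := by
  simp [shiftedMonomial, Derivation.leibniz, Derivation.leibniz_pow, MvPolynomial.pderiv_X,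
    MvPolynomial.smul_eq_C_mul]
  ring

lemma pderiv_mem_polyLT {c : Plane} {h : ℝ} {n : ℕ} {p : Poly} (hp : p ∈ polyLT c h n)
    (i : Fin 2) : MvPolynomial.pderiv i p ∈ polyLT c h (n - 1) := by
  have : polyLT c h n ≤ (polyLT c h (n - 1)).comap (MvPolynomial.pderiv i).toLinearMap := by
    refine Submodule.span_le.2 ?_
    rintro _ ⟨a, b, hab, rfl⟩
    simp only [SetLike.mem_coe, Submodule.mem_comap, Derivation.coeFn_coe]
    fin_cases i
    · simp only [Fin.zero_eta]
      rw [pderiv_shiftedMonomial_zero]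
      rcases a with _ | a
      · simp
      · exact Submodule.smul_mem _ _ (shiftedMonomial_mem (by omega))
    · simp only [Fin.mk_one]
      rw [pderiv_shiftedMonomial_one]
      rcases b with _ | b
      · simp
      · exact Submodule.smul_mem _ _ (shiftedMonomial_mem (by omega))
  exact this hp

/-- The components of the field `(x - c)^⊥` as polynomials. -/
def perpPoly (c : Plane) : Fin 2 → Poly :=
  ![MvPolynomial.X 1 - MvPolynomial.C (c 1), -(MvPolynomial.X 0 - MvPolynomial.C (c 0))]

lemma polyFun_perpPoly (c : Plane) (j : Fin 2) (x : Plane) :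
    polyFun (perpPoly c j) x = perp (x - c) j := by
  fin_cases j <;> simp [perpPoly, perp]

lemma perpPoly_zero_mul {c : Plane} {h : ℝ} (hh : h ≠ 0) (a b : ℕ) :
    perpPoly c 0 * shiftedMonomial c h a b = h • shiftedMonomial c h a (b + 1) := by
  have : perpPoly c 0 = h • (h⁻¹ • (MvPolynomial.X 1 - MvPolynomial.C (c 1))) := by
    rw [smul_smul, mul_inv_cancel₀ hh, one_smul]; rfl
  rw [this, shiftedMonomial, shiftedMonomial, smul_mul_assoc, pow_succ]
  congr 1
  ring

lemma perpPoly_one_mul {c : Plane} {h : ℝ} (hh : h ≠ 0) (a b : ℕ) :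
    perpPoly c 1 * shiftedMonomial c h a b = -(h • shiftedMonomial c h (a + 1) b) := by
  have : perpPoly c 1 = -(h • (h⁻¹ • (MvPolynomial.X 0 - MvPolynomial.C (c 0)))) := by
    rw [smul_smul, mul_inv_cancel₀ hh, one_smul]; rfl
  rw [this, shiftedMonomial, shiftedMonomial, neg_mul, smul_mul_assoc, pow_succ]
  congr 2
  ring

/-- Polynomial vector fields split as `P_m² = ∇ P_{m+1} + (x - c)^⊥ P_{m-1}`. On homogeneous
fields this is Euler's identity. -/
lemma exists_grad_add_perp {c : Plane} {h : ℝ} (hh : h ≠ 0) {n : ℕ} (F : Fin 2 → Poly)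
    (hF : ∀ j, F j ∈ polyLT c h n) :
    ∃ s : Poly, ∃ t ∈ polyLT c h (n - 1),
      ∀ j, F j = MvPolynomial.pderiv j s + perpPoly c j * t := by
  let S : Submodule ℝ (Fin 2 → Poly) :=
    { carrier := {F | ∃ s : Poly, ∃ t ∈ polyLT c h (n - 1),
        ∀ j, F j = MvPolynomial.pderiv j s + perpPoly c j * t}
      zero_mem' := ⟨0, 0, zero_mem _, by simp⟩
      add_mem' := by
        rintro F G ⟨s, t, ht, hF⟩ ⟨s', t', ht', hG⟩
        refine ⟨s + s', t + t', add_mem ht ht', fun j => ?_⟩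
        simp only [Pi.add_apply, hF, hG, map_add]; ring
      smul_mem' := by
        rintro r F ⟨s, t, ht, hF⟩
        refine ⟨r • s, r • t, Submodule.smul_mem _ _ ht, fun j => ?_⟩
        simp only [Pi.smul_apply, hF, Derivation.map_smul, smul_add, mul_smul_comm] }
  have hsing : ∀ i : Fin 2, ∀ p ∈ polyLT c h n, (Pi.single i p : Fin 2 → Poly) ∈ S := by
    intro i
    suffices polyLT c h n ≤ S.comap (LinearMap.single ℝ (fun _ : Fin 2 => Poly) i) from
      fun p hp => this hp
    refine Submodule.span_le.2 ?_
    rintro _ ⟨a, b, hab, rfl⟩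
    simp only [SetLike.mem_coe, Submodule.mem_comap, LinearMap.coe_single]
    fin_cases i
    · refine ⟨(h / (a + b + 1 : ℝ)) • shiftedMonomial c h (a + 1) b,
        ((b : ℝ) / (a + b + 1) * h⁻¹) • shiftedMonomial c h a (b - 1), ?_, ?_⟩
      · rcases b with _ | b
        · simp
        · exact Submodule.smul_mem _ _ (shiftedMonomial_mem (by omega))
      · rw [Fin.forall_fin_two]
        constructor
        · rcases b with _ | b <;>
          simp only [Fin.zero_eta, Pi.single_eq_same, Derivation.map_smul,
            pderiv_shiftedMonomial_zero, Nat.add_sub_cancel, mul_smul_comm,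
            perpPoly_zero_mul hh] <;> match_scalars <;> field_simp <;> ring
        · rcases b with _ | b <;>
          simp only [Fin.zero_eta, Pi.single_eq_of_ne one_ne_zero, Derivation.map_smul,
            pderiv_shiftedMonomial_one, Nat.add_sub_cancel, mul_smul_comm,
            perpPoly_one_mul hh] <;> match_scalars <;> field_simp <;> ring
    · refine ⟨(h / (a + b + 1 : ℝ)) • shiftedMonomial c h a (b + 1),
        (-((a : ℝ) / (a + b + 1) * h⁻¹)) • shiftedMonomial c h (a - 1) b, ?_, ?_⟩
      · rcases a with _ | a
        · simp
        · exact Submodule.smul_mem _ _ (shiftedMonomial_mem (by omega))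
      · rw [Fin.forall_fin_two]
        constructor
        · rcases a with _ | a <;>
          simp only [Fin.mk_one, Pi.single_eq_of_ne zero_ne_one, Derivation.map_smul,
            pderiv_shiftedMonomial_zero, Nat.add_sub_cancel, mul_smul_comm,
            perpPoly_zero_mul hh] <;> match_scalars <;> field_simp <;> ring
        · rcases a with _ | a <;>
          simp only [Fin.mk_one, Pi.single_eq_same, Derivation.map_smul,
            pderiv_shiftedMonomial_one, Nat.add_sub_cancel, mul_smul_comm,
            perpPoly_one_mul hh] <;> match_scalars <;> field_simp <;> ring
  have hdec : F = ∑ i, Pi.single i (F i) := (Finset.univ_sum_single F).symm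
  have hmem : F ∈ S := by
    rw [hdec]
    exact Submodule.sum_mem _ fun i _ => hsing i _ (hF i)
  exact hmem

/-! ### Integration against polynomials -/

/-- A nonempty bounded open subset of the plane. -/
structure IsBddOpen (E : Set Plane) : Prop where
  isOpen : IsOpen E
  isBounded : Bornology.IsBounded E
  nonempty : E.Nonempty

lemma IsBddOpen.measurableSet {E : Set Plane} (hE : IsBddOpen E) : MeasurableSet E :=
  hE.isOpen.measurableSet

lemma IsBddOpen.isCompact_closure {E : Set Plane} (hE : IsBddOpen E) : IsCompact (closure E) :=
  hE.isBounded.isCompact_closure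

lemma IsBddOpen.volume_ne_top {E : Set Plane} (hE : IsBddOpen E) : volume E ≠ ⊤ :=
  hE.isBounded.measure_lt_top.ne

lemma IsBddOpen.isFiniteMeasure {E : Set Plane} (hE : IsBddOpen E) :
    IsFiniteMeasure (volume.restrict E) :=
  isFiniteMeasure_restrict.2 hE.volume_ne_top

lemma IsBddOpen.integrableOn_of_memLp {E : Set Plane} (hE : IsBddOpen E) {f : Plane → ℝ}
    (hf : MemLp f 2 (volume.restrict E)) : IntegrableOn f E :=
  have := hE.isFiniteMeasure
  hf.integrable one_le_two

lemma IsBddOpen.integrableOn_of_continuousOn {E : Set Plane} (hE : IsBddOpen E) {f : Plane → ℝ}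
    (hf : ContinuousOn f (closure E)) : IntegrableOn f E :=
  (hf.integrableOn_compact hE.isCompact_closure).mono_set subset_closure

lemma IsBddOpen.integrableOn_continuousOn_mul {E : Set Plane} (hE : IsBddOpen E) {f g : Plane → ℝ}
    (hg : ContinuousOn g (closure E)) (hf : IntegrableOn f E) :
    IntegrableOn (fun x => g x * f x) E :=
  hf.continuousOn_mul_of_subset hg hE.isCompact_closure hE.measurableSet subset_closure

lemma IsBddOpen.memLp_of_continuousOn {E : Set Plane} (hE : IsBddOpen E) {f : Plane → ℝ}
    (hf : ContinuousOn f (closure E)) : MemLp f 2 (volume.restrict E) := by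
  have := hE.isFiniteMeasure
  obtain ⟨C, hC⟩ := hE.isCompact_closure.exists_bound_of_continuousOn hf
  exact MemLp.of_bound ((hf.mono subset_closure).aestronglyMeasurable hE.measurableSet) C
    (ae_restrict_of_forall_mem hE.measurableSet fun x hx => hC x (subset_closure hx))

lemma IsBddOpen.integrableOn_polyFun {E : Set Plane} (hE : IsBddOpen E) (p : Poly) :
    IntegrableOn (polyFun p) E :=
  hE.integrableOn_of_continuousOn (continuous_polyFun p).continuousOn

lemma IsBddOpen.integrableOn_polyFun_mul {E : Set Plane} (hE : IsBddOpen E) (p : Poly)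
    {f : Plane → ℝ} (hf : IntegrableOn f E) : IntegrableOn (fun x => polyFun p x * f x) E :=
  hE.integrableOn_continuousOn_mul (continuous_polyFun p).continuousOn hf

/-- A continuous function that vanishes almost everywhere on an open set vanishes there. -/
lemma IsBddOpen.eq_zero_of_ae {E : Set Plane} (hE : IsBddOpen E) {f : Plane → ℝ}
    (hf : ContinuousOn f E) (h : f =ᵐ[volume.restrict E] 0) : ∀ x ∈ E, f x = 0 :=
  fun _ hx => Measure.eqOn_open_of_ae_eq h hE.isOpen hf continuousOn_const hx

lemma IsBddOpen.eq_zero_of_integral_eq_zero {E : Set Plane} (hE : IsBddOpen E) {f : Plane → ℝ}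
    (hf : ContinuousOn f E) (hint : IntegrableOn f E) (h0 : ∀ x, 0 ≤ f x)
    (h : ∫ x in E, f x = 0) : ∀ x ∈ E, f x = 0 :=
  hE.eq_zero_of_ae hf ((integral_eq_zero_iff_of_nonneg h0 hint).1 h)

lemma IsBddOpen.poly_eq_zero_of_integral_mul_self {E : Set Plane} (hE : IsBddOpen E) {p : Poly}
    (h : ∫ x in E, polyFun p x * polyFun p x = 0) : p = 0 := by
  refine eq_zero_of_polyFun_eqOn_zero hE.isOpen hE.nonempty fun x hx => ?_
  have := hE.eq_zero_of_integral_eq_zero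
    ((continuous_polyFun p).mul (continuous_polyFun p)).continuousOn
    (hE.integrableOn_polyFun_mul p (hE.integrableOn_polyFun p)) (fun x => mul_self_nonneg _) h x hx
  exact mul_self_eq_zero.1 this

/-- A positive definite bilinear form on a finite-dimensional space represents every linear
functional. -/
lemma exists_bilin_eq {V : Type*} [AddCommGroup V] [Module ℝ V] [FiniteDimensional ℝ V]
    (B : V →ₗ[ℝ] V →ₗ[ℝ] ℝ) (hB : ∀ v, B v v = 0 → v = 0) (ℓ : V →ₗ[ℝ] ℝ) :
    ∃ v, B v = ℓ := by
  have hinj : Function.Injective B := by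
    rw [← LinearMap.ker_eq_bot, LinearMap.ker_eq_bot']
    intro v hv
    exact hB v (by rw [hv]; rfl)
  exact (LinearMap.injective_iff_surjective_of_finrank_eq_finrank
    Subspace.dual_finrank_eq.symm).1 hinj ℓ

/-! ### The `L²`-projection -/

/-- Nondegeneracy of the `L²`-pairing on the polynomials yields the projection of every integrable
function. -/
lemma IsBddOpen.exists_isL2Proj {E : Set Plane} (hE : IsBddOpen E) (n : ℕ) {f : Plane → ℝ}
    (hf : IntegrableOn f E) : ∃ p, IsL2Proj E n f p := by
  let V := MvPolynomial.restrictTotalDegree (Fin 2) ℝ n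
  have hI := fun p q : V =>
    hE.integrableOn_polyFun_mul (q : Poly) (hE.integrableOn_polyFun (p : Poly))
  have hIf := fun q : V => hE.integrableOn_polyFun_mul (q : Poly) hf
  let B : V →ₗ[ℝ] V →ₗ[ℝ] ℝ := LinearMap.mk₂ ℝ
    (fun p q => ∫ x in E, polyFun (q : Poly) x * polyFun (p : Poly) x)
    (fun p p' q => by
      rw [← integral_add (hI p q) (hI p' q)]
      exact integral_congr_ae (.of_forall fun x => by simp [mul_add]))
    (fun c p q => by
      rw [smul_eq_mul, ← integral_const_mul]
      exact integral_congr_ae (.of_forall fun x => by simp; ring))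
    (fun p q q' => by
      rw [← integral_add (hI p q) (hI p q')]
      exact integral_congr_ae (.of_forall fun x => by simp [add_mul]))
    (fun c p q => by
      rw [smul_eq_mul, ← integral_const_mul]
      exact integral_congr_ae (.of_forall fun x => by simp; ring))
  let ℓ : V →ₗ[ℝ] ℝ :=
    { toFun := fun q => ∫ x in E, polyFun (q : Poly) x * f x
      map_add' := fun q q' => by
        rw [← integral_add (hIf q) (hIf q')]
        exact integral_congr_ae (.of_forall fun x => by simp [add_mul])
      map_smul' := fun c q => by
        rw [RingHom.id_apply, smul_eq_mul, ← integral_const_mul]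
        exact integral_congr_ae (.of_forall fun x => by simp; ring) }
  obtain ⟨p, hp⟩ := exists_bilin_eq B
    (fun v hv => Subtype.ext (hE.poly_eq_zero_of_integral_mul_self hv)) ℓ
  refine ⟨p, (MvPolynomial.mem_restrictTotalDegree _ _ _).1 p.2, fun q hq => ?_⟩
  have h := LinearMap.congr_fun hp ⟨q, (MvPolynomial.mem_restrictTotalDegree _ _ _).2 hq⟩
  have h' : ∫ x in E, polyFun q x * polyFun (p : Poly) x = ∫ x in E, polyFun q x * f x := h
  simp only [mul_sub]
  rw [integral_sub (hE.integrableOn_polyFun_mul q hf)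
    (hE.integrableOn_polyFun_mul q (hE.integrableOn_polyFun _)), h', sub_self]

lemma IsL2Proj.smul_add {E : Set Plane} (hE : IsBddOpen E) {n : ℕ} {f g : Plane → ℝ} {p q : Poly}
    (hf : IntegrableOn f E) (hg : IntegrableOn g E) (hp : IsL2Proj E n f p)
    (hq : IsL2Proj E n g q) (a b : ℝ) : IsL2Proj E n (a • f + b • g) (a • p + b • q) := by
  refine ⟨?_, fun s hs => ?_⟩
  · have := (MvPolynomial.restrictTotalDegree (Fin 2) ℝ n).add_mem
      (Submodule.smul_mem _ a ((MvPolynomial.mem_restrictTotalDegree _ _ _).2 hp.1))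
      (Submodule.smul_mem _ b ((MvPolynomial.mem_restrictTotalDegree _ _ _).2 hq.1))
    exact (MvPolynomial.mem_restrictTotalDegree _ _ _).1 this
  · have e : ∀ x, polyFun s x * ((a • f + b • g) x - polyFun (a • p + b • q) x)
        = a * (polyFun s x * (f x - polyFun p x)) + b * (polyFun s x * (g x - polyFun q x)) := by
      intro x; simp; ring
    simp only [e]
    rw [integral_add, integral_const_mul, integral_const_mul, hp.2 s hs, hq.2 s hs]
    · simp
    · exact (hE.integrableOn_polyFun_mul s (hf.sub (hE.integrableOn_polyFun p))).const_mul a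
    · exact (hE.integrableOn_polyFun_mul s (hg.sub (hE.integrableOn_polyFun q))).const_mul b

lemma IsL2Proj.congr {E : Set Plane} {n : ℕ} {f g : Plane → ℝ} {p : Poly}
    (hp : IsL2Proj E n f p) (h : f =ᵐ[volume.restrict E] g) : IsL2Proj E n g p := by
  refine ⟨hp.1, fun q hq => ?_⟩
  rw [← hp.2 q hq]
  exact integral_congr_ae (h.mono fun x hx => by simp only [hx])

lemma isL2Proj_polyFun (E : Set Plane) {n : ℕ} {p : Poly} (hp : p.totalDegree ≤ n) :
    IsL2Proj E n (polyFun p) p := ⟨hp, fun q _ => by simp⟩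

lemma IsL2Proj.unique {E : Set Plane} (hE : IsBddOpen E) {n : ℕ} {f : Plane → ℝ} {p q : Poly}
    (hf : IntegrableOn f E) (hp : IsL2Proj E n f p) (hq : IsL2Proj E n f q) : p = q := by
  have h := hp.smul_add hE hf hf hq 1 (-1)
  have h2 := h.2 _ h.1
  rw [← sub_eq_zero]
  have e : (1 : ℝ) • p + (-1 : ℝ) • q = p - q := by module
  rw [e] at h2
  refine hE.poly_eq_zero_of_integral_mul_self ?_
  rw [← neg_eq_zero, ← integral_neg, ← h2]
  exact integral_congr_ae (.of_forall fun x => by simp; ring)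

lemma IsL2Proj.l2Proj_eq {E : Set Plane} (hE : IsBddOpen E) {n : ℕ} {f : Plane → ℝ} {p : Poly}
    (hf : IntegrableOn f E) (hp : IsL2Proj E n f p) : l2Proj E n f = polyFun p := by
  have h : ∃ p, IsL2Proj E n f p := ⟨p, hp⟩
  rw [l2Proj, dif_pos h, h.choose_spec.unique hE hf hp]

/-- The `L²`-projection is a polynomial function, even where it takes its default value. -/
lemma exists_l2Proj_eq_polyFun (E : Set Plane) (n : ℕ) (f : Plane → ℝ) :
    ∃ p : Poly, p.totalDegree ≤ n ∧ l2Proj E n f = polyFun p := by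
  by_cases h : ∃ p, IsL2Proj E n f p
  · exact ⟨_, h.choose_spec.1, by rw [l2Proj, dif_pos h]⟩
  · exact ⟨0, by simp, by rw [l2Proj, dif_neg h, polyFun_zero]⟩

lemma continuous_l2Proj (E : Set Plane) (n : ℕ) (f : Plane → ℝ) : Continuous (l2Proj E n f) := by
  obtain ⟨p, -, hp⟩ := exists_l2Proj_eq_polyFun E n f
  rw [hp]; exact continuous_polyFun p

lemma l2Proj_smul_add {E : Set Plane} (hE : IsBddOpen E) (n : ℕ) {f g : Plane → ℝ}
    (hf : IntegrableOn f E) (hg : IntegrableOn g E) (a b : ℝ) :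
    l2Proj E n (a • f + b • g) = a • l2Proj E n f + b • l2Proj E n g := by
  obtain ⟨p, hp⟩ := hE.exists_isL2Proj n hf
  obtain ⟨q, hq⟩ := hE.exists_isL2Proj n hg
  rw [(hp.smul_add hE hf hg hq a b).l2Proj_eq hE ((hf.smul a).add (hg.smul b)),
    hp.l2Proj_eq hE hf, hq.l2Proj_eq hE hg]
  simp

lemma l2Proj_congr {E : Set Plane} (hE : IsBddOpen E) (n : ℕ) {f g : Plane → ℝ}
    (hf : IntegrableOn f E) (h : f =ᵐ[volume.restrict E] g) : l2Proj E n f = l2Proj E n g := by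
  obtain ⟨p, hp⟩ := hE.exists_isL2Proj n hf
  rw [hp.l2Proj_eq hE hf, (hp.congr h).l2Proj_eq hE (hf.congr h)]

/-! ### Weak derivatives -/

lemma IsTestFunction.continuous {E : Set Plane} {φ : Plane → ℝ} (h : IsTestFunction E φ) :
    Continuous φ := h.smooth.continuous

lemma continuous_partialDeriv {φ : Plane → ℝ} (h : ContDiff ℝ 1 φ) (i : Fin 2) :
    Continuous (partialDeriv i φ) :=
  (h.continuous_fderiv one_ne_zero).clm_apply continuous_const

lemma IsTestFunction.continuous_partialDeriv {E : Set Plane} {φ : Plane → ℝ}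
    (h : IsTestFunction E φ) (i : Fin 2) : Continuous (partialDeriv i φ) :=
  VEM.continuous_partialDeriv (h.smooth.of_le (by norm_cast)) i

lemma IsTestFunction.differentiable {E : Set Plane} {φ : Plane → ℝ} (h : IsTestFunction E φ) :
    Differentiable ℝ φ := h.smooth.differentiable (by simp)

lemma IsTestFunction.eq_zero {E : Set Plane} {φ : Plane → ℝ} (h : IsTestFunction E φ) {x : Plane}
    (hx : x ∉ E) : φ x = 0 := image_eq_zero_of_notMem_tsupport fun hx' => hx (h.support hx')

lemma partialDeriv_eq_zero {φ : Plane → ℝ} (i : Fin 2) {x : Plane}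
    (hx : x ∉ tsupport φ) : partialDeriv i φ x = 0 := by
  rw [partialDeriv, image_eq_zero_of_notMem_tsupport fun h => hx (tsupport_fderiv_subset ℝ h)]
  rfl

lemma IsTestFunction.partialDeriv_eq_zero {E : Set Plane} {φ : Plane → ℝ}
    (h : IsTestFunction E φ) (i : Fin 2) {x : Plane} (hx : x ∉ E) : partialDeriv i φ x = 0 :=
  VEM.partialDeriv_eq_zero i fun hx' => hx (h.support hx')

/-- Integration by parts of a `C¹` function against a test function. -/
lemma IsTestFunction.integral_mul_partialDeriv {E : Set Plane} {φ f : Plane → ℝ}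
    (h : IsTestFunction E φ) (hf : ContDiff ℝ 1 f) (i : Fin 2) :
    ∫ x in E, f x * partialDeriv i φ x = -∫ x in E, partialDeriv i f x * φ x := by
  have hcs : HasCompactSupport (partialDeriv i φ) :=
    h.compact.mono' fun x hx => by
      by_contra hx'
      exact hx (VEM.partialDeriv_eq_zero i hx')
  rw [setIntegral_eq_integral_of_forall_compl_eq_zero
      (fun x hx => by rw [h.partialDeriv_eq_zero i hx, mul_zero]),
    setIntegral_eq_integral_of_forall_compl_eq_zero (fun x hx => by rw [h.eq_zero hx, mul_zero])]
  refine integral_mul_fderiv_eq_neg_fderiv_mul_of_integrable ?_ ?_ ?_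
    (fun x _ => hf.differentiable one_ne_zero x) (fun x _ => h.differentiable x)
  · exact ((VEM.continuous_partialDeriv hf i).mul h.continuous).integrable_of_hasCompactSupport
      h.compact.mul_left
  · exact (hf.continuous.mul (h.continuous_partialDeriv i)).integrable_of_hasCompactSupport
      hcs.mul_left
  · exact (hf.continuous.mul h.continuous).integrable_of_hasCompactSupport h.compact.mul_left

lemma IsBddOpen.isWeakPartial_of_contDiff {E : Set Plane} (hE : IsBddOpen E) {f : Plane → ℝ}
    (hf : ContDiff ℝ 1 f) (i : Fin 2) : IsWeakPartial E i f (partialDeriv i f) :=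
  ⟨hE.memLp_of_continuousOn (continuous_partialDeriv hf i).continuousOn,
    fun _ hφ => hφ.integral_mul_partialDeriv hf i⟩

lemma IsWeakPartial.smul_add {E : Set Plane} (hE : IsBddOpen E) {i : Fin 2}
    {f g f' g' : Plane → ℝ} (hf : IntegrableOn f E) (hg : IntegrableOn g E)
    (h : IsWeakPartial E i f f') (h' : IsWeakPartial E i g g') (a b : ℝ) :
    IsWeakPartial E i (a • f + b • g) (a • f' + b • g') := by
  refine ⟨(h.1.const_smul a).add (h'.1.const_smul b), fun φ hφ => ?_⟩
  have I1 : ∀ {u : Plane → ℝ}, IntegrableOn u E →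
      IntegrableOn (fun x => u x * partialDeriv i φ x) E := fun hu => by
    simpa only [mul_comm] using
      hE.integrableOn_continuousOn_mul (hφ.continuous_partialDeriv i).continuousOn hu
  have I2 : ∀ {u : Plane → ℝ}, IntegrableOn u E →
      IntegrableOn (fun x => u x * φ x) E := fun hu => by
    simpa only [mul_comm] using hE.integrableOn_continuousOn_mul hφ.continuous.continuousOn hu
  simp only [Pi.add_apply, Pi.smul_apply, smul_eq_mul, add_mul, mul_assoc]
  rw [integral_add ((I1 hf).const_mul a) ((I1 hg).const_mul b),
    integral_add ((I2 (hE.integrableOn_of_memLp h.1)).const_mul a)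
      ((I2 (hE.integrableOn_of_memLp h'.1)).const_mul b)]
  simp only [integral_const_mul, h.2 φ hφ, h'.2 φ hφ]
  ring

lemma IsWeakPartial.ae_eq {E : Set Plane} (hE : IsBddOpen E) {i : Fin 2} {f g g' : Plane → ℝ}
    (h : IsWeakPartial E i f g) (h' : IsWeakPartial E i f g') :
    g =ᵐ[volume.restrict E] g' := by
  have hg := hE.integrableOn_of_memLp h.1
  have hg' := hE.integrableOn_of_memLp h'.1
  have key : ∀ᵐ x ∂volume, x ∈ E → (g - g') x = 0 := by
    refine hE.isOpen.ae_eq_zero_of_integral_contDiff_smul_eq_zero (hg.sub hg').locallyIntegrableOn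
      fun φ h1 h2 h3 => ?_
    have hφ : IsTestFunction E φ := ⟨h1, h2, h3⟩
    rw [← setIntegral_eq_integral_of_forall_compl_eq_zero (s := E)
      (fun x hx => by rw [hφ.eq_zero hx, zero_smul])]
    have e : ∀ x, φ x • (g - g') x = φ x * g x - φ x * g' x := fun x => by simp [mul_sub]
    simp only [e]
    rw [integral_sub (hE.integrableOn_continuousOn_mul hφ.continuous.continuousOn hg)
      (hE.integrableOn_continuousOn_mul hφ.continuous.continuousOn hg')]
    have h4 := h.2 φ hφ
    rw [h'.2 φ hφ] at h4
    simp only [mul_comm (φ _)]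
    linarith
  rw [Filter.EventuallyEq, ae_restrict_iff' hE.measurableSet]
  filter_upwards [key] with x hx hxE
  exact sub_eq_zero.1 (hx hxE)

lemma MemW12.isWeakPartial {E : Set Plane} {f : Plane → ℝ} (h : MemW12 E f) (i : Fin 2) :
    IsWeakPartial E i f (weakPartial E i f) := by
  rw [weakPartial, dif_pos (h.2 i)]
  exact (h.2 i).choose_spec

lemma IsWeakPartial.weakPartial_ae_eq {E : Set Plane} (hE : IsBddOpen E) {i : Fin 2}
    {f g : Plane → ℝ} (h : IsWeakPartial E i f g) :
    weakPartial E i f =ᵐ[volume.restrict E] g := by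
  have h' : ∃ g, IsWeakPartial E i f g := ⟨g, h⟩
  rw [weakPartial, dif_pos h']
  exact h'.choose_spec.ae_eq hE h

lemma IsBddOpen.memW12_polyFun {E : Set Plane} (hE : IsBddOpen E) (p : Poly) :
    MemW12 E (polyFun p) :=
  ⟨hE.memLp_of_continuousOn (continuous_polyFun p).continuousOn,
    fun i => ⟨_, hE.isWeakPartial_of_contDiff (contDiff_polyFun p) i⟩⟩

lemma IsBddOpen.weakPartial_polyFun {E : Set Plane} (hE : IsBddOpen E) (p : Poly) (i : Fin 2) :
    weakPartial E i (polyFun p) =ᵐ[volume.restrict E] polyFun (MvPolynomial.pderiv i p) := by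
  have := (hE.isWeakPartial_of_contDiff (contDiff_polyFun p) i).weakPartial_ae_eq hE
  rwa [show partialDeriv i (polyFun p) = polyFun (MvPolynomial.pderiv i p) from
    funext (partialDeriv_polyFun i p)] at this

lemma MemW12.smul_add {E : Set Plane} (hE : IsBddOpen E) {f g : Plane → ℝ} (hf : MemW12 E f)
    (hg : MemW12 E g) (a b : ℝ) : MemW12 E (a • f + b • g) :=
  ⟨(hf.1.const_smul a).add (hg.1.const_smul b), fun i =>
    ⟨_, (hf.isWeakPartial i).smul_add hE (hE.integrableOn_of_memLp hf.1)
      (hE.integrableOn_of_memLp hg.1) (hg.isWeakPartial i) a b⟩⟩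

lemma weakPartial_smul_add {E : Set Plane} (hE : IsBddOpen E) {f g : Plane → ℝ} (hf : MemW12 E f)
    (hg : MemW12 E g) (a b : ℝ) (i : Fin 2) :
    weakPartial E i (a • f + b • g) =ᵐ[volume.restrict E]
      a • weakPartial E i f + b • weakPartial E i g :=
  ((hf.isWeakPartial i).smul_add hE (hE.integrableOn_of_memLp hf.1)
      (hE.integrableOn_of_memLp hg.1) (hg.isWeakPartial i) a b).weakPartial_ae_eq hE

/-! ### Mollification -/

open Filter Topology in
/-- Translations are continuous in `L²`. -/
lemma exists_eLpNorm_translation_sub_le {g : Plane → ℝ} (hg : MemLp g 2 volume) {ε : ℝ}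
    (hε : 0 < ε) :
    ∃ η > 0, ∀ y : Plane, ‖y‖ < η →
      eLpNorm (fun x => g (x - y) - g x) 2 volume ≤ ENNReal.ofReal ε := by
  have : Fact ((2 : ENNReal) ≠ ⊤) := ⟨by simp⟩
  have hcont : Continuous fun y : Plane =>
      (DomAddAct.mk y +ᵥ hg.toLp g : Lp ℝ 2 (volume : Measure Plane)) :=
    Continuous.vadd DomAddAct.continuous_mk continuous_const
  have h0 := (Metric.continuous_iff.1 hcont) 0 ε hε
  obtain ⟨η, hη, h⟩ := h0
  refine ⟨η, hη, fun y hy => ?_⟩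
  have h1 := h (-y) (by simpa using hy)
  rw [DomAddAct.mk_vadd_toLp, DomAddAct.mk_vadd_toLp, Lp.dist_def] at h1
  have m1 := hg.comp_measurePreserving (measurePreserving_vadd (-y) volume)
  have m2 := hg.comp_measurePreserving (measurePreserving_vadd (0 : Plane) volume)
  have h2 : eLpNorm (fun x => g (x - y) - g x) 2 volume
      = eLpNorm (⇑(m1.toLp _) - ⇑(m2.toLp _)) 2 volume := by
    refine eLpNorm_congr_ae ?_
    filter_upwards [m1.coeFn_toLp, m2.coeFn_toLp] with x h3 h4
    rw [Pi.sub_apply, h3, h4]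
    simp [sub_eq_neg_add]
  rw [h2]
  refine (ENNReal.le_ofReal_iff_toReal_le ?_ hε.le).2 h1.le
  rw [← h2]
  exact ((hg.comp_measurePreserving (measurePreserving_sub_right volume y)).sub hg).2.ne

/-- The mollification of `u` by a normalized bump function. -/
def mollify (φ : ContDiffBump (0 : Plane)) (u : Plane → ℝ) : Plane → ℝ :=
  convolution u (φ.normed volume) (ContinuousLinearMap.mul ℝ ℝ) volume

lemma mollify_eq (φ : ContDiffBump (0 : Plane)) (u : Plane → ℝ) (x : Plane) :
    mollify φ u x = ∫ t, u t * φ.normed volume (x - t) := rfl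

lemma mollify_eq_convolution (φ : ContDiffBump (0 : Plane)) (u : Plane → ℝ) (x : Plane) :
    mollify φ u x = convolution (φ.normed volume) u (ContinuousLinearMap.lsmul ℝ ℝ) volume x := by
  rw [convolution_lsmul_swap, mollify_eq]
  simp only [smul_eq_mul, mul_comm]

lemma contDiff_mollify (φ : ContDiffBump (0 : Plane)) {u : Plane → ℝ}
    (hu : LocallyIntegrable u volume) : ContDiff ℝ ∞ (mollify φ u) :=
  φ.hasCompactSupport_normed.contDiff_convolution_right _ hu φ.contDiff_normed

lemma partialDeriv_mollify (φ : ContDiffBump (0 : Plane)) {u : Plane → ℝ}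
    (hu : LocallyIntegrable u volume) (i : Fin 2) (x : Plane) :
    partialDeriv i (mollify φ u) x
      = ∫ t, u t * partialDeriv i (φ.normed volume) (x - t) := by
  have h := (φ.hasCompactSupport_normed (μ := volume)).hasFDerivAt_convolution_right
    (ContinuousLinearMap.mul ℝ ℝ) (μ := volume) hu φ.contDiff_normed x
  rw [partialDeriv, show mollify φ u = convolution u (φ.normed volume)
    (ContinuousLinearMap.mul ℝ ℝ) volume from rfl, h.fderiv, convolution_precompR_apply _ hu
    (φ.hasCompactSupport_normed.fderiv ℝ)
    ((φ.contDiff_normed (n := 1)).continuous_fderiv one_ne_zero)]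
  rfl

/-- Where the mollification kernel fits into `E`, the partial derivatives of the mollification are
the mollifications of the weak partial derivatives. -/
lemma partialDeriv_mollify_of_isWeakPartial {E : Set Plane} (hE : MeasurableSet E) {i : Fin 2}
    {u g : Plane → ℝ}
    (h : IsWeakPartial E i u g) (hu : LocallyIntegrable u volume) (φ : ContDiffBump (0 : Plane))
    {x : Plane} (hx : Metric.closedBall x φ.rOut ⊆ E) :
    partialDeriv i (mollify φ u) x = mollify φ (E.indicator g) x := by
  have hsmooth : ContDiff ℝ ∞ (fun t => φ.normed volume (x - t)) :=
    φ.contDiff_normed.comp (contDiff_const.sub contDiff_id)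
  have hts : tsupport (fun t => φ.normed volume (x - t)) ⊆ Metric.closedBall x φ.rOut := by
    refine closure_minimal (fun t ht => ?_) Metric.isClosed_closedBall
    have : x - t ∈ Function.support (φ.normed volume) := ht
    rw [φ.support_normed_eq, mem_ball_zero_iff] at this
    rw [Metric.mem_closedBall, dist_comm, dist_eq_norm]
    exact this.le
  have htest : IsTestFunction E (fun t => φ.normed volume (x - t)) :=
    ⟨hsmooth, HasCompactSupport.of_support_subset_isCompact (isCompact_closedBall x φ.rOut)
      ((subset_tsupport _).trans hts), hts.trans hx⟩
  have hder : ∀ t, partialDeriv i (fun t => φ.normed volume (x - t)) t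
      = -partialDeriv i (φ.normed volume) (x - t) := by
    intro t
    have h1 := ((φ.contDiff_normed (μ := volume) (n := 1)).differentiable one_ne_zero
      (x - t)).hasFDerivAt.comp t ((hasFDerivAt_id t).const_sub x)
    have h2 : fderiv ℝ (fun t => φ.normed volume (x - t)) t = _ := h1.fderiv
    rw [partialDeriv, h2]
    simp [partialDeriv]
  have key := h.2 _ htest
  rw [setIntegral_eq_integral_of_forall_compl_eq_zero
    (fun y hy => by rw [htest.partialDeriv_eq_zero i hy, mul_zero])] at key
  simp only [hder, mul_neg, integral_neg, neg_inj] at key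
  rw [partialDeriv_mollify φ hu, key, mollify_eq, ← integral_indicator hE]
  refine integral_congr_ae (.of_forall fun t => ?_)
  simp only [indicator_mul_left]

/-- Mollification does not increase oscillation: Jensen's inequality and Tonelli's theorem bound the
`L²`-distance to `g` by that of the translates of `g`. -/
lemma eLpNorm_mollify_sub_le {g : Plane → ℝ} (hg : MemLp g 2 volume) (φ : ContDiffBump (0 : Plane))
    {ε : ℝ} (h : ∀ y : Plane, ‖y‖ < φ.rOut →
      eLpNorm (fun x => g (x - y) - g x) 2 volume ≤ ENNReal.ofReal ε) :
    eLpNorm (mollify φ g - g) 2 volume ≤ ENNReal.ofReal ε := by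
  wlog hsm : StronglyMeasurable g generalizing g
  · have hae := hg.1.ae_eq_mk
    have h1 := this ((memLp_congr_ae hae).1 hg) (fun y hy => by
      refine le_trans (eLpNorm_congr_ae ?_).le (h y hy)
      have := (measurePreserving_sub_right volume y).quasiMeasurePreserving.ae_eq_comp hae
      filter_upwards [hae, this] with x h1 h2
      simp only [Function.comp_apply] at h2
      rw [h1, h2]) hg.1.stronglyMeasurable_mk
    refine le_trans (eLpNorm_congr_ae ?_).le h1
    filter_upwards [hae] with x hx
    rw [Pi.sub_apply, Pi.sub_apply, ← hx, mollify_eq, mollify_eq]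
    congr 1
    exact integral_congr_ae (by filter_upwards [hae] with t ht; rw [ht])
  set ν : Measure Plane := volume.withDensity fun t => ENNReal.ofReal (φ.normed volume t) with hν
  have hmeas : Measurable fun t => ENNReal.ofReal (φ.normed volume t) :=
    (φ.continuous_normed.measurable).ennreal_ofReal
  have hprob : IsProbabilityMeasure ν := ⟨by
    rw [hν, withDensity_apply _ MeasurableSet.univ, setLIntegral_univ,
      ← ofReal_integral_eq_lintegral_ofReal φ.integrable_normed (.of_forall φ.nonneg_normed),
      φ.integral_normed, ENNReal.ofReal_one]⟩
  have hptw : ∀ x, ‖(mollify φ g - g) x‖ₑ ^ (2 : ℝ) ≤ ∫⁻ t, ‖g (x - t) - g x‖ₑ ^ (2 : ℝ) ∂ν := by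
    intro x
    have e1 : (mollify φ g - g) x = ∫ t, (g (x - t) - g x) ∂ν := by
      rw [hν, integral_withDensity_eq_integral_toReal_smul hmeas (.of_forall fun _ => by simp)]
      simp only [ENNReal.toReal_ofReal (φ.nonneg_normed _), smul_eq_mul, mul_sub]
      rw [integral_sub, integral_mul_const, φ.integral_normed, one_mul, Pi.sub_apply,
        mollify_eq_convolution]
      · rfl
      · have hloc : LocallyIntegrable (fun t => g (x - t)) volume :=
          (hg.comp_measurePreserving
            (Measure.measurePreserving_sub_left volume x)).locallyIntegrable one_le_two
        exact hloc.integrable_smul_left_of_hasCompactSupport φ.continuous_normed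
          φ.hasCompactSupport_normed
      · exact φ.integrable_normed.mul_const _
    rw [e1]
    have hsm' : AEStronglyMeasurable (fun t => g (x - t) - g x) ν :=
      ((hsm.comp_measurable (measurable_const.sub measurable_id)).sub
        stronglyMeasurable_const).aestronglyMeasurable
    have e2 := eLpNorm_le_eLpNorm_of_exponent_le (p := 1) (q := 2) one_le_two hsm'
    rw [eLpNorm_one_eq_lintegral_enorm] at e2
    refine (ENNReal.rpow_le_rpow
      ((enorm_integral_le_lintegral_enorm _).trans e2) zero_le_two).trans ?_
    rw [eLpNorm_eq_lintegral_rpow_enorm_toReal two_ne_zero (by simp), ← ENNReal.rpow_mul]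
    simp
  have hF : Measurable fun z : Plane × Plane => ‖g (z.1 - z.2) - g z.1‖ₑ ^ (2 : ℝ) := by
    have := hsm.measurable
    fun_prop
  have key : ∫⁻ x, ‖(mollify φ g - g) x‖ₑ ^ (2 : ℝ) ≤ ENNReal.ofReal ε ^ (2 : ℝ) := by
    calc _ ≤ ∫⁻ x, ∫⁻ t, ‖g (x - t) - g x‖ₑ ^ (2 : ℝ) ∂ν := lintegral_mono hptw
      _ = ∫⁻ t, (∫⁻ x, ‖g (x - t) - g x‖ₑ ^ (2 : ℝ)) ∂ν :=
        lintegral_lintegral_swap (f := fun x t => ‖g (x - t) - g x‖ₑ ^ (2 : ℝ)) hF.aemeasurable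
      _ ≤ ∫⁻ t, ENNReal.ofReal ε ^ (2 : ℝ) ∂ν := by
        refine lintegral_mono_ae ((ae_withDensity_iff hmeas).2 (.of_forall fun t ht => ?_))
        have ht' : ‖t‖ < φ.rOut := by
          rw [← mem_ball_zero_iff, ← φ.support_normed_eq (μ := volume)]
          intro h0
          exact ht (by rw [h0, ENNReal.ofReal_zero])
        have h1 := h t ht'
        rw [eLpNorm_eq_lintegral_rpow_enorm_toReal two_ne_zero (by simp)] at h1
        have h2 := ENNReal.rpow_le_rpow h1 (zero_le_two (α := ℝ))
        rw [← ENNReal.rpow_mul] at h2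
        simpa using h2
      _ = _ := by simp
  rw [eLpNorm_eq_lintegral_rpow_enorm_toReal two_ne_zero (by simp)]
  simp only [ENNReal.toReal_ofNat]
  refine (ENNReal.rpow_le_rpow key (by norm_num)).trans ?_
  rw [← ENNReal.rpow_mul]
  simp

/-! ### Approximation by test functions -/

lemma abs_integral_mul_le {X : Type*} [MeasurableSpace X] {ν : Measure X} {f g : X → ℝ}
    (hf : MemLp f 2 ν) (hg : MemLp g 2 ν) :
    |∫ x, f x * g x ∂ν| ≤ (eLpNorm f 2 ν).toReal * (eLpNorm g 2 ν).toReal := by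
  have h := abs_real_inner_le_norm (hf.toLp f) (hg.toLp g)
  rw [L2.inner_def, Lp.norm_toLp, Lp.norm_toLp] at h
  refine le_trans (le_of_eq ?_) h
  congr 1
  refine integral_congr_ae ?_
  filter_upwards [hf.coeFn_toLp, hg.coeFn_toLp] with x h1 h2
  rw [h1, h2]
  simp [mul_comm]

/-- A smooth compactly supported function on the line that is the identity near zero. -/
lemma exists_smooth_truncation : ∃ G : ℝ → ℝ, ContDiff ℝ ∞ G ∧ HasCompactSupport G ∧
    (∀ t, |t| ≤ 1 → G t = t) ∧ (∀ t, |G t| ≤ 2) ∧ ∀ t, 2 ≤ |t| → G t = 0 := by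
  let b : ContDiffBump (0 : ℝ) := ⟨1, 2, one_pos, one_lt_two⟩
  refine ⟨fun t => t * b t, contDiff_id.mul b.contDiff, b.hasCompactSupport.mul_left, ?_, ?_, ?_⟩
  · intro t ht
    have : b t = 1 := b.one_of_mem_closedBall (by simpa using ht)
    simp [this]
  · intro t
    rcases le_or_gt 2 |t| with h | h
    · have : b t = 0 := b.zero_of_le_dist (by simpa using h)
      simp [this]
    · rw [abs_mul, abs_of_nonneg b.nonneg]
      nlinarith [b.le_one (x := t), b.nonneg (x := t), abs_nonneg t]
  · intro t h
    have : b t = 0 := b.zero_of_le_dist (by simpa using h)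
    simp [this]

/-- A function with the properties of `exists_smooth_truncation`, along with Lipschitz constants for
it and its derivative. -/
structure IsTruncation (G : ℝ → ℝ) (C L : ℝ) : Prop where
  smooth : ContDiff ℝ ∞ G
  eq_self : ∀ t, |t| ≤ 1 → G t = t
  abs_le : ∀ t, |G t| ≤ 2
  eq_zero : ∀ t, 2 ≤ |t| → G t = 0
  nonneg : 0 ≤ C
  nonneg' : 0 ≤ L
  lipschitz : ∀ s t, |G s - G t| ≤ C * |s - t|
  lipschitz_deriv : ∀ s t, |deriv G s - deriv G t| ≤ L * |s - t|
  abs_deriv_le : ∀ t, |deriv G t| ≤ C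

lemma exists_isTruncation : ∃ G C L, IsTruncation G C L := by
  obtain ⟨G, h1, h2, h3, h4, h5⟩ := exists_smooth_truncation
  obtain ⟨C, hC⟩ := h1.lipschitzWith_of_hasCompactSupport h2 (by simp)
  have h6 : ContDiff ℝ 1 (deriv G) := ((contDiff_infty_iff_deriv.1 h1).2).of_le (by norm_cast)
  obtain ⟨L, hL⟩ := h6.lipschitzWith_of_hasCompactSupport h2.deriv one_ne_zero
  refine ⟨G, C, L, h1, h3, h4, h5, C.2, L.2, fun s t => ?_, fun s t => ?_, fun t => ?_⟩
  · simpa [Real.dist_eq] using hC.dist_le_mul s t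
  · simpa [Real.dist_eq] using hL.dist_le_mul s t
  · simpa using norm_deriv_le_of_lipschitz hC (x₀ := t)

lemma IsTruncation.deriv_eq_one {G : ℝ → ℝ} {C L : ℝ} (h : IsTruncation G C L) {t : ℝ}
    (ht : |t| < 1) : deriv G t = 1 := by
  have : G =ᶠ[nhds t] id := by
    filter_upwards [(isOpen_lt continuous_abs continuous_const).mem_nhds ht] with s hs
    exact h.eq_self s (le_of_lt hs)
  rw [this.deriv_eq, deriv_id]

lemma IsTruncation.deriv_eq_zero {G : ℝ → ℝ} {C L : ℝ} (h : IsTruncation G C L) {t : ℝ}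
    (ht : 2 < |t|) : deriv G t = 0 := by
  have : G =ᶠ[nhds t] fun _ => 0 := by
    filter_upwards [(isOpen_lt continuous_const continuous_abs).mem_nhds ht] with s hs
    exact h.eq_zero s (le_of_lt hs)
  rw [this.deriv_eq, deriv_const]

/-- The truncation `t ↦ t - G(N t)/N` of a continuous function vanishing outside `E` cuts off a
neighbourhood of the boundary, so that mollifying commutes with it up to a small error and yields
test functions. -/
lemma exists_testFunction_truncation {E : Set Plane} (hE : IsBddOpen E) {u : Plane → ℝ}
    (hu : Continuous u) (hu0 : ∀ x ∉ E, u x = 0) {g : Fin 2 → Plane → ℝ}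
    (hg : ∀ i, IsWeakPartial E i u (g i)) {G : ℝ → ℝ} {C L : ℝ} (hG : IsTruncation G C L)
    {N : ℝ} (hN : 0 < N) {ε : ℝ} (hε : 0 < ε) :
    ∃ φ, IsTestFunction E φ ∧ (∀ x, |φ x - (u x - G (N * u x) / N)| ≤ ε) ∧
      ∀ i, eLpNorm (fun x => partialDeriv i φ x -
        (1 - deriv G (N * u x)) * E.indicator (g i) x) 2 volume ≤ ENNReal.ofReal ε := by
  have hcs : HasCompactSupport u :=
    HasCompactSupport.of_support_subset_isCompact hE.isCompact_closure fun x hx =>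
      subset_closure (by by_contra h; exact hx (hu0 x h))
  have hloc : LocallyIntegrable u volume := hu.locallyIntegrable
  have hgL : ∀ i, MemLp (E.indicator (g i)) 2 volume := fun i =>
    (memLp_indicator_iff_restrict hE.measurableSet).2 (hg i).1
  set M : ℝ := ∑ i, (eLpNorm (E.indicator (g i)) 2 volume).toReal with hM
  have hM0 : 0 ≤ M := Finset.sum_nonneg fun i _ => ENNReal.toReal_nonneg
  have hgM : ∀ i, eLpNorm (E.indicator (g i)) 2 volume ≤ ENNReal.ofReal M := fun i => by
    rw [← ENNReal.ofReal_toReal (hgL i).2.ne]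
    exact ENNReal.ofReal_le_ofReal
      (Finset.single_le_sum (f := fun i => (eLpNorm (E.indicator (g i)) 2 volume).toReal)
        (fun i _ => ENNReal.toReal_nonneg) (Finset.mem_univ i))
  have hC := hG.nonneg
  have hL := hG.nonneg'
  set D : ℝ := (1 + C) + L * N * M with hD
  have hD0 : 0 < D := by positivity
  set κ : ℝ := min (1 / (2 * N)) (ε / D) with hκ
  have hκ0 : 0 < κ := by positivity
  have hκN : N * κ ≤ 1 / 2 := by
    have : κ ≤ 1 / (2 * N) := min_le_left _ _
    calc N * κ ≤ N * (1 / (2 * N)) := by gcongr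
      _ = 1 / 2 := by field_simp
  have hκε : D * κ ≤ ε := by
    have : κ ≤ ε / D := min_le_right _ _
    calc D * κ ≤ D * (ε / D) := by gcongr
      _ = ε := by field_simp
  -- the radii for which the mollified function and gradient are `κ`-close, and for which the
  -- kernel centred at points with `|u| ≥ 1/(2N)` fits into `E`
  obtain ⟨η₁, hη₁, h₁⟩ := Metric.uniformContinuous_iff.1
    (hcs.uniformContinuous_of_continuous hu) κ hκ0
  have hη₂ : ∃ η > 0, ∀ i, ∀ y : Plane, ‖y‖ < η →
      eLpNorm (fun x => E.indicator (g i) (x - y) - E.indicator (g i) x) 2 volume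
        ≤ ENNReal.ofReal κ := by
    obtain ⟨a, ha, h⟩ := exists_eLpNorm_translation_sub_le (hgL 0) hκ0
    obtain ⟨b, hb, h'⟩ := exists_eLpNorm_translation_sub_le (hgL 1) hκ0
    refine ⟨min a b, lt_min ha hb, ?_⟩
    rw [Fin.forall_fin_two]
    exact ⟨fun y hy => h y (hy.trans_le (min_le_left _ _)),
      fun y hy => h' y (hy.trans_le (min_le_right _ _))⟩
  obtain ⟨η₂, hη₂, h₂⟩ := hη₂
  set K : Set Plane := {x | 1 / 2 ≤ N * |u x|} with hK
  have hKclosed : IsClosed K := isClosed_le continuous_const (continuous_const.mul hu.abs)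
  have hKE : K ⊆ E := fun x hx => by
    by_contra h
    have : (1 : ℝ) / 2 ≤ N * |u x| := hx
    rw [hu0 x h, abs_zero, mul_zero] at this
    norm_num at this
  have hKc : IsCompact K :=
    hE.isCompact_closure.of_isClosed_subset hKclosed (hKE.trans subset_closure)
  obtain ⟨η₃, hη₃, h₃⟩ := hKc.exists_cthickening_subset_open hE.isOpen hKE
  set η : ℝ := min η₁ (min η₂ η₃) with hη
  have hη0 : 0 < η := by positivity
  let ψ : ContDiffBump (0 : Plane) := ⟨η / 2, η, half_pos hη0, half_lt_self hη0⟩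
  have hψ : ψ.rOut = η := rfl
  set m := mollify ψ u with hm
  have hmu : ∀ x, |m x - u x| ≤ κ := fun x => by
    rw [hm, mollify_eq_convolution, ← Real.dist_eq]
    refine ψ.dist_normed_convolution_le hu.aestronglyMeasurable fun y hy => (h₁ ?_).le
    exact lt_of_lt_of_le hy (min_le_left _ _)
  have hmg : ∀ i, eLpNorm (mollify ψ (E.indicator (g i)) - E.indicator (g i)) 2 volume
      ≤ ENNReal.ofReal κ := fun i =>
    eLpNorm_mollify_sub_le (hgL i) ψ fun y hy =>
      h₂ i y (hy.trans_le ((min_le_right _ _).trans (min_le_left _ _)))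
  have hmsm : ContDiff ℝ ∞ m := contDiff_mollify ψ hloc
  have hoff : ∀ x ∉ K, |N * m x| < 1 := fun x hx => by
    have h4 : N * |u x| < 1 / 2 := not_le.1 hx
    have h5 : |m x| ≤ |u x| + κ := by
      have := abs_sub_abs_le_abs_sub (m x) (u x)
      linarith [hmu x]
    rw [abs_mul, abs_of_pos hN]
    nlinarith
  set φ : Plane → ℝ := fun x => m x - G (N * m x) / N with hφ
  have hφsm : ContDiff ℝ ∞ φ :=
    hmsm.sub ((hG.smooth.comp (contDiff_const.mul hmsm)).div_const N)
  have hφK : tsupport φ ⊆ K := by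
    refine closure_minimal (fun x hx => ?_) hKclosed
    by_contra h
    refine hx ?_
    simp only [hφ]
    rw [hG.eq_self _ (hoff x h).le]
    field_simp
    ring
  have hder : ∀ i x, partialDeriv i φ x
      = (1 - deriv G (N * m x)) * mollify ψ (E.indicator (g i)) x := by
    intro i x
    have h6 : HasFDerivAt m (fderiv ℝ m x) x := (hmsm.differentiable (by simp) x).hasFDerivAt
    have h7 : HasDerivAt G (deriv G (N * m x)) (N * m x) :=
      (hG.smooth.differentiable (by simp) _).hasDerivAt
    have h8 := h6.sub (((h7.comp_hasFDerivAt x (h6.const_mul N))).mul_const N⁻¹)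
    have h9 : partialDeriv i φ x = (1 - deriv G (N * m x)) * partialDeriv i m x := by
      have h10 : fderiv ℝ φ x = _ := h8.fderiv
      rw [partialDeriv, h10]
      simp [partialDeriv]
      field_simp
    rw [h9]
    by_cases hx : x ∈ K
    · rw [partialDeriv_mollify_of_isWeakPartial hE.measurableSet (hg i) hloc]
      refine subset_trans ?_ h₃
      refine subset_trans (Metric.closedBall_subset_cthickening hx _) ?_
      exact Metric.cthickening_mono ((min_le_right _ _).trans (min_le_right _ _)) _
    · rw [hG.deriv_eq_one (hoff x hx)]
      simp
  refine ⟨φ, ⟨hφsm, hKc.of_isClosed_subset (isClosed_tsupport _) hφK, hφK.trans hKE⟩, ?_, ?_⟩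
  · intro x
    have e : φ x - (u x - G (N * u x) / N) = (m x - u x) - (G (N * m x) - G (N * u x)) / N := by
      simp only [hφ]; ring
    have h11 : |(G (N * m x) - G (N * u x)) / N| ≤ C * |m x - u x| := by
      rw [abs_div, abs_of_pos hN, div_le_iff₀ hN]
      refine (hG.lipschitz _ _).trans (le_of_eq ?_)
      rw [← mul_sub, abs_mul, abs_of_pos hN]; ring
    rw [e]
    calc _ ≤ |m x - u x| + C * |m x - u x| := (abs_sub _ _).trans (by gcongr)
      _ = (1 + C) * |m x - u x| := by ring
      _ ≤ D * κ := by
        gcongr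
        · rw [hD]; have : 0 ≤ L * N * M := by positivity
          linarith
        · exact hmu x
      _ ≤ ε := hκε
  · intro i
    have hcG : Continuous (deriv G) := (contDiff_infty_iff_deriv.1 hG.smooth).2.continuous
    have e : (fun x => partialDeriv i φ x - (1 - deriv G (N * u x)) * E.indicator (g i) x)
        = (fun x => (1 - deriv G (N * m x)) *
            (mollify ψ (E.indicator (g i)) - E.indicator (g i)) x)
          + fun x => (deriv G (N * u x) - deriv G (N * m x)) * E.indicator (g i) x := by
      ext x
      simp only [hder, Pi.add_apply, Pi.sub_apply]
      ring
    have hcm : Continuous (mollify ψ (E.indicator (g i))) :=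
      (contDiff_mollify ψ ((hgL i).locallyIntegrable one_le_two)).continuous
    have hms1 : AEStronglyMeasurable (fun x => (1 - deriv G (N * m x)) *
            (mollify ψ (E.indicator (g i)) - E.indicator (g i)) x) volume :=
      (continuous_const.sub (hcG.comp (continuous_const.mul
        hmsm.continuous))).aestronglyMeasurable.mul (hcm.aestronglyMeasurable.sub (hgL i).1)
    have hms2 : AEStronglyMeasurable
        (fun x => (deriv G (N * u x) - deriv G (N * m x)) * E.indicator (g i) x) volume :=
      ((hcG.comp (continuous_const.mul hu)).sub (hcG.comp (continuous_const.mul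
        hmsm.continuous))).aestronglyMeasurable.mul (hgL i).1
    have b1 := eLpNorm_le_mul_eLpNorm_of_ae_le_mul (p := 2) (μ := volume) (c := 1 + C)
      (f := fun x => (1 - deriv G (N * m x)) *
            (mollify ψ (E.indicator (g i)) - E.indicator (g i)) x)
      (g := mollify ψ (E.indicator (g i)) - E.indicator (g i)) (.of_forall fun x => by
        rw [norm_mul]
        gcongr
        refine (norm_sub_le _ _).trans ?_
        rw [norm_one]
        gcongr
        exact hG.abs_deriv_le _)
    have b2 := eLpNorm_le_mul_eLpNorm_of_ae_le_mul (p := 2) (μ := volume) (c := L * N * κ)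
      (f := fun x => (deriv G (N * u x) - deriv G (N * m x)) * E.indicator (g i) x)
      (g := E.indicator (g i)) (.of_forall fun x => by
        rw [norm_mul]
        gcongr
        refine (hG.lipschitz_deriv _ _).trans ?_
        rw [← mul_sub, abs_mul, abs_of_pos hN, abs_sub_comm, mul_assoc]
        have := hmu x
        gcongr)
    rw [e]
    calc _ ≤ _ := eLpNorm_add_le hms1 hms2 one_le_two
      _ ≤ ENNReal.ofReal (1 + C) * ENNReal.ofReal κ
          + ENNReal.ofReal (L * N * κ) * ENNReal.ofReal M :=
        add_le_add (b1.trans (by gcongr; exact hmg i)) (b2.trans (by gcongr; exact hgM i))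
      _ = ENNReal.ofReal (D * κ) := by
        rw [← ENNReal.ofReal_mul (by positivity), ← ENNReal.ofReal_mul (by positivity),
          ← ENNReal.ofReal_add (by positivity) (by positivity)]
        congr 1
        rw [hD]; ring
      _ ≤ ENNReal.ofReal ε := ENNReal.ofReal_le_ofReal hκε

/-- The chain rule for the truncation of a continuous function. -/
lemma integral_truncation_mul_partialDeriv {E : Set Plane} (hE : IsBddOpen E) {u : Plane → ℝ}
    (hu : Continuous u) (hu0 : ∀ x ∉ E, u x = 0) {g : Fin 2 → Plane → ℝ}
    (hg : ∀ i, IsWeakPartial E i u (g i)) {G : ℝ → ℝ} {C L : ℝ} (hG : IsTruncation G C L)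
    {N : ℝ} (hN : 0 < N) (i : Fin 2) {χ : Plane → ℝ} (hχ : IsTestFunction E χ) :
    ∫ x in E, (u x - G (N * u x) / N) * partialDeriv i χ x
      = -∫ x in E, (1 - deriv G (N * u x)) * g i x * χ x := by
  have hcG : Continuous (deriv G) := (contDiff_infty_iff_deriv.1 hG.smooth).2.continuous
  set w : Plane → ℝ := fun x => u x - G (N * u x) / N with hw
  have hwc : Continuous w :=
    hu.sub ((hG.smooth.continuous.comp (continuous_const.mul hu)).div_const N)
  set w' : Plane → ℝ := fun x => (1 - deriv G (N * u x)) * g i x with hw'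
  have hgi := hE.integrableOn_of_memLp (hg i).1
  have hc1 : Continuous fun x => 1 - deriv G (N * u x) :=
    continuous_const.sub (hcG.comp (continuous_const.mul hu))
  have hw'L : MemLp w' 2 (volume.restrict E) := by
    refine (hg i).1.of_le_mul (c := 1 + C) (hc1.aestronglyMeasurable.mul (hg i).1.1)
      (.of_forall fun x => ?_)
    rw [hw', norm_mul]
    gcongr
    refine (norm_sub_le _ _).trans ?_
    rw [norm_one]
    gcongr
    exact hG.abs_deriv_le _
  have hχL := hE.memLp_of_continuousOn hχ.continuous.continuousOn
  have hχ' := hχ.continuous_partialDeriv i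
  set A : ℝ := ∫ x in E, |partialDeriv i χ x|
  set B : ℝ := (eLpNorm χ 2 (volume.restrict E)).toReal
  have hA : 0 ≤ A := integral_nonneg fun x => abs_nonneg _
  have hB : 0 ≤ B := ENNReal.toReal_nonneg
  have key : ∀ ε > 0,
      |(∫ x in E, w x * partialDeriv i χ x) + ∫ x in E, w' x * χ x| ≤ ε * (A + B) := by
    intro ε hε
    obtain ⟨φ, hφ, h1, h2⟩ := exists_testFunction_truncation hE hu hu0 hg hG hN hε
    have h3 := hχ.integral_mul_partialDeriv (hφ.smooth.of_le (by norm_cast)) i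
    have i1 : IntegrableOn (fun x => w x * partialDeriv i χ x) E :=
      hE.integrableOn_of_continuousOn (hwc.mul hχ').continuousOn
    have i2 : IntegrableOn (fun x => φ x * partialDeriv i χ x) E :=
      hE.integrableOn_of_continuousOn (hφ.continuous.mul hχ').continuousOn
    have i3 : IntegrableOn (fun x => w' x * χ x) E := by
      simpa only [mul_comm] using hE.integrableOn_continuousOn_mul hχ.continuous.continuousOn
        (hE.integrableOn_of_memLp hw'L)
    have i4 : IntegrableOn (fun x => partialDeriv i φ x * χ x) E :=
      hE.integrableOn_of_continuousOn
        ((hφ.continuous_partialDeriv i).mul hχ.continuous).continuousOn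
    have e : (∫ x in E, w x * partialDeriv i χ x) + ∫ x in E, w' x * χ x
        = -(∫ x in E, (φ x - w x) * partialDeriv i χ x)
          - ∫ x in E, (partialDeriv i φ x - w' x) * χ x := by
      simp only [sub_mul]
      rw [integral_sub i2 i1, integral_sub i4 i3, h3]
      ring
    have b1 : |∫ x in E, (φ x - w x) * partialDeriv i χ x| ≤ ε * A := by
      rw [← integral_const_mul, ← Real.norm_eq_abs]
      refine norm_integral_le_of_norm_le
        ((hE.integrableOn_of_continuousOn hχ'.abs.continuousOn).const_mul ε)
        (.of_forall fun x => ?_)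
      rw [norm_mul]
      exact mul_le_mul_of_nonneg_right (h1 x) (norm_nonneg _)
    have b2 : |∫ x in E, (partialDeriv i φ x - w' x) * χ x| ≤ ε * B := by
      have hφL := hE.memLp_of_continuousOn (hφ.continuous_partialDeriv i).continuousOn
      refine (abs_integral_mul_le (hφL.sub hw'L) hχL).trans ?_
      gcongr
      refine ENNReal.toReal_le_of_le_ofReal hε.le (le_trans ?_ (h2 i))
      refine le_trans (eLpNorm_congr_ae ?_).le (eLpNorm_restrict_le _ 2 volume E)
      filter_upwards [ae_restrict_mem hE.measurableSet] with x hx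
      simp [hw', hx]
    rw [e]
    calc _ ≤ |∫ x in E, (φ x - w x) * partialDeriv i χ x|
          + |∫ x in E, (partialDeriv i φ x - w' x) * χ x| := by
            rw [← abs_neg (∫ x in E, (φ x - w x) * partialDeriv i χ x)]; exact abs_sub _ _
      _ ≤ ε * A + ε * B := add_le_add b1 b2
      _ = ε * (A + B) := by ring
  rw [eq_neg_iff_add_eq_zero, ← abs_nonpos_iff]
  refine le_of_forall_pos_le_add fun ε hε => ?_
  refine (key (ε / (A + B + 1)) (by positivity)).trans ?_
  rw [zero_add, div_mul_eq_mul_div, div_le_iff₀ (by positivity)]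
  nlinarith

open Filter Topology in
/-- Stampacchia: the weak derivatives of a continuous function vanish almost everywhere on its zero
set. -/
lemma ae_eq_zero_of_isWeakPartial {E : Set Plane} (hE : IsBddOpen E) {u : Plane → ℝ}
    (hu : Continuous u) (hu0 : ∀ x ∉ E, u x = 0) {g : Fin 2 → Plane → ℝ}
    (hg : ∀ i, IsWeakPartial E i u (g i)) (i : Fin 2) :
    ∀ᵐ x ∂volume.restrict E, u x = 0 → g i x = 0 := by
  obtain ⟨G, C, L, hG⟩ := exists_isTruncation
  have hcG : Continuous (deriv G) := (contDiff_infty_iff_deriv.1 hG.smooth).2.continuous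
  have hms : MeasurableSet {x | u x ≠ 0} := (isOpen_ne_fun hu continuous_const).measurableSet
  have hpt : ∀ x, Tendsto (fun n : ℕ => (1 - deriv G ((n + 1 : ℝ) * u x)) * g i x) atTop
      (𝓝 ({x | u x ≠ 0}.indicator (g i) x)) := by
    intro x
    by_cases hx : u x = 0
    · have : deriv G 0 = 1 := hG.deriv_eq_one (by simp)
      simp [hx, this]
    · rw [indicator_of_mem (by exact hx)]
      refine tendsto_const_nhds.congr' ?_
      obtain ⟨n₀, hn₀⟩ := exists_nat_gt (2 / |u x|)
      filter_upwards [eventually_ge_atTop n₀] with n hn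
      rw [hG.deriv_eq_zero, sub_zero, one_mul]
      have hn' : (n₀ : ℝ) ≤ n := by exact_mod_cast hn
      have hux := abs_pos.2 hx
      rw [abs_mul, abs_of_pos (by positivity)]
      rw [div_lt_iff₀ hux] at hn₀
      nlinarith
  have hpt2 : ∀ x, Tendsto (fun n : ℕ => u x - G ((n + 1 : ℝ) * u x) / (n + 1 : ℝ)) atTop
      (𝓝 (u x)) := by
    intro x
    have h1 : Tendsto (fun n : ℕ => 2 * (1 / ((n : ℝ) + 1))) atTop (𝓝 0) := by
      simpa using tendsto_one_div_add_atTop_nhds_zero_nat.const_mul (2 : ℝ)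
    have h2 : Tendsto (fun n : ℕ => G ((n + 1 : ℝ) * u x) / (n + 1 : ℝ)) atTop (𝓝 0) := by
      refine squeeze_zero_norm (fun n => ?_) h1
      rw [norm_div, Real.norm_of_nonneg (by positivity : (0 : ℝ) ≤ n + 1), mul_one_div]
      gcongr
      exact hG.abs_le _
    simpa using h2.const_sub (u x)
  have hweak : IsWeakPartial E i u ({x | u x ≠ 0}.indicator (g i)) := by
    refine ⟨(hg i).1.indicator hms, fun χ hχ => ?_⟩
    have hχ' := hχ.continuous_partialDeriv i
    have hgi := hE.integrableOn_of_memLp (hg i).1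
    have l1 : Tendsto (fun n : ℕ => ∫ x in E, (u x - G ((n + 1 : ℝ) * u x) / (n + 1 : ℝ))
        * partialDeriv i χ x) atTop (𝓝 (∫ x in E, u x * partialDeriv i χ x)) := by
      refine tendsto_integral_of_dominated_convergence
        (fun x => (|u x| + 2) * |partialDeriv i χ x|) (fun n => ?_)
        (hE.integrableOn_of_continuousOn ((hu.abs.add continuous_const).mul hχ'.abs).continuousOn)
        (fun n => .of_forall fun x => ?_) (.of_forall fun x => (hpt2 x).mul_const _)
      · exact ((hu.sub ((hG.smooth.continuous.comp (continuous_const.mul hu)).div_const _)).mul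
          hχ').aestronglyMeasurable
      · rw [norm_mul]
        refine mul_le_mul_of_nonneg_right ((norm_sub_le _ _).trans ?_) (norm_nonneg _)
        rw [norm_div, Real.norm_of_nonneg (by positivity : (0 : ℝ) ≤ n + 1)]
        refine add_le_add le_rfl
          ((div_le_self (norm_nonneg _) (by linarith [n.cast_nonneg (α := ℝ)])).trans
          (hG.abs_le _))
    have l2 : Tendsto (fun n : ℕ => -∫ x in E, (1 - deriv G ((n + 1 : ℝ) * u x)) * g i x * χ x)
        atTop (𝓝 (-∫ x in E, {x | u x ≠ 0}.indicator (g i) x * χ x)) := by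
      refine (tendsto_integral_of_dominated_convergence
        (fun x => (1 + C) * (|χ x| * |g i x|)) (fun n => ?_)
        ((hE.integrableOn_continuousOn_mul hχ.continuous.abs.continuousOn hgi.abs).const_mul _)
        (fun n => .of_forall fun x => ?_) (.of_forall fun x => (hpt x).mul_const _)).neg
      · exact ((continuous_const.sub (hcG.comp
          (continuous_const.mul hu))).aestronglyMeasurable.mul (hg i).1.1).mul
            hχ.continuous.aestronglyMeasurable
      · rw [norm_mul, norm_mul, mul_assoc, mul_comm ‖g i x‖]
        refine mul_le_mul_of_nonneg_right ((norm_sub_le _ _).trans ?_) (by positivity)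
        rw [norm_one]
        gcongr
        exact hG.abs_deriv_le _
    refine tendsto_nhds_unique l1 (l2.congr fun n => ?_)
    rw [integral_truncation_mul_partialDeriv hE hu hu0 hg hG (by positivity) i hχ]
  filter_upwards [(hg i).ae_eq hE hweak] with x hx h0
  rw [hx]
  simp [h0]

open Filter Topology in
/-- A continuous function of class `W^{1,2}` vanishing outside `E` belongs to the closure of the
test functions. -/
lemma exists_testFunction_approx {E : Set Plane} (hE : IsBddOpen E) {u : Plane → ℝ}
    (hu : Continuous u) (hu0 : ∀ x ∉ E, u x = 0) {g : Fin 2 → Plane → ℝ}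
    (hg : ∀ i, IsWeakPartial E i u (g i)) {ε : ℝ} (hε : 0 < ε) :
    ∃ φ, IsTestFunction E φ ∧ (∀ x, |φ x - u x| ≤ ε) ∧
      ∀ i, eLpNorm (partialDeriv i φ - g i) 2 (volume.restrict E) ≤ ENNReal.ofReal ε := by
  obtain ⟨G, C, L, hG⟩ := exists_isTruncation
  have hcG : Continuous (deriv G) := (contDiff_infty_iff_deriv.1 hG.smooth).2.continuous
  have hlim : ∀ i, ∀ᶠ n : ℕ in atTop,
      eLpNorm (fun x => deriv G ((n + 1 : ℝ) * u x) * g i x) 2 (volume.restrict E)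
        ≤ ENNReal.ofReal (ε / 2) := by
    intro i
    have hae := ae_eq_zero_of_isWeakPartial hE hu hu0 hg i
    have h1 : Tendsto
        (fun n : ℕ => ∫⁻ x in E, ‖deriv G ((n + 1 : ℝ) * u x) * g i x‖ₑ ^ (2 : ℝ)) atTop
        (𝓝 (∫⁻ x in E, 0)) := by
      refine tendsto_lintegral_of_dominated_convergence' (fun x => ‖C * g i x‖ₑ ^ (2 : ℝ))
        (fun n => ?_) (fun n => .of_forall fun x => ?_) ?_ ?_
      · exact ((hcG.comp (continuous_const.mul hu)).aestronglyMeasurable.mul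
          (hg i).1.1).enorm.pow_const _
      · refine ENNReal.rpow_le_rpow ?_ zero_le_two
        rw [enorm_le_iff_norm_le, norm_mul, norm_mul, Real.norm_of_nonneg hG.nonneg]
        gcongr
        exact hG.abs_deriv_le _
      · have h2 := ((hg i).1.const_mul C).2
        rw [eLpNorm_lt_top_iff_lintegral_rpow_enorm_lt_top two_ne_zero (by simp)] at h2
        simpa using h2.ne
      · filter_upwards [hae] with x hx
        refine tendsto_const_nhds.congr' ?_
        by_cases hux : u x = 0
        · simp [hx hux]
        · obtain ⟨n₀, hn₀⟩ := exists_nat_gt (2 / |u x|)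
          filter_upwards [eventually_ge_atTop n₀] with n hn
          rw [hG.deriv_eq_zero]
          · simp
          have hn' : (n₀ : ℝ) ≤ n := by exact_mod_cast hn
          have hux := abs_pos.2 hux
          rw [abs_mul, abs_of_pos (by positivity)]
          rw [div_lt_iff₀ hux] at hn₀
          nlinarith
    rw [lintegral_zero] at h1
    have hpos : (0 : ENNReal) < ENNReal.ofReal (ε / 2) ^ (2 : ℝ) :=
      ENNReal.rpow_pos (by simpa using hε) (by simp)
    filter_upwards [h1.eventually_le_const hpos] with n hn
    rw [eLpNorm_eq_lintegral_rpow_enorm_toReal two_ne_zero (by simp)]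
    simp only [ENNReal.toReal_ofNat]
    refine (ENNReal.rpow_le_rpow hn (by norm_num)).trans ?_
    rw [← ENNReal.rpow_mul]
    simp
  obtain ⟨n₀, hn₀⟩ := exists_nat_gt (4 / ε)
  obtain ⟨n, hn0, hn1, hn2⟩ := ((hlim 0).and ((hlim 1).and (eventually_ge_atTop n₀))).exists
  have hN : (0 : ℝ) < n + 1 := by positivity
  obtain ⟨φ, hφ, h1, h2⟩ := exists_testFunction_truncation hE hu hu0 hg hG hN (half_pos hε)
  refine ⟨φ, hφ, fun x => ?_, fun i => ?_⟩
  · have h3 : |G ((n + 1 : ℝ) * u x) / (n + 1 : ℝ)| ≤ ε / 2 := by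
      rw [abs_div, abs_of_pos hN, div_le_iff₀ hN]
      refine (hG.abs_le _).trans ?_
      have hn' : (n₀ : ℝ) ≤ n := by exact_mod_cast hn2
      rw [div_lt_iff₀ hε] at hn₀
      nlinarith
    have e : φ x - u x = (φ x - (u x - G ((n + 1 : ℝ) * u x) / (n + 1 : ℝ)))
      - G ((n + 1 : ℝ) * u x) / (n + 1 : ℝ) := by ring
    rw [e]
    refine (abs_sub _ _).trans ?_
    linarith [h1 x]
  · have h4 : eLpNorm (fun x => deriv G ((n + 1 : ℝ) * u x) * g i x) 2 (volume.restrict E)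
        ≤ ENNReal.ofReal (ε / 2) := by
      fin_cases i
      · exact hn0
      · exact hn1
    have h5 : eLpNorm (fun x => partialDeriv i φ x - (1 - deriv G ((n + 1 : ℝ) * u x)) * g i x) 2
        (volume.restrict E) ≤ ENNReal.ofReal (ε / 2) := by
      refine le_trans (le_trans (eLpNorm_congr_ae ?_).le (eLpNorm_restrict_le _ 2 volume E)) (h2 i)
      filter_upwards [ae_restrict_mem hE.measurableSet] with x hx
      simp [hx]
    have e : partialDeriv i φ - g i
        = (fun x => partialDeriv i φ x - (1 - deriv G ((n + 1 : ℝ) * u x)) * g i x)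
          - fun x => deriv G ((n + 1 : ℝ) * u x) * g i x := by
      ext x
      simp only [Pi.sub_apply]
      ring
    have m1 : AEStronglyMeasurable (fun x => deriv G ((n + 1 : ℝ) * u x) * g i x)
        (volume.restrict E) :=
      (hcG.comp (continuous_const.mul hu)).aestronglyMeasurable.mul (hg i).1.1
    have m2 : AEStronglyMeasurable
        (fun x => partialDeriv i φ x - (1 - deriv G ((n + 1 : ℝ) * u x)) * g i x)
        (volume.restrict E) :=
      (hφ.continuous_partialDeriv i).aestronglyMeasurable.sub
        ((continuous_const.sub (hcG.comp (continuous_const.mul hu))).aestronglyMeasurable.mul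
          (hg i).1.1)
    rw [e]
    calc _ ≤ _ := eLpNorm_sub_le m2 m1 one_le_two
      _ ≤ _ := add_le_add h5 h4
      _ = ENNReal.ofReal ε := by
        rw [← ENNReal.ofReal_add (by positivity) (by positivity), add_halves]

/-! ### Functions with zero boundary values -/

/-- Functions of class `W^{1,2}(E)`, continuous up to the boundary and zero there. -/
structure HasZeroTrace (E : Set Plane) (v : Plane → ℝ) : Prop where
  continuousOn : ContinuousOn v (closure E)
  memW12 : MemW12 E v
  eq_zero : ∀ x ∈ frontier E, v x = 0

/-- The extension by zero is approximated by test functions. -/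
lemma HasZeroTrace.exists_testFunction {E : Set Plane} (hE : IsBddOpen E) {v : Plane → ℝ}
    (hv : HasZeroTrace E v) {ε : ℝ} (hε : 0 < ε) :
    ∃ φ, IsTestFunction E φ ∧ (∀ x ∈ E, |φ x - v x| ≤ ε) ∧
      ∀ i, eLpNorm (partialDeriv i φ - weakPartial E i v) 2 (volume.restrict E)
        ≤ ENNReal.ofReal ε := by
  obtain ⟨φ, h1, h2, h3⟩ := exists_testFunction_approx hE (u := E.indicator v)
    (continuous_indicator hv.eq_zero hv.continuousOn) (fun x hx => indicator_of_notMem hx v)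
    (g := fun i => weakPartial E i v)
    (fun i => ⟨(hv.memW12.isWeakPartial i).1, fun χ hχ => by
      rw [← (hv.memW12.isWeakPartial i).2 χ hχ]
      exact setIntegral_congr_fun hE.measurableSet fun x hx => by simp [hx]⟩) hε
  refine ⟨φ, h1, fun x hx => ?_, h3⟩
  simpa [hx] using h2 x

/-- A first-order functional vanishing on all test functions vanishes on functions with zero
boundary values. -/
lemma HasZeroTrace.integral_eq_zero {E : Set Plane} (hE : IsBddOpen E) {v : Plane → ℝ}
    (hv : HasZeroTrace E v) {H : Fin 2 → Plane → ℝ} {h : Plane → ℝ}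
    (hH : ∀ j, MemLp (H j) 2 (volume.restrict E)) (hh : IntegrableOn h E)
    (h0 : ∀ φ, IsTestFunction E φ →
      (∑ j, ∫ x in E, H j x * partialDeriv j φ x) + ∫ x in E, h x * φ x = 0) :
    (∑ j, ∫ x in E, H j x * weakPartial E j v x) + ∫ x in E, h x * v x = 0 := by
  set A : ℝ := ∑ j, (eLpNorm (H j) 2 (volume.restrict E)).toReal with hA
  set B : ℝ := ∫ x in E, |h x|
  have hA0 : 0 ≤ A := Finset.sum_nonneg fun j _ => ENNReal.toReal_nonneg
  have hB0 : 0 ≤ B := integral_nonneg fun x => abs_nonneg _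
  have key : ∀ ε > 0, |(∑ j, ∫ x in E, H j x * weakPartial E j v x) + ∫ x in E, h x * v x|
      ≤ ε * (A + B) := by
    intro ε hε
    obtain ⟨φ, hφ, h1, h2⟩ := hv.exists_testFunction hE hε
    have mφ := fun j => hE.memLp_of_continuousOn (hφ.continuous_partialDeriv j).continuousOn
    have mv := fun j => (hv.memW12.isWeakPartial j).1
    have e : (∑ j, ∫ x in E, H j x * weakPartial E j v x) + ∫ x in E, h x * v x
        = -((∑ j, ∫ x in E, H j x * (partialDeriv j φ x - weakPartial E j v x))
          + ∫ x in E, h x * (φ x - v x)) := by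
      have e1 : ∀ j, ∫ x in E, H j x * (partialDeriv j φ x - weakPartial E j v x)
          = (∫ x in E, H j x * partialDeriv j φ x) - ∫ x in E, H j x * weakPartial E j v x := by
        intro j
        simp only [mul_sub]
        exact integral_sub ((hH j).integrable_mul (mφ j)) ((hH j).integrable_mul (mv j))
      have e2 : ∫ x in E, h x * (φ x - v x)
          = (∫ x in E, h x * φ x) - ∫ x in E, h x * v x := by
        simp only [mul_sub]
        refine integral_sub ?_ ?_
        · exact hh.mul_continuousOn_of_subset hφ.continuous.continuousOn hE.measurableSet
            hE.isCompact_closure subset_closure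
        · exact hh.mul_continuousOn_of_subset hv.continuousOn hE.measurableSet
            hE.isCompact_closure subset_closure
      simp only [e1, e2, Finset.sum_sub_distrib]
      linarith [h0 φ hφ]
    rw [e, abs_neg]
    have b1 : |∑ j, ∫ x in E, H j x * (partialDeriv j φ x - weakPartial E j v x)| ≤ ε * A := by
      rw [hA, Finset.mul_sum]
      refine (Finset.abs_sum_le_sum_abs _ _).trans (Finset.sum_le_sum fun j _ => ?_)
      refine (abs_integral_mul_le (hH j) ((mφ j).sub (mv j))).trans ?_
      rw [mul_comm]
      gcongr
      exact ENNReal.toReal_le_of_le_ofReal hε.le (h2 j)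
    have b2 : |∫ x in E, h x * (φ x - v x)| ≤ ε * B := by
      rw [← integral_const_mul, ← Real.norm_eq_abs]
      refine norm_integral_le_of_norm_le (hh.abs.const_mul ε) ?_
      filter_upwards [ae_restrict_mem hE.measurableSet] with x hx
      rw [norm_mul, mul_comm]
      exact mul_le_mul_of_nonneg_right (h1 x hx) (norm_nonneg _)
    calc _ ≤ _ := abs_add_le _ _
      _ ≤ ε * A + ε * B := add_le_add b1 b2
      _ = ε * (A + B) := by ring
  rw [← abs_nonpos_iff]
  refine le_of_forall_pos_le_add fun ε hε => ?_
  refine (key (ε / (A + B + 1)) (by positivity)).trans ?_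
  rw [zero_add, div_mul_eq_mul_div, div_le_iff₀ (by positivity)]
  nlinarith

/-- Integration by parts against a smooth function without boundary terms. -/
lemma HasZeroTrace.integral_mul_partialDeriv {E : Set Plane} (hE : IsBddOpen E) {v : Plane → ℝ}
    (hv : HasZeroTrace E v) {f : Plane → ℝ} (hf : ContDiff ℝ 1 f) (i : Fin 2) :
    ∫ x in E, f x * weakPartial E i v x = -∫ x in E, partialDeriv i f x * v x := by
  have h := hv.integral_eq_zero hE (H := Pi.single i f) (h := partialDeriv i f)
    (fun j => by
      by_cases hj : j = i
      · subst hj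
        rw [Pi.single_eq_same]
        exact hE.memLp_of_continuousOn hf.continuous.continuousOn
      · rw [Pi.single_eq_of_ne hj]
        exact MemLp.zero')
    (hE.integrableOn_of_continuousOn (continuous_partialDeriv hf i).continuousOn)
    (fun φ hφ => by
      rw [Finset.sum_eq_single i (fun j _ hj => by simp [Pi.single_eq_of_ne hj]) (by simp),
        Pi.single_eq_same, hφ.integral_mul_partialDeriv hf i, neg_add_cancel])
  rw [Finset.sum_eq_single i (fun j _ hj => by simp [Pi.single_eq_of_ne hj]) (by simp),
    Pi.single_eq_same] at h
  linarith

/-- Poincaré: a function with zero boundary values and zero gradient vanishes. -/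
lemma HasZeroTrace.eq_zero_of_weakPartial_eq_zero {E : Set Plane} (hE : IsBddOpen E)
    {v : Plane → ℝ} (hv : HasZeroTrace E v)
    (h0 : weakPartial E 0 v =ᵐ[volume.restrict E] 0) : ∀ x ∈ closure E, v x = 0 := by
  have hx0 : Continuous fun x : Plane => x 0 :=
    (EuclideanSpace.proj (𝕜 := ℝ) (0 : Fin 2)).continuous
  have hxd : ContDiff ℝ ∞ fun x : Plane => x 0 :=
    (EuclideanSpace.proj (𝕜 := ℝ) (0 : Fin 2)).contDiff
  have hvI := hE.integrableOn_of_continuousOn hv.continuousOn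
  -- test with `x₀ v`, whose derivative in the direction of `x₀` is `v`
  have h := hv.integral_eq_zero hE (H := Pi.single 0 fun x => x 0 * v x) (h := v)
    (fun j => by
      by_cases hj : j = 0
      · subst hj
        rw [Pi.single_eq_same]
        exact hE.memLp_of_continuousOn (hx0.continuousOn.mul hv.continuousOn)
      · rw [Pi.single_eq_of_ne hj]
        exact MemLp.zero') hvI
    (fun φ hφ => by
      rw [Finset.sum_eq_single 0 (fun j _ hj => by simp [Pi.single_eq_of_ne hj]) (by simp),
        Pi.single_eq_same]
      have hxφ : IsTestFunction E fun x => x 0 * φ x :=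
        ⟨hxd.mul hφ.smooth, hφ.compact.mul_left,
          (tsupport_mul_subset_right).trans hφ.support⟩
      have h1 := (hv.memW12.isWeakPartial 0).2 _ hxφ
      have h2 : ∫ x in E, weakPartial E 0 v x * (x 0 * φ x) = 0 := by
        rw [← integral_zero Plane ℝ (μ := volume.restrict E)]
        exact integral_congr_ae (h0.mono fun x hx => by simp [hx])
      have h3 : ∀ x, partialDeriv 0 (fun x => x 0 * φ x) x = φ x + x 0 * partialDeriv 0 φ x := by
        intro x
        have d1 := (EuclideanSpace.proj (𝕜 := ℝ) (0 : Fin 2)).hasFDerivAt (x := x)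
        have d2 := (hφ.differentiable x).hasFDerivAt
        have d3 : fderiv ℝ (fun x => x 0 * φ x) x = _ := (d1.mul d2).fderiv
        rw [partialDeriv, d3]
        simp [partialDeriv]
        ring
      rw [h2, neg_zero] at h1
      rw [← integral_add, ← h1]
      · exact integral_congr_ae (.of_forall fun x => by simp only [h3]; ring)
      · exact hE.integrableOn_of_continuousOn ((hx0.continuousOn.mul hv.continuousOn).mul
          (hφ.continuous_partialDeriv 0).continuousOn)
      · exact hE.integrableOn_of_continuousOn (hv.continuousOn.mul hφ.continuous.continuousOn))
  rw [Finset.sum_eq_single 0 (fun j _ hj => by simp [Pi.single_eq_of_ne hj]) (by simp),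
    Pi.single_eq_same] at h
  have h4 : ∫ x in E, x 0 * v x * weakPartial E 0 v x = 0 := by
    rw [← integral_zero Plane ℝ (μ := volume.restrict E)]
    exact integral_congr_ae (h0.mono fun x hx => by simp [hx])
  rw [h4, zero_add] at h
  have h5 := hE.eq_zero_of_integral_eq_zero
    ((hv.continuousOn.mul hv.continuousOn).mono subset_closure)
    (hE.integrableOn_continuousOn_mul hv.continuousOn hvI) (fun x => mul_self_nonneg _) h
  intro x hx
  rw [closure_eq_self_union_frontier] at hx
  rcases hx with hx | hx
  · exact mul_self_eq_zero.1 (h5 x hx)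
  · exact hv.eq_zero x hx

/-! ### Polygonal elements and the elliptic projection -/

/-- A polynomial whose gradient vanishes is constant. -/
lemma exists_eq_C_of_pderiv_eq_zero {p : Poly} (h : ∀ i, MvPolynomial.pderiv i p = 0) :
    ∃ a, p = MvPolynomial.C a := by
  have hf : ∀ x, fderiv ℝ (polyFun p) x = 0 := by
    intro x
    ext y
    have hy : y = ∑ i, y i • EuclideanSpace.single i (1 : ℝ) := by
      ext j
      fin_cases j <;> simp
    rw [hy, map_sum]
    refine (Finset.sum_eq_zero fun i _ => ?_).trans (by simp)
    have := partialDeriv_polyFun i p x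
    rw [h i, polyFun_zero, partialDeriv] at this
    rw [map_smul, this]
    simp
  refine ⟨polyFun p 0, polyFun_injective ?_⟩
  ext x
  rw [polyFun_C]
  exact is_const_of_fderiv_eq_zero (differentiable_polyFun p) hf x 0

namespace MeshElement

variable (K : MeshElement)

lemma isBddOpen : IsBddOpen K.carrier := ⟨K.isOpen, K.isBounded, K.isConnected.nonempty⟩

lemma diam_pos : 0 < K.diam := by
  obtain ⟨x, hx⟩ := K.isConnected.nonempty
  obtain ⟨ε, hε, h⟩ := Metric.isOpen_iff.1 K.isOpen x hx
  have hy : x + EuclideanSpace.single (0 : Fin 2) (ε / 2) ∈ K.carrier := h (by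
    rw [Metric.mem_ball, dist_eq_norm, add_sub_cancel_left, PiLp.norm_single,
      Real.norm_of_nonneg (by positivity)]
    linarith)
  have := Metric.dist_le_diam_of_mem K.isBounded hy hx
  rw [dist_eq_norm, add_sub_cancel_left, PiLp.norm_single,
    Real.norm_of_nonneg (by positivity)] at this
  unfold diam
  linarith

lemma area_pos : 0 < K.area :=
  ENNReal.toReal_pos (K.isOpen.measure_pos _ K.isConnected.nonempty).ne' K.isBddOpen.volume_ne_top

lemma n_pos : 0 < K.n := by
  by_contra h
  have hn : K.n = 0 := by omega
  have hfr : frontier K.carrier = ∅ := by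
    rw [K.frontier_eq, Polygon.boundary]
    have : IsEmpty (Fin K.n) := by rw [hn]; infer_instance
    simp
  rcases isClopen_iff.1 (isClopen_iff_frontier_eq_empty.2 hfr) with h0 | h0
  · exact K.isConnected.nonempty.ne_empty h0
  · have := K.isBounded
    rw [h0] at this
    exact NormedSpace.unbounded_univ ℝ Plane this

lemma continuous_edgePath (i : Fin K.n) : Continuous (K.poly.edgePath ℝ i) :=
  AffineMap.continuous_of_finiteDimensional _

lemma edgePath_mem_frontier (i : Fin K.n) {θ : ℝ} (hθ : θ ∈ Icc (0 : ℝ) 1) :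
    K.poly.edgePath ℝ i θ ∈ frontier K.carrier := by
  rw [K.frontier_eq, Polygon.boundary]
  exact mem_iUnion.2 ⟨i, mem_image_of_mem _ hθ⟩

lemma edgePath_mem_closure (i : Fin K.n) {θ : ℝ} (hθ : θ ∈ Icc (0 : ℝ) 1) :
    K.poly.edgePath ℝ i θ ∈ closure K.carrier :=
  frontier_subset_closure (K.edgePath_mem_frontier i hθ)

lemma continuousOn_comp_edgePath {X : Type*} [TopologicalSpace X] {F : Plane → X}
    (hF : ContinuousOn F (closure K.carrier)) (i : Fin K.n) :
    ContinuousOn (fun θ => F (K.poly.edgePath ℝ i θ)) (uIcc (0 : ℝ) 1) := by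
  rw [uIcc_of_le zero_le_one]
  exact hF.comp (K.continuous_edgePath i).continuousOn fun θ hθ => K.edgePath_mem_closure i hθ

lemma boundaryIntegral_smul_add {F G : Plane → ℝ} (hF : ContinuousOn F (closure K.carrier))
    (hG : ContinuousOn G (closure K.carrier)) (a b : ℝ) :
    K.boundaryIntegral (a • F + b • G) = a * K.boundaryIntegral F + b * K.boundaryIntegral G := by
  unfold boundaryIntegral
  rw [Finset.mul_sum, Finset.mul_sum, ← Finset.sum_add_distrib]
  refine Finset.sum_congr rfl fun i _ => ?_
  simp only [Pi.add_apply, Pi.smul_apply, smul_eq_mul]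
  rw [intervalIntegral.integral_add, intervalIntegral.integral_const_mul,
    intervalIntegral.integral_const_mul]
  · ring
  · exact ((K.continuousOn_comp_edgePath hF i).intervalIntegrable).const_mul a
  · exact ((K.continuousOn_comp_edgePath hG i).intervalIntegrable).const_mul b

lemma boundaryIntegral_sub {F G : Plane → ℝ} (hF : ContinuousOn F (closure K.carrier))
    (hG : ContinuousOn G (closure K.carrier)) :
    K.boundaryIntegral (fun x => F x - G x) = K.boundaryIntegral F - K.boundaryIntegral G := by
  have := K.boundaryIntegral_smul_add hF hG 1 (-1)
  rw [show (fun x => F x - G x) = (1 : ℝ) • F + (-1 : ℝ) • G by ext x; simp; ring, this]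
  ring

lemma boundaryIntegral_const_pos (hK : ∀ i, 0 < K.edgeLength i) :
    0 < K.boundaryIntegral fun _ => 1 := by
  unfold boundaryIntegral
  have : Nonempty (Fin K.n) := ⟨⟨0, K.n_pos⟩⟩
  exact Finset.sum_pos (fun i _ => by simpa using hK i) Finset.univ_nonempty

/-- The elliptic form is definite on polynomials. -/
lemma poly_eq_zero_of_energy (hK : ∀ i, 0 < K.edgeLength i) {p : Poly}
    (h : ∫ x in K.carrier, ∑ i, polyFun (MvPolynomial.pderiv i p) x *
      polyFun (MvPolynomial.pderiv i p) x = 0) (hb : K.boundaryIntegral (polyFun p) = 0) :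
    p = 0 := by
  have hE := K.isBddOpen
  have hc : Continuous fun x => ∑ i, polyFun (MvPolynomial.pderiv i p) x *
      polyFun (MvPolynomial.pderiv i p) x :=
    continuous_finsetSum _ fun i _ => (continuous_polyFun _).mul (continuous_polyFun _)
  have h1 := hE.eq_zero_of_integral_eq_zero hc.continuousOn
    (hE.integrableOn_of_continuousOn hc.continuousOn)
    (fun x => Finset.sum_nonneg fun i _ => mul_self_nonneg _) h
  obtain ⟨a, rfl⟩ := exists_eq_C_of_pderiv_eq_zero (p := p) fun i =>
    eq_zero_of_polyFun_eqOn_zero hE.isOpen hE.nonempty fun x hx => mul_self_eq_zero.1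
      ((Finset.sum_eq_zero_iff_of_nonneg fun i _ => mul_self_nonneg _).1 (h1 x hx) i
        (Finset.mem_univ i))
  have h2 := K.boundaryIntegral_smul_add (F := fun _ => (1 : ℝ)) (G := fun _ => (1 : ℝ))
    continuousOn_const continuousOn_const a 0
  have e : polyFun (MvPolynomial.C a) = a • (fun _ => (1 : ℝ)) + (0 : ℝ) • (fun _ => (1 : ℝ)) := by
    ext x; simp
  rw [e, h2, zero_mul, add_zero] at hb
  have : a = 0 := (mul_eq_zero.1 hb).resolve_right (K.boundaryIntegral_const_pos hK).ne'
  rw [this, map_zero]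

/-- Scalar functions continuous on the closure of the element and of class `W^{1,2}`, the domain
of the elliptic projection. -/
structure IsAdmissible (f : Plane → ℝ) : Prop where
  continuousOn : ContinuousOn f (closure K.carrier)
  memW12 : MemW12 K.carrier f

variable {K}

lemma IsAdmissible.smul_add {f g : Plane → ℝ} (hf : K.IsAdmissible f) (hg : K.IsAdmissible g)
    (a b : ℝ) : K.IsAdmissible (a • f + b • g) :=
  ⟨(hf.continuousOn.const_smul a).add (hg.continuousOn.const_smul b),
    hf.memW12.smul_add K.isBddOpen hg.memW12 a b⟩

lemma isAdmissible_polyFun (p : Poly) : K.IsAdmissible (polyFun p) :=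
  ⟨(continuous_polyFun p).continuousOn, K.isBddOpen.memW12_polyFun p⟩

lemma IsAdmissible.integrableOn {f : Plane → ℝ} (hf : K.IsAdmissible f) :
    IntegrableOn f K.carrier := K.isBddOpen.integrableOn_of_continuousOn hf.continuousOn

lemma IsAdmissible.integrableOn_weakPartial {f : Plane → ℝ} (hf : K.IsAdmissible f) (i : Fin 2) :
    IntegrableOn (weakPartial K.carrier i f) K.carrier :=
  K.isBddOpen.integrableOn_of_memLp (hf.memW12.isWeakPartial i).1

/-- The energy pairing of a polynomial with a gradient field. -/
lemma integrableOn_energy (q : Poly) {G : Fin 2 → Plane → ℝ}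
    (hG : ∀ i, IntegrableOn (G i) K.carrier) :
    IntegrableOn (fun x => ∑ i, polyFun (MvPolynomial.pderiv i q) x * G i x) K.carrier :=
  integrable_finsetSum _ fun i _ => K.isBddOpen.integrableOn_polyFun_mul _ (hG i)

lemma isEllProj_iff {n : ℕ} {f : Plane → ℝ} {p : Poly} (hf : K.IsAdmissible f) :
    K.IsEllProj n f p ↔ p.totalDegree ≤ n ∧
      (∀ q : Poly, q.totalDegree ≤ n →
        ∫ x in K.carrier, ∑ i, polyFun (MvPolynomial.pderiv i q) x *
            polyFun (MvPolynomial.pderiv i p) x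
          = ∫ x in K.carrier, ∑ i, polyFun (MvPolynomial.pderiv i q) x *
            weakPartial K.carrier i f x) ∧
      K.boundaryIntegral (polyFun p) = K.boundaryIntegral f := by
  unfold IsEllProj
  refine and_congr_right fun _ => and_congr (forall₂_congr fun q _ => ?_) ?_
  · simp only [mul_sub, Finset.sum_sub_distrib]
    rw [integral_sub (integrableOn_energy q hf.integrableOn_weakPartial)
      (integrableOn_energy q fun i => K.isBddOpen.integrableOn_polyFun _), sub_eq_zero, eq_comm]
  · rw [K.boundaryIntegral_sub hf.continuousOn (continuous_polyFun p).continuousOn, sub_eq_zero,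
      eq_comm]

lemma IsEllProj.smul_add {n : ℕ} {f g : Plane → ℝ} {p q : Poly} (hf : K.IsAdmissible f)
    (hg : K.IsAdmissible g) (hp : K.IsEllProj n f p) (hq : K.IsEllProj n g q) (a b : ℝ) :
    K.IsEllProj n (a • f + b • g) (a • p + b • q) := by
  rw [isEllProj_iff hf] at hp
  rw [isEllProj_iff hg] at hq
  rw [isEllProj_iff (hf.smul_add hg a b)]
  refine ⟨?_, fun s hs => ?_, ?_⟩
  · have := (MvPolynomial.restrictTotalDegree (Fin 2) ℝ n).add_mem
      (Submodule.smul_mem _ a ((MvPolynomial.mem_restrictTotalDegree _ _ _).2 hp.1))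
      (Submodule.smul_mem _ b ((MvPolynomial.mem_restrictTotalDegree _ _ _).2 hq.1))
    exact (MvPolynomial.mem_restrictTotalDegree _ _ _).1 this
  · have e1 : ∀ x, ∑ i, polyFun (MvPolynomial.pderiv i s) x *
        polyFun (MvPolynomial.pderiv i (a • p + b • q)) x
        = a * (∑ i, polyFun (MvPolynomial.pderiv i s) x * polyFun (MvPolynomial.pderiv i p) x)
          + b * ∑ i, polyFun (MvPolynomial.pderiv i s) x * polyFun (MvPolynomial.pderiv i q) x := by
      intro x
      rw [Finset.mul_sum, Finset.mul_sum, ← Finset.sum_add_distrib]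
      refine Finset.sum_congr rfl fun i _ => ?_
      simp only [map_add, Derivation.map_smul, polyFun_add, polyFun_smul, Pi.add_apply,
        Pi.smul_apply, smul_eq_mul]
      ring
    have e2 : ∫ x in K.carrier, ∑ i, polyFun (MvPolynomial.pderiv i s) x *
        weakPartial K.carrier i (a • f + b • g) x
        = ∫ x in K.carrier, (a * (∑ i, polyFun (MvPolynomial.pderiv i s) x *
            weakPartial K.carrier i f x)
          + b * ∑ i, polyFun (MvPolynomial.pderiv i s) x * weakPartial K.carrier i g x) := by
      refine integral_congr_ae ?_
      have h := fun i => weakPartial_smul_add K.isBddOpen hf.memW12 hg.memW12 a b i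
      filter_upwards [h 0, h 1] with x h0 h1
      simp only [Fin.sum_univ_two, h0, h1, Pi.add_apply, Pi.smul_apply, smul_eq_mul]
      ring
    simp only [e1]
    rw [e2, integral_add, integral_add]
    · simp only [integral_const_mul, hp.2.1 s hs, hq.2.1 s hs]
    · exact (integrableOn_energy s hf.integrableOn_weakPartial).const_mul a
    · exact (integrableOn_energy s hg.integrableOn_weakPartial).const_mul b
    · exact (integrableOn_energy s fun i => K.isBddOpen.integrableOn_polyFun _).const_mul a
    · exact (integrableOn_energy s fun i => K.isBddOpen.integrableOn_polyFun _).const_mul b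
  · rw [K.boundaryIntegral_smul_add hf.continuousOn hg.continuousOn, polyFun_add, polyFun_smul,
      polyFun_smul, K.boundaryIntegral_smul_add (continuous_polyFun p).continuousOn
      (continuous_polyFun q).continuousOn, hp.2.2, hq.2.2]

lemma isEllProj_polyFun {n : ℕ} {p : Poly} (hp : p.totalDegree ≤ n) :
    K.IsEllProj n (polyFun p) p := by
  rw [isEllProj_iff (isAdmissible_polyFun p)]
  refine ⟨hp, fun q _ => integral_congr_ae ?_, rfl⟩
  filter_upwards [K.isBddOpen.weakPartial_polyFun p 0, K.isBddOpen.weakPartial_polyFun p 1]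
    with x h0 h1
  simp only [Fin.sum_univ_two, h0, h1]

lemma IsEllProj.unique (hK : ∀ i, 0 < K.edgeLength i) {n : ℕ} {f : Plane → ℝ} {p q : Poly}
    (hf : K.IsAdmissible f) (hp : K.IsEllProj n f p) (hq : K.IsEllProj n f q) : p = q := by
  rw [isEllProj_iff hf] at hp hq
  have hdeg : (p - q).totalDegree ≤ n :=
    (MvPolynomial.totalDegree_sub _ _).trans (max_le hp.1 hq.1)
  rw [← sub_eq_zero]
  refine K.poly_eq_zero_of_energy hK ?_ ?_
  · have h := (hp.2.1 _ hdeg).trans (hq.2.1 _ hdeg).symm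
    rw [← sub_eq_zero, ← integral_sub] at h
    · rw [← h]
      refine integral_congr_ae (.of_forall fun x => ?_)
      simp only [map_sub, polyFun_sub, Pi.sub_apply, ← Finset.sum_sub_distrib]
      exact Finset.sum_congr rfl fun i _ => by ring
    · exact integrableOn_energy _ fun i => K.isBddOpen.integrableOn_polyFun _
    · exact integrableOn_energy _ fun i => K.isBddOpen.integrableOn_polyFun _
  · rw [show polyFun (p - q) = fun x => polyFun p x - polyFun q x by rw [polyFun_sub]; rfl,
      K.boundaryIntegral_sub (continuous_polyFun p).continuousOn
        (continuous_polyFun q).continuousOn,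
      hp.2.2, hq.2.2, sub_self]

lemma exists_isEllProj (hK : ∀ i, 0 < K.edgeLength i) (n : ℕ) {f : Plane → ℝ}
    (hf : K.IsAdmissible f) : ∃ p, K.IsEllProj n f p := by
  let V := MvPolynomial.restrictTotalDegree (Fin 2) ℝ n
  have hI := fun p q : Poly => integrableOn_energy (K := K) q
    (G := fun i => polyFun (MvPolynomial.pderiv i p)) fun i => K.isBddOpen.integrableOn_polyFun _
  have hIf := fun q : Poly => integrableOn_energy (K := K) q hf.integrableOn_weakPartial
  have hbI := fun (p q : Poly) (a b : ℝ) => K.boundaryIntegral_smul_add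
    (continuous_polyFun p).continuousOn (continuous_polyFun q).continuousOn a b
  let β : Poly →ₗ[ℝ] ℝ :=
    { toFun := fun p => K.boundaryIntegral (polyFun p)
      map_add' := fun p q => by simpa using hbI p q 1 1
      map_smul' := fun c p => by simpa using hbI p p c 0 }
  have hEadd : ∀ (G G' H : Fin 2 → Plane → ℝ) (x : Plane),
      ∑ i, (G i x + G' i x) * H i x = (∑ i, G i x * H i x) + ∑ i, G' i x * H i x := by
    intro G G' H x
    simp only [add_mul, Finset.sum_add_distrib]
  let e : Poly →ₗ[ℝ] Poly →ₗ[ℝ] ℝ := LinearMap.mk₂ ℝ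
    (fun p q => ∫ x in K.carrier, ∑ i, polyFun (MvPolynomial.pderiv i q) x *
            polyFun (MvPolynomial.pderiv i p) x)
    (fun p p' q => by
      rw [← integral_add (hI p q) (hI p' q)]
      exact integral_congr_ae (.of_forall fun x => by simp [mul_add, Finset.sum_add_distrib]))
    (fun c p q => by
      rw [smul_eq_mul, ← integral_const_mul]
      exact integral_congr_ae (.of_forall fun x => by simp; ring))
    (fun p q q' => by
      rw [← integral_add (hI p q) (hI p q')]
      exact integral_congr_ae (.of_forall fun x => by simp [add_mul, Finset.sum_add_distrib]))
    (fun c p q => by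
      rw [smul_eq_mul, ← integral_const_mul]
      exact integral_congr_ae (.of_forall fun x => by simp; ring))
  let ℓ : Poly →ₗ[ℝ] ℝ :=
    { toFun := fun q => ∫ x in K.carrier, ∑ i, polyFun (MvPolynomial.pderiv i q) x *
            weakPartial K.carrier i f x
      map_add' := fun q q' => by
        rw [← integral_add (hIf q) (hIf q')]
        exact integral_congr_ae (.of_forall fun x => by simp [add_mul]; ring)
      map_smul' := fun c q => by
        rw [RingHom.id_apply, smul_eq_mul, ← integral_const_mul]
        exact integral_congr_ae (.of_forall fun x => by simp; ring) }
  let B : V →ₗ[ℝ] V →ₗ[ℝ] ℝ :=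
    (e + (LinearMap.mul ℝ ℝ).compl₁₂ β β).compl₁₂ V.subtype V.subtype
  have hB : ∀ p q : V, B p q = e p q + β p * β q := fun p q => rfl
  obtain ⟨p, hp⟩ := exists_bilin_eq B (fun v hv => by
    rw [hB] at hv
    have h1 : 0 ≤ e (v : Poly) v :=
      integral_nonneg fun x => Finset.sum_nonneg fun i _ => mul_self_nonneg _
    have h2 := mul_self_nonneg (β v)
    exact Subtype.ext (K.poly_eq_zero_of_energy hK (p := v) (by change e (v : Poly) v = 0; linarith)
      (mul_self_eq_zero.1 (by change β (v : Poly) * β v = 0; linarith))))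
    ((ℓ + K.boundaryIntegral f • β).comp V.subtype)
  have hp' : ∀ q : Poly, q.totalDegree ≤ n →
      e p q + β p * β q = ℓ q + K.boundaryIntegral f * β q := fun q hq =>
    LinearMap.congr_fun hp ⟨q, (MvPolynomial.mem_restrictTotalDegree _ _ _).2 hq⟩
  -- constants determine the boundary mean
  have hbd : β p = K.boundaryIntegral f := by
    have h1 := hp' 1 (by simp)
    have e1 : e p 1 = 0 := by
      change ∫ x in K.carrier, _ = _
      simp
    have e2 : ℓ 1 = 0 := by
      change ∫ x in K.carrier, _ = _
      simp
    have e3 : 0 < β 1 := by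
      have : polyFun 1 = fun _ => (1 : ℝ) := by ext x; simp
      change 0 < K.boundaryIntegral (polyFun 1)
      rw [this]
      exact K.boundaryIntegral_const_pos hK
    rw [e1, e2, zero_add, zero_add] at h1
    exact mul_right_cancel₀ e3.ne' h1
  refine ⟨p, (isEllProj_iff hf).2
    ⟨(MvPolynomial.mem_restrictTotalDegree _ _ _).1 p.2, fun q hq => ?_, hbd⟩⟩
  have := hp' q hq
  rw [hbd] at this
  exact add_right_cancel this

lemma IsEllProj.ellProj_eq (hK : ∀ i, 0 < K.edgeLength i) {n : ℕ} {f : Plane → ℝ} {p : Poly}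
    (hf : K.IsAdmissible f) (hp : K.IsEllProj n f p) : K.ellProj n f = polyFun p := by
  have h : ∃ p, K.IsEllProj n f p := ⟨p, hp⟩
  rw [ellProj, dif_pos h, h.choose_spec.unique hK hf hp]

lemma ellProj_smul_add (hK : ∀ i, 0 < K.edgeLength i) (n : ℕ) {f g : Plane → ℝ}
    (hf : K.IsAdmissible f) (hg : K.IsAdmissible g) (a b : ℝ) :
    K.ellProj n (a • f + b • g) = a • K.ellProj n f + b • K.ellProj n g := by
  obtain ⟨p, hp⟩ := exists_isEllProj hK n hf
  obtain ⟨q, hq⟩ := exists_isEllProj hK n hg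
  rw [(hp.smul_add hf hg hq a b).ellProj_eq hK (hf.smul_add hg a b), hp.ellProj_eq hK hf,
    hq.ellProj_eq hK hg]
  simp

lemma continuous_ellProj (n : ℕ) (f : Plane → ℝ) : Continuous (K.ellProj n f) := by
  by_cases h : ∃ p, K.IsEllProj n f p
  · rw [ellProj, dif_pos h]
    exact continuous_polyFun _
  · rw [ellProj, dif_neg h]
    exact continuous_zero

end MeshElement

namespace MeshElement

variable {K : MeshElement}

/-! ### The local virtual element space -/

/-- Vector fields with admissible components. -/
def IsAdmissibleField (K : MeshElement) (v : Plane → Plane) : Prop :=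
  ∀ i, K.IsAdmissible fun x => v x i

lemma comp_smul_add (v w : Plane → Plane) (a b : ℝ) (i : Fin 2) :
    (fun x => (a • v + b • w) x i) = a • (fun x => v x i) + b • fun x => w x i := by
  ext x; simp

lemma InLocalSpace.isAdmissibleField {k : ℕ} {v : Plane → Plane} (hv : K.InLocalSpace k v) :
    K.IsAdmissibleField v := fun i =>
  ⟨(EuclideanSpace.proj (𝕜 := ℝ) i).continuous.comp_continuousOn hv.continuousOn, hv.memW12 i⟩

lemma IsAdmissibleField.continuousOn {v : Plane → Plane} (hv : K.IsAdmissibleField v) :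
    ContinuousOn v (closure K.carrier) := by
  have : ContinuousOn (fun x => WithLp.ofLp (v x)) (closure K.carrier) :=
    continuousOn_pi.2 fun i => (hv i).continuousOn
  exact (PiLp.continuous_toLp 2 _).comp_continuousOn this

lemma IsAdmissibleField.smul_add {v w : Plane → Plane} (hv : K.IsAdmissibleField v)
    (hw : K.IsAdmissibleField w) (a b : ℝ) : K.IsAdmissibleField (a • v + b • w) := fun i => by
  rw [comp_smul_add]
  exact (hv i).smul_add (hw i) a b

/-- The vector field with the given polynomial components. -/
def polyField (P : Fin 2 → Poly) (x : Plane) : Plane := WithLp.toLp 2 fun i => polyFun (P i) x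

lemma polyField_apply (P : Fin 2 → Poly) (i : Fin 2) :
    (fun x => polyField P x i) = polyFun (P i) := rfl

lemma isAdmissibleField_polyField (P : Fin 2 → Poly) : K.IsAdmissibleField (polyField P) :=
  fun i => isAdmissible_polyFun (P i)

lemma continuous_polyField (P : Fin 2 → Poly) : Continuous (polyField P) :=
  (PiLp.continuous_toLp 2 _).comp (continuous_pi fun i => continuous_polyFun (P i))

lemma weakPartial_comp_smul_add {v w : Plane → Plane} (hv : K.IsAdmissibleField v)
    (hw : K.IsAdmissibleField w) (a b : ℝ) (i j : Fin 2) :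
    ∀ᵐ x ∂volume.restrict K.carrier, weakPartial K.carrier j (fun y => (a • v + b • w) y i) x
      = a * weakPartial K.carrier j (fun y => v y i) x
        + b * weakPartial K.carrier j (fun y => w y i) x := by
  rw [comp_smul_add]
  exact weakPartial_smul_add K.isBddOpen (hv i).memW12 (hw i).memW12 a b j

lemma weakDiv_smul_add {v w : Plane → Plane} (hv : K.IsAdmissibleField v)
    (hw : K.IsAdmissibleField w) (a b : ℝ) :
    ∀ᵐ x ∂volume.restrict K.carrier, weakDiv K.carrier (a • v + b • w) x
      = a * weakDiv K.carrier v x + b * weakDiv K.carrier w x := by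
  filter_upwards [weakPartial_comp_smul_add hv hw a b 0 0, weakPartial_comp_smul_add hv hw a b 1 1]
    with x h0 h1
  simp only [weakDiv, Fin.sum_univ_two, h0, h1]
  ring

lemma IsAdmissibleField.memLp_weakDiv {v : Plane → Plane} (hv : K.IsAdmissibleField v) :
    MemLp (weakDiv K.carrier v) 2 (volume.restrict K.carrier) := by
  have : weakDiv K.carrier v = ∑ i, weakPartial K.carrier i (fun y => v y i) := by
    ext x; simp [weakDiv]
  rw [this]
  exact memLp_finsetSum' _ fun i _ => ((hv i).memW12.isWeakPartial i).1

lemma ellProjVec_smul_add (hK : ∀ i, 0 < K.edgeLength i) (n : ℕ) {v w : Plane → Plane}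
    (hv : K.IsAdmissibleField v) (hw : K.IsAdmissibleField w) (a b : ℝ) :
    K.ellProjVec n (a • v + b • w) = a • K.ellProjVec n v + b • K.ellProjVec n w := by
  ext x i
  simp only [ellProjVec, comp_smul_add, ellProj_smul_add hK n (hv i) (hw i)]
  simp [ellProjVec]

lemma continuous_ellProjVec (n : ℕ) (v : Plane → Plane) : Continuous (K.ellProjVec n v) :=
  (PiLp.continuous_toLp 2 _).comp (continuous_pi fun _ => continuous_ellProj n _)

lemma continuous_perp : Continuous perp := by
  unfold perp
  refine (PiLp.continuous_toLp 2 _).comp (continuous_pi fun i => ?_)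
  fin_cases i
  · exact (EuclideanSpace.proj (𝕜 := ℝ) (1 : Fin 2)).continuous
  · exact (EuclideanSpace.proj (𝕜 := ℝ) (0 : Fin 2)).continuous.neg

lemma monomial_eq_polyFun (α : ℕ × ℕ) :
    K.monomial α = polyFun (shiftedMonomial K.centroid K.diam α.1 α.2) := by
  ext x
  simp [monomial, shiftedMonomial, polyFun, div_eq_inv_mul]

lemma continuous_of_mem_highPoly {k : ℕ} {m : Plane → ℝ} (hm : m ∈ K.highPoly k) :
    Continuous m := by
  let S : Submodule ℝ (Plane → ℝ) :=
    { carrier := {f | Continuous f}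
      zero_mem' := continuous_zero
      add_mem' := fun h h' => h.add h'
      smul_mem' := fun c f h => h.const_smul c }
  have : K.highPoly k ≤ S := Submodule.span_le.2 (by
    rintro _ ⟨α, -, -, rfl⟩
    rw [monomial_eq_polyFun]
    exact continuous_polyFun _)
  exact this hm

/-- The weak Stokes functional of a field, tested with one component. -/
lemma integrableOn_stokes {v : Plane → Plane} (hv : K.IsAdmissibleField v) (i : Fin 2)
    {φ : Plane → ℝ} (hφ : IsTestFunction K.carrier φ) :
    IntegrableOn (fun x => ∑ j, weakPartial K.carrier j (fun y => v y i) x * partialDeriv j φ x)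
      K.carrier :=
  integrable_finsetSum _ fun j _ => ((hv i).integrableOn_weakPartial j).mul_continuousOn_of_subset
    (hφ.continuous_partialDeriv j).continuousOn K.isBddOpen.measurableSet
    K.isBddOpen.isCompact_closure subset_closure

lemma InLocalSpace.smul_add (hK : ∀ i, 0 < K.edgeLength i) {k : ℕ} {v w : Plane → Plane}
    (hv : K.InLocalSpace k v) (hw : K.InLocalSpace k w) (a b : ℝ) :
    K.InLocalSpace k (a • v + b • w) := by
  have hva := hv.isAdmissibleField
  have hwa := hw.isAdmissibleField
  have hE := K.isBddOpen
  refine ⟨(hva.smul_add hwa a b).continuousOn, fun i => (hva.smul_add hwa a b i).memW12,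
    ?_, ?_, fun i => ?_, fun i => ?_, fun m hm => ?_⟩
  · obtain ⟨s, hs, hs0, p, hp, hsp⟩ := hv.stokes
    obtain ⟨t, ht, ht0, q, hq, htq⟩ := hw.stokes
    have hsI := hE.integrableOn_of_memLp hs
    have htI := hE.integrableOn_of_memLp ht
    refine ⟨a • s + b • t, (hs.const_smul a).add (ht.const_smul b), ?_, a • p + b • q, ?_, ?_⟩
    · simp only [Pi.add_apply, Pi.smul_apply, smul_eq_mul]
      rw [integral_add (hsI.const_mul a) (htI.const_mul b), integral_const_mul, integral_const_mul,
        hs0, ht0]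
      simp
    · have := (MvPolynomial.restrictTotalDegree (Fin 2) ℝ (k - 1)).add_mem
        (Submodule.smul_mem _ a ((MvPolynomial.mem_restrictTotalDegree _ _ _).2 hp))
        (Submodule.smul_mem _ b ((MvPolynomial.mem_restrictTotalDegree _ _ _).2 hq))
      exact (MvPolynomial.mem_restrictTotalDegree _ _ _).1 this
    · intro i φ hφ
      have h1 := hsp i φ hφ
      have h2 := htq i φ hφ
      have e1 : ∫ x in K.carrier, ∑ j, weakPartial K.carrier j (fun y => (a • v + b • w) y i) x
            * partialDeriv j φ x
          = a * (∫ x in K.carrier, ∑ j, weakPartial K.carrier j (fun y => v y i) x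
              * partialDeriv j φ x)
            + b * ∫ x in K.carrier, ∑ j, weakPartial K.carrier j (fun y => w y i) x
              * partialDeriv j φ x := by
        rw [← integral_const_mul, ← integral_const_mul, ← integral_add
          ((integrableOn_stokes hva i hφ).const_mul a) ((integrableOn_stokes hwa i hφ).const_mul b)]
        refine integral_congr_ae ?_
        filter_upwards [weakPartial_comp_smul_add hva hwa a b i 0,
          weakPartial_comp_smul_add hva hwa a b i 1] with x h0 h1
        simp only [Fin.sum_univ_two, h0, h1]
        ring
      have I : ∀ {f : Plane → ℝ}, IntegrableOn f K.carrier →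
          IntegrableOn (fun x => f x * partialDeriv i φ x) K.carrier := fun hf =>
        hf.mul_continuousOn_of_subset (hφ.continuous_partialDeriv i).continuousOn
          hE.measurableSet hE.isCompact_closure subset_closure
      have e2 : ∫ x in K.carrier, (a • s + b • t) x * partialDeriv i φ x
          = a * (∫ x in K.carrier, s x * partialDeriv i φ x)
            + b * ∫ x in K.carrier, t x * partialDeriv i φ x := by
        rw [← integral_const_mul, ← integral_const_mul, ← integral_add
          ((I hsI).const_mul a) ((I htI).const_mul b)]
        exact integral_congr_ae (.of_forall fun x => by simp; ring)
      have J : ∀ p : Poly, IntegrableOn (fun x => perp x i * polyFun p x * φ x) K.carrier :=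
        fun p => hE.integrableOn_of_continuousOn
          ((((EuclideanSpace.proj (𝕜 := ℝ) i).continuous.comp continuous_perp).mul
            (continuous_polyFun p)).mul hφ.continuous).continuousOn
      have e3 : ∫ x in K.carrier, perp x i * polyFun (a • p + b • q) x * φ x
          = a * (∫ x in K.carrier, perp x i * polyFun p x * φ x)
            + b * ∫ x in K.carrier, perp x i * polyFun q x * φ x := by
        rw [← integral_const_mul, ← integral_const_mul, ← integral_add
          ((J p).const_mul a) ((J q).const_mul b)]
        exact integral_congr_ae (.of_forall fun x => by simp; ring)
      rw [e1, e2, e3, ← h1, ← h2]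
      ring
  · obtain ⟨p, hp, hvp⟩ := hv.div_poly
    obtain ⟨q, hq, hwq⟩ := hw.div_poly
    refine ⟨a • p + b • q, ?_, ?_⟩
    · have := (MvPolynomial.restrictTotalDegree (Fin 2) ℝ (k - 1)).add_mem
        (Submodule.smul_mem _ a ((MvPolynomial.mem_restrictTotalDegree _ _ _).2 hp))
        (Submodule.smul_mem _ b ((MvPolynomial.mem_restrictTotalDegree _ _ _).2 hq))
      exact (MvPolynomial.mem_restrictTotalDegree _ _ _).1 this
    · filter_upwards [hvp, hwq, weakDiv_smul_add hva hwa a b] with x h1 h2 h3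
      rw [h3, h1, h2]
      simp
  · obtain ⟨p, hp, hvp⟩ := hv.normal_poly i
    obtain ⟨q, hq, hwq⟩ := hw.normal_poly i
    refine ⟨a • p + b • q, Polynomial.natDegree_add_le_of_degree_le
      ((Polynomial.natDegree_smul_le _ _).trans hp) ((Polynomial.natDegree_smul_le _ _).trans hq),
      fun θ hθ => ?_⟩
    simp only [Pi.add_apply, Pi.smul_apply, inner_add_left, inner_smul_left, hvp θ hθ, hwq θ hθ]
    simp
  · obtain ⟨p, hp, hvp⟩ := hv.tangent_poly i
    obtain ⟨q, hq, hwq⟩ := hw.tangent_poly i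
    refine ⟨a • p + b • q, Polynomial.natDegree_add_le_of_degree_le
      ((Polynomial.natDegree_smul_le _ _).trans hp) ((Polynomial.natDegree_smul_le _ _).trans hq),
      fun θ hθ => ?_⟩
    simp only [Pi.add_apply, Pi.smul_apply, inner_add_left, inner_smul_left, hvp θ hθ, hwq θ hθ]
    simp
  · have I : ∀ {v : Plane → Plane}, K.IsAdmissibleField v →
        IntegrableOn (fun x => inner ℝ (v x - K.ellProjVec k v x) (m x • perp x)) K.carrier :=
      fun hv => hE.integrableOn_of_continuousOn
        ((hv.continuousOn.sub (continuous_ellProjVec k _).continuousOn).inner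
          ((continuous_of_mem_highPoly hm).smul continuous_perp).continuousOn)
    have h1 := hv.enhanced m hm
    have h2 := hw.enhanced m hm
    have e : ∀ x, inner ℝ ((a • v + b • w) x - K.ellProjVec k (a • v + b • w) x) (m x • perp x)
        = a * inner ℝ (v x - K.ellProjVec k v x) (m x • perp x)
          + b * inner ℝ (w x - K.ellProjVec k w x) (m x • perp x) := by
      intro x
      rw [ellProjVec_smul_add hK k hva hwa]
      simp only [Pi.add_apply, Pi.smul_apply, inner_sub_left, inner_add_left, inner_smul_left]
      simp
      ring
    simp only [e]
    rw [integral_add ((I hva).const_mul a) ((I hwa).const_mul b), integral_const_mul,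
      integral_const_mul, h1, h2]
    simp

/-- The restriction of a polynomial field to an edge is polynomial in the edge parameter. -/
lemma exists_polynomial_edge (P : Fin 2 → Poly) {k : ℕ} (hP : ∀ i, (P i).totalDegree ≤ k)
    (i : Fin K.n) (z : Plane) : ∃ q : Polynomial ℝ, q.natDegree ≤ k ∧
      ∀ θ, inner ℝ (polyField P (K.poly.edgePath ℝ i θ)) z = q.eval θ := by
  let ℓ : Fin 2 → Polynomial ℝ := fun c => Polynomial.C (K.poly i c)
    + Polynomial.C (K.poly (finRotate K.n i) c - K.poly i c) * Polynomial.X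
  refine ⟨∑ c, z c • MvPolynomial.aeval ℓ (P c), ?_, fun θ => ?_⟩
  · refine Polynomial.natDegree_sum_le_of_forall_le _ _ fun c _ =>
      (Polynomial.natDegree_smul_le _ _).trans ?_
    have h1 := MvPolynomial.aeval_natDegree_le (P c) (hP c) ℓ (n := 1) (fun c => by
      refine Polynomial.natDegree_add_le_of_degree_le (by simp) ?_
      exact (Polynomial.natDegree_C_mul_le _ _).trans Polynomial.natDegree_X_le)
    simpa using h1
  · have h2 : ∀ c, Polynomial.eval θ (ℓ c) = K.poly.edgePath ℝ i θ c := by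
      intro c
      simp [ℓ, Polygon.edgePath, AffineMap.lineMap_apply]
      ring
    simp only [PiLp.inner_apply, Polynomial.eval_finsetSum, Polynomial.eval_smul, smul_eq_mul,
      polyField, polyFun]
    refine Finset.sum_congr rfl fun c _ => ?_
    have h3 : Polynomial.eval θ (MvPolynomial.aeval ℓ (P c))
        = MvPolynomial.eval (fun c => K.poly.edgePath ℝ i θ c) (P c) := by
      have := MvPolynomial.comp_aeval_apply (φ := Polynomial.aeval (R := ℝ) θ) ℓ (P c)
      simp only [Polynomial.coe_aeval_eq_eval] at this
      rw [← MvPolynomial.coe_aeval_eq_eval]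
      simp only [← h2]
      exact this
    rw [h3]
    simp

lemma ellProjVec_polyField (hK : ∀ i, 0 < K.edgeLength i) {k : ℕ} {P : Fin 2 → Poly}
    (hP : ∀ i, (P i).totalDegree ≤ k) : K.ellProjVec k (polyField P) = polyField P := by
  ext x i
  simp only [ellProjVec, polyField_apply]
  rw [(isEllProj_polyFun (hP i)).ellProj_eq hK (isAdmissible_polyFun (P i))]
  rfl

/-- The local space contains the vector polynomials of degree at most `k`. -/
lemma inLocalSpace_polyField (hK : ∀ i, 0 < K.edgeLength i) {k : ℕ} {P : Fin 2 → Poly}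
    (hP : ∀ i, (P i).totalDegree ≤ k) : K.InLocalSpace k (polyField P) := by
  have hE := K.isBddOpen
  have hPk : ∀ i, P i ∈ polyLT 0 1 (k + 1) := fun i => (mem_polyLT_iff one_ne_zero).2 (hP i)
  refine ⟨(continuous_polyField P).continuousOn, fun i => hE.memW12_polyFun (P i),
    ?_, ?_, fun i => ?_, fun i => ?_, fun m hm => ?_⟩
  · obtain ⟨s, t, ht, hst⟩ := exists_grad_add_perp (c := 0) (h := 1) one_ne_zero (n := k - 1)
      (fun i => ∑ j, MvPolynomial.pderiv j (MvPolynomial.pderiv j (P i)))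
      (fun i => Submodule.sum_mem _ fun j _ => pderiv_mem_polyLT (pderiv_mem_polyLT (hPk i) j) j)
    -- the pressure is the potential of the gradient part, normalized to have zero mean
    set a : ℝ := (∫ x in K.carrier, polyFun s x) / K.area with ha
    set s' : Poly := MvPolynomial.C a - s with hs'
    refine ⟨polyFun s', hE.memLp_of_continuousOn (continuous_polyFun _).continuousOn, ?_, t, ?_, ?_⟩
    · have := hE.isFiniteMeasure
      have e : ∀ x, polyFun s' x = a - polyFun s x := fun x => by simp [hs']
      simp only [e]
      rw [integral_sub (integrable_const a) (hE.integrableOn_polyFun s), integral_const, ha]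
      simp only [measureReal_restrict_apply_univ, smul_eq_mul]
      change K.area * _ - _ = _
      rw [mul_div_cancel₀ _ K.area_pos.ne', sub_self]
    · exact (mem_polyLT_iff one_ne_zero).1 (polyLT_mono 0 1 (by omega) ht)
    · intro i φ hφ
      have ibp := fun (p : Poly) (j : Fin 2) =>
        hφ.integral_mul_partialDeriv (contDiff_polyFun p (n := 1)) j
      simp only [partialDeriv_polyFun] at ibp
      have I : ∀ p : Poly, IntegrableOn (fun x => polyFun p x * φ x) K.carrier := fun p =>
        hE.integrableOn_of_continuousOn ((continuous_polyFun p).mul hφ.continuous).continuousOn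
      have e1 : ∫ x in K.carrier, ∑ j, weakPartial K.carrier j (fun y => polyField P y i) x
          * partialDeriv j φ x
          = -∫ x in K.carrier,
            polyFun (∑ j, MvPolynomial.pderiv j (MvPolynomial.pderiv j (P i))) x * φ x := by
        have h0 : ∫ x in K.carrier, ∑ j, weakPartial K.carrier j (fun y => polyField P y i) x
            * partialDeriv j φ x
            = ∫ x in K.carrier, ∑ j, polyFun (MvPolynomial.pderiv j (P i)) x
              * partialDeriv j φ x := by
          refine integral_congr_ae ?_
          simp only [polyField_apply]
          filter_upwards [hE.weakPartial_polyFun (P i) 0, hE.weakPartial_polyFun (P i) 1]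
            with x h0 h1
          simp only [Fin.sum_univ_two, h0, h1]
        have J : ∀ j, IntegrableOn (fun x => polyFun (MvPolynomial.pderiv j (P i)) x
            * partialDeriv j φ x) K.carrier := fun j => hE.integrableOn_of_continuousOn
          ((continuous_polyFun _).mul (hφ.continuous_partialDeriv j)).continuousOn
        rw [h0, integral_finsetSum _ fun j _ => J j]
        simp only [ibp, Fin.sum_univ_two, polyFun_add, Pi.add_apply, add_mul]
        rw [integral_add (I _) (I _)]
        ring
      have hpp : ∀ x, perp x i = polyFun (perpPoly 0 i) x := fun x => by
        rw [polyFun_perpPoly, sub_zero]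
      have e2 : MvPolynomial.pderiv i s' = -MvPolynomial.pderiv i s := by simp [hs']
      rw [e1, ibp s' i, neg_neg, sub_neg_eq_add, ← integral_add (I _) (I _)]
      refine integral_congr_ae (.of_forall fun x => ?_)
      simp only [hst i, e2, hpp]
      simp
      ring
  · refine ⟨∑ i, MvPolynomial.pderiv i (P i), ?_, ?_⟩
    · rcases k with _ | k
      · have h0 : ∑ i, MvPolynomial.pderiv i (P i) ∈ polyLT 0 1 (0 + 1) :=
          polyLT_mono 0 1 (by omega) (Submodule.sum_mem _ fun i _ => pderiv_mem_polyLT (hPk i) i)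
        exact (mem_polyLT_iff one_ne_zero).1 h0
      · exact (mem_polyLT_iff one_ne_zero).1
          (Submodule.sum_mem _ fun i _ => pderiv_mem_polyLT (hPk i) i)
    · filter_upwards [hE.weakPartial_polyFun (P 0) 0, hE.weakPartial_polyFun (P 1) 1]
        with x h0 h1
      simp only [weakDiv, polyField_apply, Fin.sum_univ_two, h0, h1, polyFun_add, Pi.add_apply]
  · obtain ⟨q, hq, h⟩ := exists_polynomial_edge P hP i (K.normal i)
    exact ⟨q, hq.trans (le_max_right _ _), fun θ _ => h θ⟩
  · obtain ⟨q, hq, h⟩ := exists_polynomial_edge P hP i (K.tangent i)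
    exact ⟨q, hq, fun θ _ => h θ⟩
  · rw [ellProjVec_polyField hK hP]
    simp

end MeshElement

/-! ### Unisolvence of the degrees of freedom -/

/-- A polynomial of degree at most `d` on the unit interval is determined by its end values and its
moments of degree at most `d - 2`: a polynomial with vanishing data is `θ(θ - 1)s` with
`∫ θ(θ - 1)s² = 0`. -/
lemma polynomial_eq_zero_of_moments {q : Polynomial ℝ} {d : ℕ} (hd : 1 ≤ d) (hq : q.natDegree ≤ d)
    (h0 : q.eval 0 = 0) (h1 : q.eval 1 = 0)
    (hm : ∀ j, j < d - 1 → ∫ θ in (0 : ℝ)..1, q.eval θ * (θ - 1 / 2) ^ j = 0) : q = 0 := by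
  obtain ⟨q₁, hq₁⟩ := Polynomial.dvd_iff_isRoot.2 (show q.IsRoot 0 from h0)
  have h2 : q₁.IsRoot 1 := by
    rw [hq₁] at h1
    simpa using h1
  obtain ⟨s, hs⟩ := Polynomial.dvd_iff_isRoot.2 h2
  have hqs : q = (Polynomial.X - Polynomial.C 0) * ((Polynomial.X - Polynomial.C 1) * s) := by
    rw [hq₁, hs]
  by_contra hne
  have hs0 : s ≠ 0 := by
    rintro rfl
    exact hne (by rw [hqs]; simp)
  have hdeg : q.natDegree = s.natDegree + 2 := by
    rw [hqs, Polynomial.natDegree_mul (Polynomial.X_sub_C_ne_zero 0)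
      (mul_ne_zero (Polynomial.X_sub_C_ne_zero 1) hs0),
      Polynomial.natDegree_mul (Polynomial.X_sub_C_ne_zero 1) hs0, Polynomial.natDegree_X_sub_C,
      Polynomial.natDegree_X_sub_C]
    omega
  have hsum : ∀ θ : ℝ, s.eval θ = ∑ j ∈ Finset.range (s.natDegree + 1),
      (Polynomial.taylor (1 / 2) s).coeff j * (θ - 1 / 2) ^ j := by
    intro θ
    have := Polynomial.taylor_eval_sub (R := ℝ) (1 / 2) s θ
    rw [← this, Polynomial.eval_eq_sum_range, Polynomial.natDegree_taylor]
  have hint : ∫ θ in (0 : ℝ)..1, q.eval θ * s.eval θ = 0 := by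
    simp only [hsum, Finset.mul_sum]
    rw [intervalIntegral.integral_finsetSum]
    · refine Finset.sum_eq_zero fun j hj => ?_
      have hj' := Finset.mem_range.1 hj
      have e : ∀ θ : ℝ, q.eval θ * ((Polynomial.taylor (1 / 2) s).coeff j * (θ - 1 / 2) ^ j)
          = (Polynomial.taylor (1 / 2) s).coeff j * (q.eval θ * (θ - 1 / 2) ^ j) := fun θ => by ring
      simp only [e]
      rw [intervalIntegral.integral_const_mul, hm j (by omega), mul_zero]
    · intro j _
      refine Continuous.intervalIntegrable ?_ _ _
      exact q.continuous.mul (by fun_prop)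
  have hint' : ∫ θ in (0 : ℝ)..1, θ * (1 - θ) * s.eval θ ^ 2 = 0 := by
    have e : ∀ θ : ℝ, θ * (1 - θ) * s.eval θ ^ 2 = -(q.eval θ * s.eval θ) := by
      intro θ
      rw [hqs]
      simp
      ring
    simp only [e]
    rw [intervalIntegral.integral_neg, hint, neg_zero]
  have hc : Continuous fun θ : ℝ => θ * (1 - θ) * s.eval θ ^ 2 := by
    have := s.continuous
    fun_prop
  have hzero : ∀ θ ∈ Ioo (0 : ℝ) 1, s.eval θ = 0 := by
    intro θ hθ
    by_contra hsθ
    have hpos : 0 < ∫ θ in (0 : ℝ)..1, θ * (1 - θ) * s.eval θ ^ 2 := by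
      refine intervalIntegral.integral_pos zero_lt_one hc.continuousOn (fun x hx => ?_)
        ⟨θ, Ioo_subset_Icc_self hθ, ?_⟩
      · exact mul_nonneg (mul_nonneg hx.1.le (by linarith [hx.2])) (sq_nonneg _)
      · have := hθ.1
        have : 0 < 1 - θ := by linarith [hθ.2]
        positivity
    linarith
  exact hs0 (Polynomial.eq_zero_of_infinite_isRoot s
    ((Ioo_infinite (zero_lt_one (α := ℝ))).mono fun θ hθ => hzero θ hθ))

namespace MeshElement

variable {K : MeshElement}

lemma edgePath_zero (i : Fin K.n) : K.poly.edgePath ℝ i 0 = K.poly i :=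
  AffineMap.lineMap_apply_zero _ _

lemma edgePath_one (i : Fin K.n) : K.poly.edgePath ℝ i 1 = K.poly (finRotate K.n i) :=
  AffineMap.lineMap_apply_one _ _

/-- The tangent and the normal of an edge span the plane. -/
lemma eq_zero_of_inner_tangent_normal {i : Fin K.n} (hi : 0 < K.edgeLength i) {z : Plane}
    (hn : inner ℝ z (K.normal i) = 0) (ht : inner ℝ z (K.tangent i) = 0) : z = 0 := by
  have hunit : K.tangent i 0 ^ 2 + K.tangent i 1 ^ 2 = 1 := by
    have h1 : ‖K.tangent i‖ = 1 := by
      rw [tangent, norm_smul, norm_inv, Real.norm_of_nonneg hi.le, ← dist_eq_norm, dist_comm]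
      exact inv_mul_cancel₀ hi.ne'
    have h2 := EuclideanSpace.norm_sq_eq (K.tangent i)
    rw [h1, Fin.sum_univ_two, Real.norm_eq_abs, Real.norm_eq_abs, sq_abs, sq_abs] at h2
    linarith
  simp only [PiLp.inner_apply, Fin.sum_univ_two, normal, perp] at hn ht
  simp at hn ht
  ext c
  fin_cases c
  · change z 0 = 0
    linear_combination (-z 0) * hunit + K.tangent i 0 * ht + K.tangent i 1 * hn
  · change z 1 = 0
    linear_combination (-z 1) * hunit + K.tangent i 1 * ht - K.tangent i 0 * hn

section Unisolvence

variable {k : ℕ} {v : Plane → Plane}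

/-- The vertex values and the edge moments determine the boundary values. -/
lemma InLocalSpace.eq_zero_of_mem_frontier (hk : 1 ≤ k) (hK : ∀ i, 0 < K.edgeLength i)
    (hv : K.InLocalSpace k v) (hdof : K.dof k v = 0) : ∀ x ∈ frontier K.carrier, v x = 0 := by
  have hd : ∀ j, K.dof k v j = 0 := fun j => by rw [hdof]; rfl
  have hvert : ∀ i, v (K.poly i) = 0 := by
    intro i
    ext c
    exact hd (.inl (i, c))
  intro x hx
  rw [K.frontier_eq, Polygon.boundary] at hx
  obtain ⟨i, θ, hθ, rfl⟩ := mem_iUnion.1 hx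
  change v (K.poly.edgePath ℝ i θ) = 0
  refine eq_zero_of_inner_tangent_normal (hK i) ?_ ?_
  · obtain ⟨q, hq, h⟩ := hv.normal_poly i
    have hq0 : q = 0 := by
      refine polynomial_eq_zero_of_moments (by omega) hq ?_ ?_ fun j hj => ?_
      · rw [← h 0 (by simp), edgePath_zero, hvert, inner_zero_left]
      · rw [← h 1 (by simp), edgePath_one, hvert, inner_zero_left]
      · have := hd (.inr (.inr (.inl (i, ⟨j, hj⟩))))
        refine Eq.trans ?_ this
        change ∫ θ in (0 : ℝ)..1, _ = ∫ θ in (0 : ℝ)..1, _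
        refine intervalIntegral.integral_congr fun θ hθ => ?_
        rw [uIcc_of_le zero_le_one] at hθ
        simp only [h θ hθ]
    rw [h θ hθ, hq0, Polynomial.eval_zero]
  · obtain ⟨q, hq, h⟩ := hv.tangent_poly i
    have hq0 : q = 0 := by
      refine polynomial_eq_zero_of_moments hk hq ?_ ?_ fun j hj => ?_
      · rw [← h 0 (by simp), edgePath_zero, hvert, inner_zero_left]
      · rw [← h 1 (by simp), edgePath_one, hvert, inner_zero_left]
      · have := hd (.inr (.inl (i, ⟨j, hj⟩)))
        refine Eq.trans ?_ this
        change ∫ θ in (0 : ℝ)..1, _ = ∫ θ in (0 : ℝ)..1, _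
        refine intervalIntegral.integral_congr fun θ hθ => ?_
        rw [uIcc_of_le zero_le_one] at hθ
        simp only [h θ hθ]
    rw [h θ hθ, hq0, Polynomial.eval_zero]

/-- Linear functionals of polynomials vanish on `P_{n-1}` once they vanish on the shifted
monomials. -/
lemma integral_eq_zero_of_monomials {n : ℕ} {f : Plane → ℝ} (hf : IntegrableOn f K.carrier)
    (h : ∀ a b, a + b < n → ∫ x in K.carrier, f x * K.monomial (a, b) x = 0) {p : Poly}
    (hp : p ∈ polyLT K.centroid K.diam n) : ∫ x in K.carrier, f x * polyFun p x = 0 := by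
  have I : ∀ p : Poly, IntegrableOn (fun x => f x * polyFun p x) K.carrier := fun p =>
    hf.mul_continuousOn_of_subset (continuous_polyFun p).continuousOn K.isBddOpen.measurableSet
      K.isBddOpen.isCompact_closure subset_closure
  let ℓ : Poly →ₗ[ℝ] ℝ :=
    { toFun := fun p => ∫ x in K.carrier, f x * polyFun p x
      map_add' := fun p q => by
        rw [← integral_add (I p) (I q)]
        exact integral_congr_ae (.of_forall fun x => by simp [mul_add])
      map_smul' := fun c p => by
        rw [RingHom.id_apply, smul_eq_mul, ← integral_const_mul]
        exact integral_congr_ae (.of_forall fun x => by simp; ring) }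
  have hker : polyLT K.centroid K.diam n ≤ LinearMap.ker ℓ := by
    refine Submodule.span_le.2 ?_
    rintro _ ⟨a, b, hab, rfl⟩
    have := h a b hab
    rw [monomial_eq_polyFun] at this
    exact this
  exact hker hp

/-- The divergence is a polynomial of degree at most `k - 1`. Its moments against nonconstant
monomials are degrees of freedom, and its mean vanishes with the boundary values. -/
lemma weakDiv_ae_eq_zero (hk : 1 ≤ k) (hv : K.InLocalSpace k v) (hdof : K.dof k v = 0)
    (htr : ∀ i, HasZeroTrace K.carrier fun x => v x i) :
    weakDiv K.carrier v =ᵐ[volume.restrict K.carrier] 0 := by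
  have hE := K.isBddOpen
  have hd : ∀ j, K.dof k v j = 0 := fun j => by rw [hdof]; rfl
  have hdivI := hE.integrableOn_of_memLp hv.isAdmissibleField.memLp_weakDiv
  obtain ⟨q, hq, h⟩ := hv.div_poly
  have h1 : ∫ x in K.carrier, weakDiv K.carrier v x * polyFun q x = 0 := by
    refine integral_eq_zero_of_monomials hdivI (n := k) (fun a b hab => ?_)
      (by
        obtain ⟨k, rfl⟩ : ∃ m, k = m + 1 := ⟨k - 1, by omega⟩
        exact (mem_polyLT_iff K.diam_pos.ne').2 hq)
    rcases Nat.eq_zero_or_pos (a + b) with h0 | h0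
    · obtain ⟨rfl, rfl⟩ : a = 0 ∧ b = 0 := by omega
      simp only [monomial, pow_zero, mul_one]
      have e : ∀ i, ∫ x in K.carrier, weakPartial K.carrier i (fun y => v y i) x = 0 := by
        intro i
        have := (htr i).integral_mul_partialDeriv hE (f := fun _ => (1 : ℝ)) contDiff_const i
        have h3 : ∀ x, partialDeriv i (fun _ => (1 : ℝ)) x = 0 := fun x => by simp [partialDeriv]
        simpa [h3] using this
      simp only [weakDiv]
      rw [integral_finsetSum _ fun i _ => (hv.isAdmissibleField i).integrableOn_weakPartial i]
      simp [e]
    · have hmem : ((a, b) : ℕ × ℕ) ∈ divIndex k := by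
        simp only [divIndex, Finset.mem_filter, Finset.mem_product, Finset.mem_range]
        omega
      have h2 :
          K.diam / K.area * ∫ x in K.carrier, weakDiv K.carrier v x * K.monomial (a, b) x = 0 :=
        hd (.inr (.inr (.inr (.inr ⟨(a, b), hmem⟩))))
      exact (mul_eq_zero.1 h2).resolve_left (div_pos K.diam_pos K.area_pos).ne'
  have hq0 : q = 0 := by
    refine hE.poly_eq_zero_of_integral_mul_self ?_
    rw [← h1]
    exact integral_congr_ae (h.mono fun x hx => by simp only [hx])
  filter_upwards [h] with x hx
  rw [hx, hq0, polyFun_zero]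

lemma integrableOn_comp_mul_polyFun (hv : K.IsAdmissibleField v) (i : Fin 2) (p : Poly) :
    IntegrableOn (fun x => v x i * polyFun p x) K.carrier :=
  (hv i).integrableOn.mul_continuousOn_of_subset (continuous_polyFun p).continuousOn
    K.isBddOpen.measurableSet K.isBddOpen.isCompact_closure subset_closure

/-- A field without degrees of freedom is orthogonal to `P_{k-2}²`, the sum of the gradients of
`P_{k-1}` and of `x^⊥ P_{k-3}`. -/
lemma integral_comp_mul_eq_zero (hv : K.InLocalSpace k v) (hdof : K.dof k v = 0)
    (htr : ∀ i, HasZeroTrace K.carrier fun x => v x i)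
    (hdiv : weakDiv K.carrier v =ᵐ[volume.restrict K.carrier] 0) (i : Fin 2) {p : Poly}
    (hp : p ∈ polyLT K.centroid K.diam (k - 1)) : ∫ x in K.carrier, v x i * polyFun p x = 0 := by
  have hE := K.isBddOpen
  have hva := hv.isAdmissibleField
  have hd : ∀ j, K.dof k v j = 0 := fun j => by rw [hdof]; rfl
  have I := integrableOn_comp_mul_polyFun hva
  -- a divergence-free field with zero boundary values is orthogonal to gradients
  have hgrad : ∀ s : Poly, ∑ j, ∫ x in K.carrier, v x j * polyFun (MvPolynomial.pderiv j s) x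
      = 0 := by
    intro s
    have h1 : ∀ j, ∫ x in K.carrier, v x j * polyFun (MvPolynomial.pderiv j s) x
        = -∫ x in K.carrier, polyFun s x * weakPartial K.carrier j (fun y => v y j) x := by
      intro j
      have := (htr j).integral_mul_partialDeriv hE (contDiff_polyFun s (n := 1)) j
      rw [this, neg_neg]
      simp only [partialDeriv_polyFun, mul_comm]
    simp only [h1, Finset.sum_neg_distrib, neg_eq_zero]
    rw [← integral_finsetSum _ fun j _ =>
      hE.integrableOn_polyFun_mul s ((hva j).integrableOn_weakPartial j),
      ← integral_zero Plane ℝ (μ := volume.restrict K.carrier)]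
    refine integral_congr_ae (hdiv.mono fun x hx => ?_)
    simp only [← Finset.mul_sum]
    rw [show ∑ j, weakPartial K.carrier j (fun y => v y j) x = 0 from hx, mul_zero]
  have hperp : ∀ t ∈ polyLT K.centroid K.diam (k - 1 - 1),
      ∑ j, ∫ x in K.carrier, v x j * polyFun (perpPoly K.centroid j * t) x = 0 := by
    intro t ht
    have e : ∀ t : Poly, ∑ j, ∫ x in K.carrier, v x j * polyFun (perpPoly K.centroid j * t) x
        = ∫ x in K.carrier, (∑ j, v x j * polyFun (perpPoly K.centroid j) x) * polyFun t x := by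
      intro t
      rw [← integral_finsetSum _ fun j _ => I j _]
      simp only [polyFun_mul, Pi.mul_apply, Finset.sum_mul, mul_assoc]
    rw [e]
    refine integral_eq_zero_of_monomials (integrable_finsetSum _ fun j _ => I j _)
      (fun a b hab => ?_) ht
    have hmem : ((a, b) : ℕ × ℕ) ∈ perpIndex k := by
      simp only [perpIndex, Finset.mem_filter, Finset.mem_product, Finset.mem_range]
      omega
    have h2 : K.area⁻¹ * ∫ x in K.carrier, inner ℝ (v x)
        ((K.monomial (a, b) x / K.diam) • perp (x - K.centroid)) = 0 :=
      hd (.inr (.inr (.inr (.inl ⟨(a, b), hmem⟩))))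
    have h3 := (mul_eq_zero.1 h2).resolve_left (inv_pos.2 K.area_pos).ne'
    have h4 : ∀ x, inner ℝ (v x) ((K.monomial (a, b) x / K.diam) • perp (x - K.centroid))
        = K.diam⁻¹ * ((∑ j, v x j * polyFun (perpPoly K.centroid j) x) * K.monomial (a, b) x) := by
      intro x
      rw [inner_smul_right, PiLp.inner_apply]
      simp only [polyFun_perpPoly, Fin.sum_univ_two]
      simp
      ring
    simp only [h4] at h3
    rw [integral_const_mul] at h3
    exact (mul_eq_zero.1 h3).resolve_left (inv_pos.2 K.diam_pos).ne'
  obtain ⟨s, t, ht, hst⟩ := exists_grad_add_perp K.diam_pos.ne' (n := k - 1) (Pi.single i p)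
    (fun j => by
      by_cases hj : j = i
      · subst hj; rwa [Pi.single_eq_same]
      · rw [Pi.single_eq_of_ne hj]; exact zero_mem _)
  have hsplit : ∀ j, ∫ x in K.carrier, v x j * polyFun ((Pi.single i p : Fin 2 → Poly) j) x
      = (∫ x in K.carrier, v x j * polyFun (MvPolynomial.pderiv j s) x)
        + ∫ x in K.carrier, v x j * polyFun (perpPoly K.centroid j * t) x := by
    intro j
    rw [← integral_add (I j _) (I j _), hst j]
    exact integral_congr_ae (.of_forall fun x => by simp only [polyFun_add, Pi.add_apply, mul_add])
  have htotal : ∑ j, ∫ x in K.carrier, v x j * polyFun ((Pi.single i p : Fin 2 → Poly) j) x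
      = 0 := by
    simp only [hsplit, Finset.sum_add_distrib, hgrad s, hperp t ht, add_zero]
  rwa [Finset.sum_eq_single i (fun j _ hj => by simp [Pi.single_eq_of_ne hj]) (by simp),
    Pi.single_eq_same] at htotal

/-- Integration by parts turns the definition of the elliptic projection into moments against
`P_{k-2}`, so that it vanishes. -/
lemma ellProj_eq_zero (hK : ∀ i, 0 < K.edgeLength i) (hv : K.InLocalSpace k v)
    (htr : ∀ i, HasZeroTrace K.carrier fun x => v x i)
    (horth : ∀ i, ∀ p ∈ polyLT K.centroid K.diam (k - 1),
      ∫ x in K.carrier, v x i * polyFun p x = 0) (i : Fin 2) :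
    K.ellProj k (fun x => v x i) = 0 := by
  have hE := K.isBddOpen
  have hva := hv.isAdmissibleField
  suffices K.IsEllProj k (fun x => v x i) 0 by
    rw [this.ellProj_eq hK (hva i), polyFun_zero]
  rw [isEllProj_iff (hva i)]
  refine ⟨by simp, fun q hq => ?_, ?_⟩
  · simp only [map_zero, polyFun_zero, Pi.zero_apply, mul_zero, Finset.sum_const_zero,
      integral_zero]
    have hq' : q ∈ polyLT K.centroid K.diam (k + 1) := (mem_polyLT_iff K.diam_pos.ne').2 hq
    rw [integral_finsetSum _ fun j _ =>
      hE.integrableOn_polyFun_mul _ ((hva i).integrableOn_weakPartial j)]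
    refine (Finset.sum_eq_zero fun j _ => ?_).symm
    rw [(htr i).integral_mul_partialDeriv hE (contDiff_polyFun _) j]
    simp only [partialDeriv_polyFun, mul_comm, neg_eq_zero]
    exact horth i _ (pderiv_mem_polyLT (pderiv_mem_polyLT hq' j) j)
  · have h1 : K.boundaryIntegral (fun x => v x i) = 0 := by
      refine Finset.sum_eq_zero fun e _ => ?_
      have : ∫ θ in (0 : ℝ)..1, v (K.poly.edgePath ℝ e θ) i = ∫ θ in (0 : ℝ)..1, (0 : ℝ) := by
        refine intervalIntegral.integral_congr fun θ hθ => ?_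
        rw [uIcc_of_le zero_le_one] at hθ
        exact (htr i).eq_zero _ (K.edgePath_mem_frontier e hθ)
      rw [this]
      simp
    rw [h1, polyFun_zero]
    exact Finset.sum_eq_zero fun e _ => by simp

/-- Orthogonality to `x^⊥ P_{k-1}`: in degrees up to `k - 3` it is part of the orthogonality to
`P_{k-2}²`, and in the two highest degrees it is the enhancement constraint, in which the elliptic
projection vanishes. -/
lemma integral_perp_mul_eq_zero (hv : K.InLocalSpace k v)
    (horth : ∀ i, ∀ p ∈ polyLT K.centroid K.diam (k - 1),
      ∫ x in K.carrier, v x i * polyFun p x = 0)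
    (hell : ∀ i, K.ellProj k (fun x => v x i) = 0) {p : Poly}
    (hp : p ∈ polyLT K.centroid K.diam k) :
    ∫ x in K.carrier, (∑ i, v x i * perp x i) * polyFun p x = 0 := by
  have hva := hv.isAdmissibleField
  have I := integrableOn_comp_mul_polyFun hva
  have hpp : ∀ (x : Plane) (i : Fin 2), perp x i = polyFun (perpPoly 0 i) x := fun x i => by
    rw [polyFun_perpPoly, sub_zero]
  refine integral_eq_zero_of_monomials (n := k) ?_ (fun a b hab => ?_) hp
  · simp only [hpp]
    exact integrable_finsetSum _ fun j _ => I j _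
  · by_cases h : k ≤ a + b + 2
    · have h1 := hv.enhanced (K.monomial (a, b)) (Submodule.subset_span ⟨(a, b), h, hab, rfl⟩)
      have h2 : ∀ x, K.ellProjVec k v x = 0 := fun x => by
        ext i
        simp only [ellProjVec, hell]
        rfl
      rw [← h1]
      refine integral_congr_ae (.of_forall fun x => ?_)
      simp only [h2, sub_zero, inner_smul_right, PiLp.inner_apply, Fin.sum_univ_two]
      simp
      ring
    · have hmem : ∀ i, perpPoly 0 i * shiftedMonomial K.centroid K.diam a b
          ∈ polyLT K.centroid K.diam (k - 1) := by
        intro i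
        have h1 : perpPoly 0 i ∈ polyLT K.centroid K.diam (1 + 1) := by
          rw [mem_polyLT_iff K.diam_pos.ne']
          fin_cases i <;> simp [perpPoly]
        exact polyLT_mono _ _ (by omega)
          (mul_mem_polyLT h1 (shiftedMonomial_mem (Nat.lt_succ_self (a + b))))
      have h3 : ∑ i, ∫ x in K.carrier, v x i *
          polyFun (perpPoly 0 i * shiftedMonomial K.centroid K.diam a b) x = 0 :=
        Finset.sum_eq_zero fun i _ => horth i _ (hmem i)
      rw [← integral_finsetSum _ fun i _ => I i _] at h3
      rw [← h3, monomial_eq_polyFun]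
      refine integral_congr_ae (.of_forall fun x => ?_)
      simp only [hpp, polyFun_mul, Pi.mul_apply, Finset.sum_mul, mul_assoc]

/-- The local degrees of freedom are unisolvent on the local space. A field without degrees of
freedom vanishes on the boundary, is divergence free, and by the enhancement is orthogonal to the
right-hand sides of its Stokes equation; testing that equation with the field itself shows that
its gradient vanishes. -/
theorem InLocalSpace.eq_zero_of_dof_eq_zero (hk : 1 ≤ k) (hK : ∀ i, 0 < K.edgeLength i)
    (hv : K.InLocalSpace k v) (hdof : K.dof k v = 0) : ∀ x ∈ closure K.carrier, v x = 0 := by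
  have hE := K.isBddOpen
  have hva := hv.isAdmissibleField
  have hfr := hv.eq_zero_of_mem_frontier hk hK hdof
  have htr : ∀ i, HasZeroTrace K.carrier fun x => v x i := fun i =>
    ⟨(hva i).continuousOn, (hva i).memW12, fun x hx => by rw [hfr x hx]; rfl⟩
  have hdiv := weakDiv_ae_eq_zero hk hv hdof htr
  have horth : ∀ i, ∀ p ∈ polyLT K.centroid K.diam (k - 1),
      ∫ x in K.carrier, v x i * polyFun p x = 0 :=
    fun i p hp => integral_comp_mul_eq_zero hv hdof htr hdiv i hp
  have hell := ellProj_eq_zero hK hv htr horth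
  obtain ⟨s, hs, -, p, hp, hsp⟩ := hv.stokes
  have hp' : p ∈ polyLT K.centroid K.diam k := by
    obtain ⟨k, rfl⟩ : ∃ m, k = m + 1 := ⟨k - 1, by omega⟩
    exact (mem_polyLT_iff K.diam_pos.ne').2 hp
  have hperp := integral_perp_mul_eq_zero hv horth hell hp'
  set w : Fin 2 → Fin 2 → Plane → ℝ := fun i j => weakPartial K.carrier j (fun y => v y i) with hw
  have hwL : ∀ i j, MemLp (w i j) 2 (volume.restrict K.carrier) := fun i j =>
    ((hva i).memW12.isWeakPartial j).1
  have hmul : ∀ {f g : Plane → ℝ}, MemLp f 2 (volume.restrict K.carrier) →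
      MemLp g 2 (volume.restrict K.carrier) →
      Integrable (fun x => f x * g x) (volume.restrict K.carrier) := fun hf hg =>
    hf.integrable_mul hg
  have hpc : ∀ i : Fin 2, Continuous fun x => perp x i * polyFun p x := fun i =>
    ((EuclideanSpace.proj (𝕜 := ℝ) i).continuous.comp continuous_perp).mul (continuous_polyFun p)
  have hδ : ∀ i j : Fin 2, MemLp ((Pi.single i s : Fin 2 → Plane → ℝ) j) 2
      (volume.restrict K.carrier) := by
    intro i j
    by_cases hj : j = i
    · subst hj; rwa [Pi.single_eq_same]
    · rw [Pi.single_eq_of_ne hj]; exact MemLp.zero'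
  have key : ∀ i, (∑ j, ∫ x in K.carrier, w i j x * w i j x)
      + (∫ x in K.carrier, s x * w i i x) + ∫ x in K.carrier, perp x i * polyFun p x * v x i
      = 0 := by
    intro i
    have h1 := (htr i).integral_eq_zero hE
      (H := fun j => w i j + (Pi.single i s : Fin 2 → Plane → ℝ) j)
      (h := fun x => perp x i * polyFun p x) (fun j => (hwL i j).add (hδ i j))
      (hE.integrableOn_of_continuousOn (hpc i).continuousOn)
      (fun φ hφ => by
        have h2 := hsp i φ hφ
        have hφL := fun j => hE.memLp_of_continuousOn (hφ.continuous_partialDeriv j).continuousOn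
        rw [integral_finsetSum _ fun j _ => hmul (hwL i j) (hφL j)] at h2
        simp only [Pi.add_apply, add_mul]
        have e : ∀ j, ∫ x in K.carrier, (w i j x * partialDeriv j φ x
            + (Pi.single i s : Fin 2 → Plane → ℝ) j x * partialDeriv j φ x)
            = (∫ x in K.carrier, w i j x * partialDeriv j φ x)
              + ∫ x in K.carrier, (Pi.single i s : Fin 2 → Plane → ℝ) j x * partialDeriv j φ x :=
          fun j => integral_add ((hwL i j).integrable_mul (hφL j)) ((hδ i j).integrable_mul (hφL j))
        rw [Finset.sum_congr rfl fun j _ => e j, Finset.sum_add_distrib,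
          Finset.sum_eq_single (f := fun j => ∫ x in K.carrier,
            (Pi.single i s : Fin 2 → Plane → ℝ) j x * partialDeriv j φ x) i
            (fun j _ hj => by simp [Pi.single_eq_of_ne hj]) (by simp), Pi.single_eq_same]
        linarith)
    have e : ∀ j, ∫ x in K.carrier, (w i j + (Pi.single i s : Fin 2 → Plane → ℝ) j) x * w i j x
        = (∫ x in K.carrier, w i j x * w i j x)
          + ∫ x in K.carrier, (Pi.single i s : Fin 2 → Plane → ℝ) j x * w i j x := by
      intro j
      simp only [Pi.add_apply, add_mul]
      exact integral_add ((hwL i j).integrable_mul (hwL i j)) ((hδ i j).integrable_mul (hwL i j))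
    rw [Finset.sum_congr rfl fun j _ => e j, Finset.sum_add_distrib,
      Finset.sum_eq_single (f := fun j => ∫ x in K.carrier,
        (Pi.single i s : Fin 2 → Plane → ℝ) j x * w i j x) i
        (fun j _ hj => by simp [Pi.single_eq_of_ne hj]) (by simp), Pi.single_eq_same] at h1
    exact h1
  have hsdiv : ∑ i, ∫ x in K.carrier, s x * w i i x = 0 := by
    rw [← integral_finsetSum _ fun i _ => hmul hs (hwL i i),
      ← integral_zero Plane ℝ (μ := volume.restrict K.carrier)]
    refine integral_congr_ae (hdiv.mono fun x hx => ?_)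
    simp only [← Finset.mul_sum]
    rw [show ∑ i, w i i x = 0 from hx, mul_zero]
  have hpv : ∑ i, ∫ x in K.carrier, perp x i * polyFun p x * v x i = 0 := by
    rw [← integral_finsetSum _ fun i _ =>
      hE.integrableOn_continuousOn_mul (hpc i).continuousOn (hva i).integrableOn, ← hperp]
    refine integral_congr_ae (.of_forall fun x => ?_)
    simp only [Finset.sum_mul]
    exact Finset.sum_congr rfl fun i _ => by ring
  have hsum : ∑ i, ∑ j, ∫ x in K.carrier, w i j x * w i j x = 0 := by
    have h3 := Finset.sum_eq_zero (s := Finset.univ) fun i (_ : i ∈ Finset.univ) => key i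
    rw [Finset.sum_add_distrib, Finset.sum_add_distrib, hsdiv, hpv, add_zero, add_zero] at h3
    exact h3
  have hnn : ∀ i j, 0 ≤ ∫ x in K.carrier, w i j x * w i j x := fun i j =>
    integral_nonneg fun x => mul_self_nonneg _
  intro x hx
  ext i
  refine (htr i).eq_zero_of_weakPartial_eq_zero hE ?_ x hx
  have h4 := (Finset.sum_eq_zero_iff_of_nonneg fun j _ => hnn i j).1
    ((Finset.sum_eq_zero_iff_of_nonneg fun i _ => Finset.sum_nonneg fun j _ => hnn i j).1 hsum i
      (Finset.mem_univ i)) 0 (Finset.mem_univ 0)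
  rw [integral_eq_zero_iff_of_nonneg (fun x => mul_self_nonneg _)
    ((hwL i 0).integrable_mul (hwL i 0))] at h4
  exact h4.mono fun x hx => mul_self_eq_zero.1 hx

end Unisolvence

end MeshElement

namespace MeshElement

variable {K : MeshElement} {k : ℕ}

/-! ### Degrees of freedom, projected strains and defects as linear maps -/

lemma edgeMoment_smul_add (i : Fin K.n) {F G : Plane → ℝ} (hF : ContinuousOn F (closure K.carrier))
    (hG : ContinuousOn G (closure K.carrier)) (a b : ℝ) (j : ℕ) :
    K.edgeMoment i (fun x => a * F x + b * G x) j
      = a * K.edgeMoment i F j + b * K.edgeMoment i G j := by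
  have I : ∀ {F : Plane → ℝ}, ContinuousOn F (closure K.carrier) → IntervalIntegrable
      (fun θ => F (K.poly.edgePath ℝ i θ) * (θ - 1 / 2) ^ j) volume 0 1 := fun hF =>
    ((continuousOn_comp_edgePath K hF i).mul (by fun_prop)).intervalIntegrable
  simp only [edgeMoment]
  rw [← intervalIntegral.integral_const_mul, ← intervalIntegral.integral_const_mul,
    ← intervalIntegral.integral_add ((I hF).const_mul a) ((I hG).const_mul b)]
  congr 1
  ext θ
  ring

lemma continuous_monomial (α : ℕ × ℕ) : Continuous (K.monomial α) := by
  rw [monomial_eq_polyFun]; exact continuous_polyFun _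

lemma dof_smul_add {v w : Plane → Plane} (hv : K.IsAdmissibleField v)
    (hw : K.IsAdmissibleField w) (a b : ℝ) :
    K.dof k (a • v + b • w) = a • K.dof k v + b • K.dof k w := by
  have hE := K.isBddOpen
  have hin : ∀ z : Plane, (fun x => inner ℝ ((a • v + b • w) x) z)
      = fun x => a * inner ℝ (v x) z + b * inner ℝ (w x) z := fun z => by
    ext x
    simp only [Pi.add_apply, Pi.smul_apply, inner_add_left, inner_smul_left]
    simp
  have hc : ∀ {v : Plane → Plane}, K.IsAdmissibleField v → ∀ z : Plane,
      ContinuousOn (fun x => (inner ℝ (v x) z : ℝ)) (closure K.carrier) := fun hv z =>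
    hv.continuousOn.inner continuousOn_const
  ext l
  rcases l with ⟨i, c⟩ | ⟨i, j⟩ | ⟨i, j⟩ | β | β
  · simp [dof]
  · simp only [dof, hin, edgeMoment_smul_add i (hc hv _) (hc hw _)]
    simp
  · simp only [dof, hin, edgeMoment_smul_add i (hc hv _) (hc hw _)]
    simp
  · have hz : Continuous fun x => (K.monomial β x / K.diam) • perp (x - K.centroid) :=
      ((continuous_monomial _).div_const _).smul (continuous_perp.comp (by fun_prop))
    have I : ∀ {v : Plane → Plane}, K.IsAdmissibleField v → IntegrableOn (fun x =>
        (inner ℝ (v x) ((K.monomial β x / K.diam) • perp (x - K.centroid)) : ℝ)) K.carrier :=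
      fun hv => hE.integrableOn_of_continuousOn (hv.continuousOn.inner hz.continuousOn)
    simp only [dof, PiLp.add_apply, PiLp.smul_apply, smul_eq_mul]
    have e : ∀ x, (inner ℝ ((a • v + b • w) x)
        ((K.monomial β x / K.diam) • perp (x - K.centroid)) : ℝ)
        = a * inner ℝ (v x) ((K.monomial β x / K.diam) • perp (x - K.centroid))
          + b * inner ℝ (w x) ((K.monomial β x / K.diam) • perp (x - K.centroid)) := fun x =>
      congrFun (hin _) x
    simp only [e]
    rw [integral_add ((I hv).const_mul a) ((I hw).const_mul b), integral_const_mul,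
      integral_const_mul]
    ring
  · have I : ∀ {v : Plane → Plane}, K.IsAdmissibleField v → IntegrableOn (fun x =>
        weakDiv K.carrier v x * K.monomial β x) K.carrier := fun hv =>
      (hE.integrableOn_of_memLp hv.memLp_weakDiv).mul_continuousOn_of_subset
        (continuous_monomial _).continuousOn hE.measurableSet hE.isCompact_closure subset_closure
    simp only [dof, PiLp.add_apply, PiLp.smul_apply, smul_eq_mul]
    have e : ∫ x in K.carrier, weakDiv K.carrier (a • v + b • w) x * K.monomial β x
        = a * (∫ x in K.carrier, weakDiv K.carrier v x * K.monomial β x)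
          + b * ∫ x in K.carrier, weakDiv K.carrier w x * K.monomial β x := by
      rw [← integral_const_mul, ← integral_const_mul, ← integral_add
        ((I hv).const_mul a) ((I hw).const_mul b)]
      refine integral_congr_ae ?_
      filter_upwards [weakDiv_smul_add hv hw a b] with x hx
      rw [hx]
      ring
    rw [e]
    ring

/-- The projected strain `Π⁰_{k-1} ε(v)` on an element. -/
def projStrain (K : MeshElement) (k : ℕ) (v : Plane → Plane) : Plane → Matrix (Fin 2) (Fin 2) ℝ :=
  l2ProjMat K.carrier (k - 1) (strain K.carrier v)

/-- The projection defect `(I - Π⁰_k) v` on an element. -/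
def defect (K : MeshElement) (k : ℕ) (v : Plane → Plane) (x : Plane) : Plane :=
  v x - l2ProjVec K.carrier k v x

lemma integrableOn_strain {v : Plane → Plane} (hv : K.IsAdmissibleField v) (i j : Fin 2) :
    IntegrableOn (fun x => strain K.carrier v x i j) K.carrier :=
  (((hv i).integrableOn_weakPartial j).add ((hv j).integrableOn_weakPartial i)).div_const 2

lemma projStrain_smul_add {v w : Plane → Plane} (hv : K.IsAdmissibleField v)
    (hw : K.IsAdmissibleField w) (a b : ℝ) :
    K.projStrain k (a • v + b • w) = a • K.projStrain k v + b • K.projStrain k w := by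
  ext x i j
  have e : (fun y => strain K.carrier (a • v + b • w) y i j) =ᵐ[volume.restrict K.carrier]
      a • (fun y => strain K.carrier v y i j) + b • fun y => strain K.carrier w y i j := by
    filter_upwards [weakPartial_comp_smul_add hv hw a b i j,
      weakPartial_comp_smul_add hv hw a b j i] with y h1 h2
    simp only [strain, Matrix.of_apply]
    rw [h1, h2]
    simp only [Pi.add_apply, Pi.smul_apply, smul_eq_mul]
    ring
  simp only [projStrain, l2ProjMat, Matrix.of_apply]
  rw [l2Proj_congr K.isBddOpen _ (integrableOn_strain (hv.smul_add hw a b) i j) e,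
    l2Proj_smul_add K.isBddOpen _ (integrableOn_strain hv i j) (integrableOn_strain hw i j)]
  simp [l2ProjMat]

lemma projStrain_isSymm (v : Plane → Plane) (x : Plane) : (K.projStrain k v x).IsSymm := by
  ext i j
  simp only [Matrix.transpose_apply, projStrain, l2ProjMat, strain, Matrix.of_apply]
  congr 2
  ext y
  rw [add_comm]

lemma continuous_projStrain (v : Plane → Plane) : Continuous (K.projStrain k v) :=
  continuous_matrix fun _ _ => continuous_l2Proj _ _ _

lemma exists_l2ProjVec_eq (E : Set Plane) (k : ℕ) (v : Plane → Plane) :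
    ∃ P : Fin 2 → Poly, (∀ i, (P i).totalDegree ≤ k) ∧ l2ProjVec E k v = polyField P := by
  choose P hP h using fun i => exists_l2Proj_eq_polyFun E k fun y => v y i
  refine ⟨P, hP, ?_⟩
  ext x i
  simp [l2ProjVec, polyField, h]

lemma defect_smul_add {v w : Plane → Plane} (hv : K.IsAdmissibleField v)
    (hw : K.IsAdmissibleField w) (a b : ℝ) :
    K.defect k (a • v + b • w) = a • K.defect k v + b • K.defect k w := by
  ext x i
  simp only [defect, l2ProjVec, PiLp.sub_apply]
  rw [comp_smul_add, l2Proj_smul_add K.isBddOpen k (hv i).integrableOn (hw i).integrableOn]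
  simp [l2ProjVec, defect]
  ring

/-- The local space is stable under removing the polynomial projection. -/
lemma InLocalSpace.defect (hK : ∀ i, 0 < K.edgeLength i) {v : Plane → Plane}
    (hv : K.InLocalSpace k v) : K.InLocalSpace k (K.defect k v) := by
  obtain ⟨P, hP, h⟩ := exists_l2ProjVec_eq K.carrier k v
  have := hv.smul_add hK (inLocalSpace_polyField hK hP) 1 (-1)
  convert this using 1
  ext x i
  simp [MeshElement.defect, h, sub_eq_add_neg]

end MeshElement

open MeshElement

/-! ### Rigid motions -/

/-- An infinitesimal rigid motion of the plane. -/
def IsRigid (R : Plane → Plane) : Prop := ∀ x y, inner ℝ (R x - R y) (x - y) = 0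

/-- A polynomial field with vanishing symmetric gradient is an infinitesimal rigid motion. -/
lemma isRigid_polyField {P : Fin 2 → Poly}
    (h : ∀ i j, MvPolynomial.pderiv j (P i) + MvPolynomial.pderiv i (P j) = 0) :
    IsRigid (polyField P) := by
  have hfd : ∀ (p : Poly) (x d : Plane), fderiv ℝ (polyFun p) x d
      = ∑ j, d j * polyFun (MvPolynomial.pderiv j p) x := fun p x d => by
    have hd : d = ∑ j, d j • EuclideanSpace.single j (1 : ℝ) := by
      ext l; fin_cases l <;> simp
    conv_lhs => rw [hd]
    simp only [map_sum, map_smul, ← partialDeriv_polyFun, partialDeriv, smul_eq_mul]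
  intro x y
  set d := x - y with hd
  have hline : ∀ t : ℝ, HasDerivAt (fun t : ℝ => y + t • d) d t := fun t => by
    simpa using ((hasDerivAt_id t).smul_const d).const_add y
  have hg : ∀ t : ℝ,
      HasDerivAt (fun t : ℝ => ∑ i, d i * polyFun (P i) (y + t • d)) 0 t := fun t => by
    have h1 : ∀ i, HasDerivAt (fun t : ℝ => polyFun (P i) (y + t • d))
        (∑ j, d j * polyFun (MvPolynomial.pderiv j (P i)) (y + t • d)) t := fun i => by
      rw [← hfd]
      exact ((differentiable_polyFun (P i) _).hasFDerivAt).comp_hasDerivAt t (hline t)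
    have h2 := HasDerivAt.fun_sum fun i (_ : i ∈ Finset.univ) => (h1 i).const_mul (d i)
    refine h2.congr_deriv ?_
    -- only the symmetric part of the gradient enters the quadratic form
    have h3 : ∀ i j, polyFun (MvPolynomial.pderiv j (P i)) (y + t • d)
        = -polyFun (MvPolynomial.pderiv i (P j)) (y + t • d) := fun i j => by
      rw [eq_neg_of_add_eq_zero_left (h i j), polyFun_neg, Pi.neg_apply]
    have h4 : ∀ i, polyFun (MvPolynomial.pderiv i (P i)) (y + t • d) = 0 := fun i => by
      linarith [h3 i i]
    simp only [Fin.sum_univ_two, h4, h3 0 1]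
    ring
  have hc := is_const_of_deriv_eq_zero (fun t => (hg t).differentiableAt)
    (fun t => (hg t).deriv) 1 0
  simp only [one_smul, zero_smul, add_zero] at hc
  rw [show y + d = x from add_sub_cancel y x] at hc
  simp only [PiLp.inner_apply, PiLp.sub_apply, polyField, RCLike.inner_apply, conj_trivial,
    Fin.sum_univ_two] at hc ⊢
  have h0 : d 0 = x 0 - y 0 := rfl
  have h1 : d 1 = x 1 - y 1 := rfl
  simp only [h0, h1] at hc ⊢
  linarith

namespace MeshElement

variable {K : MeshElement} {k : ℕ}

/-- A local field without projected strain whose defect has no degrees of freedom is an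
infinitesimal rigid motion: by unisolvence it equals its polynomial projection, whose strain is
a polynomial of degree at most `k - 1` and hence its own projection. -/
lemma InLocalSpace.exists_isRigid (hk : 1 ≤ k) (hK : ∀ i, 0 < K.edgeLength i) {v : Plane → Plane}
    (hv : K.InLocalSpace k v) (hstr : ∀ x ∈ K.carrier, K.projStrain k v x = 0)
    (hdof : K.dof k (K.defect k v) = 0) :
    ∃ P : Fin 2 → Poly, IsRigid (polyField P) ∧ ∀ x ∈ closure K.carrier, v x = polyField P x := by
  have hE := K.isBddOpen
  obtain ⟨P, hP, h⟩ := exists_l2ProjVec_eq K.carrier k v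
  have hvP : ∀ x ∈ closure K.carrier, v x = polyField P x := fun x hx => by
    have := (hv.defect hK).eq_zero_of_dof_eq_zero hk hK hdof x hx
    rwa [MeshElement.defect, h, sub_eq_zero] at this
  refine ⟨P, isRigid_polyField fun i j => ?_, hvP⟩
  have hva := hv.isAdmissibleField
  have hw : ∀ i j, weakPartial K.carrier j (fun y => v y i) =ᵐ[volume.restrict K.carrier]
      polyFun (MvPolynomial.pderiv j (P i)) := fun i j => by
    have h1 := hE.isWeakPartial_of_contDiff (contDiff_polyFun (P i) (n := 1)) j
    rw [funext (partialDeriv_polyFun j (P i))] at h1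
    refine IsWeakPartial.weakPartial_ae_eq hE ⟨h1.1, fun φ hφ => ?_⟩
    rw [← h1.2 φ hφ]
    refine setIntegral_congr_fun hE.measurableSet fun x hx => ?_
    simp only [hvP x (subset_closure hx), polyField]
  have hk' : k - 1 + 1 = k := by omega
  have hPk : ∀ i, P i ∈ polyLT 0 1 (k + 1) := fun i => (mem_polyLT_iff one_ne_zero).2 (hP i)
  set Q : Poly := (1 / 2 : ℝ) • (MvPolynomial.pderiv j (P i) + MvPolynomial.pderiv i (P j)) with hQ
  have hQdeg : Q.totalDegree ≤ k - 1 := by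
    rw [← mem_polyLT_iff (c := 0) one_ne_zero, hk']
    exact Submodule.smul_mem _ _ (Submodule.add_mem _ (pderiv_mem_polyLT (hPk i) j)
      (pderiv_mem_polyLT (hPk j) i))
  have hs : (fun x => strain K.carrier v x i j) =ᵐ[volume.restrict K.carrier] polyFun Q := by
    filter_upwards [hw i j, hw j i] with x h1 h2
    simp only [strain, Matrix.of_apply, h1, h2, hQ, polyFun_smul, polyFun_add, Pi.smul_apply,
      Pi.add_apply, smul_eq_mul]
    ring
  have hl : l2Proj K.carrier (k - 1) (fun x => strain K.carrier v x i j) = polyFun Q := by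
    rw [l2Proj_congr hE _ (integrableOn_strain hva i j) hs]
    exact (isL2Proj_polyFun _ hQdeg).l2Proj_eq hE (hE.integrableOn_polyFun Q)
  have hQ0 : Q = 0 := by
    refine eq_zero_of_polyFun_eqOn_zero hE.isOpen hE.nonempty fun x hx => ?_
    rw [← hl]
    exact congrFun (congrFun (hstr x hx) i) j
  have := smul_eq_zero.1 (hQ ▸ hQ0)
  exact this.resolve_left (by norm_num)

end MeshElement

open Filter Topology

/-! ### Korn's argument for piecewise rigid fields -/

/-- A vector orthogonal to `x - y` for all `y` in a nonempty open set vanishes. -/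
lemma eq_zero_of_forall_inner_sub {U : Set Plane} (hU : IsOpen U) (hne : U.Nonempty) {z x : Plane}
    (h : ∀ y ∈ U, inner ℝ z (x - y) = 0) : z = 0 := by
  obtain ⟨y, hy⟩ := hne
  have hc : Tendsto (fun s : ℝ => y + s • z) (𝓝[>] 0) (𝓝 y) := by
    have : Continuous fun s : ℝ => y + s • z := by fun_prop
    simpa using (this.tendsto 0).mono_left nhdsWithin_le_nhds
  obtain ⟨s, hs, hs0⟩ := ((hc.eventually (hU.mem_nhds hy)).and self_mem_nhdsWithin).exists
  have h1 := h _ hs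
  have h2 := h _ hy
  rw [← sub_sub, inner_sub_right, h2, inner_smul_right, zero_sub, neg_eq_zero] at h1
  exact inner_self_eq_zero.1 ((mul_eq_zero.1 h1).resolve_left (ne_of_gt hs0))

/-- Rigid motions that agree on a nonempty open set are equal. -/
lemma IsRigid.eq_of_eqOn {R S : Plane → Plane} (hR : IsRigid R) (hS : IsRigid S) {U : Set Plane}
    (hU : IsOpen U) (hne : U.Nonempty) (h : EqOn R S U) : R = S := by
  ext1 x
  refine sub_eq_zero.1 (eq_zero_of_forall_inner_sub hU hne (x := x) fun y hy => ?_)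
  have h1 := hR x y
  have h2 := hS x y
  rw [inner_sub_left] at h1 h2 ⊢
  rw [h hy] at h1
  linarith

/-- A rigid motion with two distinct zeros vanishes. -/
lemma IsRigid.eq_zero {R : Plane → Plane} (hR : IsRigid R) {a b : Plane} (hab : a ≠ b)
    (ha : R a = 0) (hb : R b = 0) : R = 0 := by
  -- a third zero, not collinear with the first two
  set c := a + perp (b - a) with hc
  have key : ∀ z : Plane, inner ℝ z (b - a) = 0 → inner ℝ z (perp (b - a)) = 0 → z = 0 := by
    intro z h1 h2
    have hd : 0 < ((b - a) 0) ^ 2 + ((b - a) 1) ^ 2 := by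
      have := norm_pos_iff.2 (sub_ne_zero.2 hab.symm)
      have h3 := EuclideanSpace.norm_sq_eq (b - a)
      simp only [Fin.sum_univ_two, Real.norm_eq_abs, sq_abs] at h3
      rw [← h3]
      positivity
    simp only [perp, PiLp.inner_apply, Fin.sum_univ_two, RCLike.inner_apply, conj_trivial,
      Matrix.cons_val_zero, Matrix.cons_val_one] at h1 h2
    generalize (b - a) 0 = d at *
    generalize (b - a) 1 = e at *
    have h0 : (d ^ 2 + e ^ 2) * z 0 = 0 := by linear_combination d * h1 + e * h2
    have h1 : (d ^ 2 + e ^ 2) * z 1 = 0 := by linear_combination e * h1 - d * h2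
    ext i
    fin_cases i
    · simpa using (mul_eq_zero.1 h0).resolve_left hd.ne'
    · simpa using (mul_eq_zero.1 h1).resolve_left hd.ne'
  have hdiff : ∀ x p : Plane, R p = 0 → inner ℝ (R x) (x - p) = 0 := fun x p hp => by
    simpa [hp] using hR x p
  have hba : ∀ x, inner ℝ (R x) (b - a) = 0 := fun x => by
    rw [← sub_sub_sub_cancel_left a b x, inner_sub_right, hdiff x a ha, hdiff x b hb, sub_zero]
  have hcz : R c = 0 := by
    refine key _ (hba c) ?_
    have := hdiff c a ha
    rwa [hc, add_sub_cancel_left, ← hc] at this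
  ext1 x
  refine key _ (hba x) ?_
  have : perp (b - a) = (x - a) - (x - c) := by rw [hc]; abel
  rw [this, inner_sub_right, hdiff x a ha, hdiff x c hcz, sub_zero]

section Pieces

variable {Ω : Set Plane} {ι : Type*} [Finite ι] {T : ι → MeshElement} {v : Plane → Plane}
  {R : ι → Plane → Plane}

/-- Along a segment the tangential component of a continuous piecewise rigid field is continuous
with finitely many values, hence constant. -/
lemma inner_sub_eq_zero_of_piecewise_rigid (hT : IsDecomposition Ω T)
    (hv : ContinuousOn v (closure Ω)) (hR : ∀ i, IsRigid (R i))
    (hvR : ∀ i, ∀ x ∈ closure (T i).carrier, v x = R i x) {x y : Plane}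
    (hxy : segment ℝ x y ⊆ closure Ω) : inner ℝ (v x - v y) (x - y) = 0 := by
  set ℓ : ℝ → Plane := fun t => AffineMap.lineMap x y t with hℓ
  have hℓc : Continuous ℓ := AffineMap.lineMap_continuous
  have hℓmem : ∀ t ∈ Icc (0 : ℝ) 1, ℓ t ∈ closure Ω := fun t ht => hxy (by
    rw [segment_eq_image_lineMap]; exact mem_image_of_mem _ ht)
  set g : ℝ → ℝ := fun t => inner ℝ (v (ℓ t)) (x - y) with hg
  have hgc : ContinuousOn g (Icc 0 1) :=
    (hv.comp hℓc.continuousOn hℓmem).inner continuousOn_const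
  have hfin : (g '' Icc 0 1) ⊆ range fun i => (inner ℝ (R i x) (x - y) : ℝ) := by
    rintro _ ⟨t, ht, rfl⟩
    have hm := hℓmem t ht
    rw [hT.cover] at hm
    obtain ⟨i, hi⟩ := mem_iUnion.1 hm
    refine ⟨i, ?_⟩
    have h1 := hR i (ℓ t) x
    have h2 : ℓ t - x = (-t) • (x - y) := by
      simp only [hℓ, AffineMap.lineMap_apply, vsub_eq_sub, vadd_eq_add]
      rw [add_sub_cancel_right, neg_smul, ← smul_neg, neg_sub]
    simp only [hg, hvR i _ hi]
    rcases eq_or_ne t 0 with rfl | h0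
    · simp [hℓ]
    · rw [h2, inner_smul_right, inner_sub_left] at h1
      have := (mul_eq_zero.1 h1).resolve_left (neg_ne_zero.2 h0)
      linarith
  have hsub : (g '' Icc 0 1).Subsingleton :=
    (isPreconnected_Icc.image g hgc).isDiscrete_iff_subsingleton.1
      ((finite_range _).subset hfin).isDiscrete
  have h01 : g 0 = g 1 := hsub (mem_image_of_mem _ (by simp)) (mem_image_of_mem _ (by simp))
  simp only [hg, hℓ, AffineMap.lineMap_apply_zero, AffineMap.lineMap_apply_one] at h01
  rw [inner_sub_left, h01, sub_self]

/-- A continuous field that is an infinitesimal rigid motion on every element of a decomposition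
of a domain is the same rigid motion on all elements. -/
lemma eq_rigid_of_piecewise_rigid (hΩ : IsOpen Ω) (hΩc : IsConnected Ω)
    (hT : IsDecomposition Ω T) (hv : ContinuousOn v (closure Ω)) (hR : ∀ i, IsRigid (R i))
    (hRc : ∀ i, Continuous (R i)) (hvR : ∀ i, ∀ x ∈ closure (T i).carrier, v x = R i x) :
    ∃ i, EqOn v (R i) (closure Ω) := by
  have hloc : ∀ x ∈ Ω, ∃ i, ∃ ε > 0, Metric.ball x ε ⊆ Ω ∧ EqOn v (R i) (Metric.ball x ε) := by
    intro x hx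
    obtain ⟨ε, hε, hB⟩ := Metric.isOpen_iff.1 hΩ x hx
    have hm := subset_closure hx
    rw [hT.cover] at hm
    obtain ⟨i, hi⟩ := mem_iUnion.1 hm
    have hne : (Metric.ball x ε ∩ (T i).carrier).Nonempty :=
      mem_closure_iff.1 hi _ Metric.isOpen_ball (Metric.mem_ball_self hε)
    refine ⟨i, ε, hε, hB, fun z hz => sub_eq_zero.1 (eq_zero_of_forall_inner_sub
      (Metric.isOpen_ball.inter (T i).isOpen) hne (x := z) fun y hy => ?_)⟩
    have h1 := inner_sub_eq_zero_of_piecewise_rigid hT hv hR hvR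
      (((convex_ball x ε).segment_subset hz hy.1).trans (hB.trans subset_closure))
    have h2 := hR i z y
    rw [inner_sub_left] at h1 h2 ⊢
    rw [hvR i y (subset_closure hy.2)] at h1
    linarith
  obtain ⟨x₀, hx₀⟩ := hΩc.nonempty
  obtain ⟨i, ε₀, hε₀, -, h₀⟩ := hloc x₀ hx₀
  refine ⟨i, ?_⟩
  set S : Set Plane := {x | v =ᶠ[𝓝 x] R i} with hS
  have hΩS : Ω ⊆ S := by
    refine hΩc.isPreconnected.subset_of_closure_inter_subset isOpen_setOfPred_eventually_nhds
      ⟨x₀, hx₀, h₀.eventuallyEq_of_mem (Metric.ball_mem_nhds _ hε₀)⟩ ?_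
    rintro x ⟨hxS, hx⟩
    obtain ⟨j, ε, hε, -, hj⟩ := hloc x hx
    obtain ⟨y, hyB, hyS⟩ := mem_closure_iff.1 hxS _ Metric.isOpen_ball (Metric.mem_ball_self hε)
    obtain ⟨U, hU, hUo, hyU⟩ := mem_nhds_iff.1 hyS
    have : R i = R j := (hR i).eq_of_eqOn (hR j) (Metric.isOpen_ball.inter hUo) ⟨y, hyB, hyU⟩
      fun z hz => (hU hz.2).symm.trans (hj hz.1)
    change v =ᶠ[𝓝 x] R i
    rw [this]
    exact hj.eventuallyEq_of_mem (Metric.ball_mem_nhds _ hε)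
  exact EqOn.of_subset_closure (fun x hx => (hΩS hx).self_of_nhds) hv (hRc i).continuousOn
    subset_closure subset_rfl

end Pieces

/-- A continuous field that is rigid on every element and vanishes on a part of the boundary of
positive length vanishes. -/
lemma eq_zero_of_piecewise_rigid {Ω ΓD : Set Plane} {ι : Type*} [Finite ι] {T : ι → MeshElement}
    (hΩ : IsOpen Ω) (hΩc : IsConnected Ω) (hT : IsDecomposition Ω T)
    (hΓ : ΓD ⊆ frontier Ω) (hΓm : MeasurableSet ΓD) (hΓD : 0 < μH[1] ΓD) {v : Plane → Plane}
    (hv : ContinuousOn v (closure Ω)) (hv0 : ∀ᵐ x ∂(μH[1]).restrict ΓD, v x = 0)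
    (hR : ∀ i, ∃ P : Fin 2 → Poly, IsRigid (polyField P) ∧
      ∀ x ∈ closure (T i).carrier, v x = polyField P x) :
    ∀ x ∈ closure Ω, v x = 0 := by
  choose P hP hvP using hR
  obtain ⟨i, hi⟩ := eq_rigid_of_piecewise_rigid hΩ hΩc hT hv hP
    (fun i => continuous_polyField (P i)) hvP
  have hns : ¬ ({x | v x = 0} ∩ ΓD).Subsingleton := fun hs => by
    have h0 : μH[1] ({x | v x = 0} ∩ ΓD) = 0 := by
      have := Measure.nullSingletonClass_hausdorff Plane one_pos
      exact hs.measure_zero _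
    have h1 : (μH[1]).restrict ΓD {x | v x = 0} = 0 := by
      rw [Measure.restrict_apply' hΓm, h0]
    have h2 : ∀ᵐ x ∂(μH[1]).restrict ΓD, v x ≠ 0 := by
      rw [ae_iff]; simpa using h1
    have h3 : ∀ᵐ x ∂(μH[1]).restrict ΓD, False := by
      filter_upwards [hv0, h2] with x hx hx' using hx' hx
    rw [ae_iff] at h3
    simp only [not_false_eq_true, ofPred_true, Measure.restrict_apply_univ] at h3
    exact hΓD.ne' h3
  obtain ⟨a, ha, b, hb, hab⟩ := not_subsingleton_iff.1 hns
  have hz : ∀ p ∈ {x | v x = 0} ∩ ΓD, polyField (P i) p = 0 := fun p hp =>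
    (hi (frontier_subset_closure (hΓ hp.2))).symm.trans hp.1
  intro x hx
  rw [hi hx, (hP i).eq_zero hab (hz a ha) (hz b hb)]
  rfl

/-- The boundary of a decomposed domain has finite length. -/
lemma hausdorffMeasure_frontier_lt_top {Ω : Set Plane} {ι : Type*} [Finite ι]
    {T : ι → MeshElement} (hΩ : IsOpen Ω) (hT : IsDecomposition Ω T) :
    μH[1] (frontier Ω) < ⊤ := by
  have hsub : frontier Ω ⊆ ⋃ i, ⋃ j, segment ℝ ((T i).poly j) ((T i).poly (finRotate _ j)) := by
    intro x hx
    have hm := frontier_subset_closure hx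
    rw [hT.cover] at hm
    obtain ⟨i, hi⟩ := mem_iUnion.1 hm
    have hf : x ∈ frontier (T i).carrier := by
      refine ⟨hi, fun h => hx.2 ?_⟩
      rw [hΩ.interior_eq]
      rw [(T i).isOpen.interior_eq] at h
      exact hT.subset i h
    rw [(T i).frontier_eq, Polygon.boundary] at hf
    obtain ⟨j, hj⟩ := mem_iUnion.1 hf
    refine mem_iUnion.2 ⟨i, mem_iUnion.2 ⟨j, ?_⟩⟩
    rw [segment_eq_image_lineMap]
    exact hj
  refine (measure_mono hsub).trans_lt ?_
  have := Fintype.ofFinite ι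
  refine (measure_iUnion_fintype_le _ _).trans_lt (ENNReal.sum_lt_top.2 fun i _ =>
    (measure_iUnion_fintype_le _ _).trans_lt (ENNReal.sum_lt_top.2 fun j _ => ?_))
  rw [hausdorffMeasure_segment]
  exact edist_lt_top _ _

/-! ### Radial monotone maps -/

/-- The weight `(δ^α + c t^α)^((r-2)/α)` of the Carreau–Yasuda law and of the stabilization. -/
def radialWeight (δ α r c t : ℝ) : ℝ := (δ ^ α + c * t ^ α) ^ ((r - 2) / α)

section Radial

variable {δ α r c : ℝ}

lemma radialWeight_nonneg (hδ : 0 ≤ δ) (hc : 0 < c) {t : ℝ} (ht : 0 ≤ t) :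
    0 ≤ radialWeight δ α r c t := by
  unfold radialWeight; positivity

lemma radialWeight_pos (hδ : 0 ≤ δ) (hc : 0 < c) {t : ℝ} (ht : 0 < t) :
    0 < radialWeight δ α r c t := by
  unfold radialWeight; positivity

lemma radialWeight_mono (hδ : 0 ≤ δ) (hc : 0 < c) (hα : 0 < α) (hr : 2 ≤ r) {s t : ℝ}
    (hs : 0 ≤ s) (hst : s ≤ t) : radialWeight δ α r c s ≤ radialWeight δ α r c t := by
  unfold radialWeight
  have : 0 ≤ (r - 2) / α := div_nonneg (by linarith) hα.le
  gcongr

lemma continuous_radialWeight (hα : 0 < α) (hr : 2 ≤ r) :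
    Continuous (radialWeight δ α r c) := by
  unfold radialWeight
  have : 0 ≤ (r - 2) / α := div_nonneg (by linarith) hα.le
  refine Continuous.rpow_const (continuous_const.add (continuous_const.mul
    (Continuous.rpow_const continuous_id fun _ => Or.inr hα.le))) fun _ => Or.inr this

variable {E : Type*} [NormedAddCommGroup E] [InnerProductSpace ℝ E]

/-- The identity `⟪a x - b y, x - y⟫ = (a + b) |x - y|² / 2 + (a - b) (|x|² - |y|²) / 2` makes a
radial map with increasing weight strictly monotone. -/
lemma inner_radial_pos (hδ : 0 ≤ δ) (hc : 0 < c) (hα : 0 < α) (hr : 2 ≤ r) {x y : E}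
    (hxy : x ≠ y) : 0 < inner ℝ (radialWeight δ α r c ‖x‖ • x - radialWeight δ α r c ‖y‖ • y)
      (x - y) := by
  set a := radialWeight δ α r c ‖x‖ with ha
  set b := radialWeight δ α r c ‖y‖ with hb
  have hid : inner ℝ (a • x - b • y) (x - y)
      = (a + b) / 2 * ‖x - y‖ ^ 2 + (a - b) * (‖x‖ - ‖y‖) * ((‖x‖ + ‖y‖) / 2) := by
    have h1 := norm_sub_sq_real x y
    rw [h1, inner_sub_left, inner_sub_right, inner_sub_right, inner_smul_left, inner_smul_left,
      inner_smul_left, inner_smul_left, real_inner_self_eq_norm_sq, real_inner_self_eq_norm_sq,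
      real_inner_comm x y]
    simp only [conj_trivial]
    ring
  have h2 : 0 ≤ (a - b) * (‖x‖ - ‖y‖) := by
    rcases le_total ‖x‖ ‖y‖ with h | h
    · exact mul_nonneg_of_nonpos_of_nonpos
        (sub_nonpos.2 (radialWeight_mono hδ hc hα hr (norm_nonneg _) h)) (sub_nonpos.2 h)
    · exact mul_nonneg (sub_nonneg.2 (radialWeight_mono hδ hc hα hr (norm_nonneg _) h))
        (sub_nonneg.2 h)
  have h3 : 0 < a + b := by
    have h4 := radialWeight_nonneg (α := α) (r := r) hδ hc (norm_nonneg x)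
    have h5 := radialWeight_nonneg (α := α) (r := r) hδ hc (norm_nonneg y)
    by_cases hx : x = 0
    · have := radialWeight_pos (α := α) (r := r) hδ hc
        (norm_pos_iff.2 fun h : y = 0 => hxy (hx.trans h.symm))
      linarith
    · have := radialWeight_pos (α := α) (r := r) hδ hc (norm_pos_iff.2 hx)
      linarith
  have h6 : 0 < ‖x - y‖ := norm_pos_iff.2 (sub_ne_zero.2 hxy)
  rw [hid]
  have := mul_nonneg h2 (by positivity : 0 ≤ (‖x‖ + ‖y‖) / 2)
  have : 0 < (a + b) / 2 * ‖x - y‖ ^ 2 := by positivity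
  linarith

lemma exists_le_radialWeight_mul_sq (hδ : 0 ≤ δ) (hc : 0 < c) (hα : 0 < α) (hr : 2 ≤ r) :
    ∃ C, 0 ≤ C ∧ ∀ t, 0 ≤ t → t ^ 2 - C ≤ radialWeight δ α r c t * t ^ 2 := by
  -- the weight is at least one as soon as `c t^α ≥ 1`
  refine ⟨(c⁻¹ ^ (α⁻¹)) ^ 2, by positivity, fun t ht => ?_⟩
  by_cases h : c⁻¹ ^ (α⁻¹) ≤ t
  · have h1 : 1 ≤ c * t ^ α := by
      have : (c⁻¹ ^ (α⁻¹)) ^ α ≤ t ^ α := by gcongr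
      rw [← Real.rpow_mul (by positivity), inv_mul_cancel₀ hα.ne', Real.rpow_one] at this
      calc (1 : ℝ) = c * c⁻¹ := (mul_inv_cancel₀ hc.ne').symm
        _ ≤ _ := by gcongr
    have h2 : 1 ≤ radialWeight δ α r c t := by
      refine Real.one_le_rpow ?_ (div_nonneg (by linarith) hα.le)
      have : 0 ≤ δ ^ α := by positivity
      linarith
    nlinarith [sq_nonneg t, sq_nonneg (c⁻¹ ^ (α⁻¹))]
  · push Not at h
    have h1 : t ^ 2 ≤ (c⁻¹ ^ (α⁻¹)) ^ 2 := by gcongr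
    have := mul_nonneg (radialWeight_nonneg (α := α) (r := r) hδ hc ht) (sq_nonneg t)
    linarith

end Radial

/-! ### Stress laws as Carathéodory monotone operators -/

/-- A matrix as a vector of the Euclidean space of its entries. -/
def matVec : Matrix (Fin 2) (Fin 2) ℝ →ₗ[ℝ] EuclideanSpace ℝ (Fin 2 × Fin 2) where
  toFun A := WithLp.toLp 2 fun p => A p.1 p.2
  map_add' _ _ := rfl
  map_smul' _ _ := rfl

lemma matVec_apply (A : Matrix (Fin 2) (Fin 2) ℝ) (i j : Fin 2) : matVec A (i, j) = A i j := rfl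

lemma matVec_injective : Function.Injective matVec := fun A B h => by
  ext i j
  exact congrArg (fun z : EuclideanSpace ℝ (Fin 2 × Fin 2) => z (i, j)) h

lemma frobInner_eq_inner (A B : Matrix (Fin 2) (Fin 2) ℝ) :
    frobInner A B = inner ℝ (matVec A) (matVec B) := by
  simp only [frobInner, PiLp.inner_apply, Fintype.sum_prod_type, RCLike.inner_apply, conj_trivial,
    matVec_apply, mul_comm]

lemma frobNorm_eq_norm (A : Matrix (Fin 2) (Fin 2) ℝ) : frobNorm A = ‖matVec A‖ := by
  rw [frobNorm, frobInner_eq_inner, real_inner_self_eq_norm_sq, Real.sqrt_sq (norm_nonneg _)]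

lemma continuous_frobNorm : Continuous frobNorm := by
  have : frobNorm = fun A => ‖matVec A‖ := funext frobNorm_eq_norm
  rw [this]
  exact (LinearMap.continuous_of_finiteDimensional matVec).norm

/-- The properties of a stress law that well-posedness rests on: the Carathéodory conditions, local
boundedness, strict monotonicity and quadratic growth at infinity, uniformly in space. -/
structure IsMonotoneLaw (Ω : Set Plane)
    (σ : Plane → Matrix (Fin 2) (Fin 2) ℝ → Matrix (Fin 2) (Fin 2) ℝ) : Prop where
  measurable : ∀ τ : Matrix (Fin 2) (Fin 2) ℝ, τ.IsSymm → ∀ i j,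
    AEStronglyMeasurable (fun x => σ x τ i j) (volume.restrict Ω)
  continuous : ∀ᵐ x ∂volume.restrict Ω, ContinuousOn (σ x) {τ | τ.IsSymm}
  bounded : ∀ M : ℝ, ∃ B : ℝ, ∀ᵐ x ∂volume.restrict Ω, ∀ τ : Matrix (Fin 2) (Fin 2) ℝ,
    τ.IsSymm → frobNorm τ ≤ M → frobNorm (σ x τ) ≤ B
  strictMono : ∀ᵐ x ∂volume.restrict Ω, ∀ τ η : Matrix (Fin 2) (Fin 2) ℝ, τ.IsSymm → η.IsSymm →
    τ ≠ η → 0 < frobInner (σ x τ - σ x η) (τ - η)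
  coercive : ∃ c C : ℝ, 0 < c ∧ ∀ᵐ x ∂volume.restrict Ω, ∀ τ : Matrix (Fin 2) (Fin 2) ℝ,
    τ.IsSymm → c * frobNorm τ ^ 2 - C ≤ frobInner (σ x τ) τ

lemma isMonotoneLaw_carreauYasuda {Ω : Set Plane} (hΩ : MeasurableSet Ω) {μ : Plane → ℝ}
    {δ α r μm μp : ℝ} (hμm : 0 < μm) (hμ_meas : AEStronglyMeasurable μ (volume.restrict Ω))
    (hμ : ∀ x ∈ Ω, μm ≤ μ x ∧ μ x ≤ μp) (hδ : 0 ≤ δ) (hα : 0 < α) (hr : 2 ≤ r) :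
    IsMonotoneLaw Ω (carreauYasuda μ δ α r) := by
  have hμae : ∀ᵐ x ∂volume.restrict Ω, μm ≤ μ x ∧ μ x ≤ μp := by
    filter_upwards [ae_restrict_mem hΩ] with x hx using hμ x hx
  have hCY : ∀ x τ, carreauYasuda μ δ α r x τ
      = μ x • radialWeight δ α r 1 (frobNorm τ) • τ := fun x τ => by
    simp [carreauYasuda, radialWeight, smul_smul]
  refine ⟨fun τ _ i j => ?_, ?_, fun M => ?_, ?_, ?_⟩
  · simp only [hCY, Matrix.smul_apply, smul_eq_mul]
    exact hμ_meas.mul_const _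
  · refine .of_forall fun x => Continuous.continuousOn ?_
    rw [show carreauYasuda μ δ α r x = fun τ => μ x • radialWeight δ α r 1 (frobNorm τ) • τ from
      funext (hCY x)]
    exact ((((continuous_radialWeight hα hr).comp continuous_frobNorm).smul
      continuous_id).const_smul (μ x))
  · refine ⟨μp * (radialWeight δ α r 1 (max M 0) * max M 0), ?_⟩
    filter_upwards [hμae] with x hx τ _ hτ
    have h0 : 0 ≤ frobNorm τ := Real.sqrt_nonneg _
    have h1 := radialWeight_nonneg (α := α) (r := r) hδ one_pos h0
    have h2 := radialWeight_mono hδ one_pos hα hr h0 (hτ.trans (le_max_left M 0))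
    rw [hCY, frobNorm_eq_norm, map_smul, map_smul, norm_smul, norm_smul, ← frobNorm_eq_norm,
      Real.norm_of_nonneg h1, Real.norm_of_nonneg (hμm.le.trans hx.1)]
    have := le_max_left M 0
    have h3 : 0 ≤ μp := hμm.le.trans (hx.1.trans hx.2)
    gcongr
    · exact hx.2
    · exact h1.trans h2
    · exact hτ.trans this
  · filter_upwards [hμae] with x hx τ η _ _ hne
    rw [hCY, hCY, ← smul_sub, frobInner_eq_inner, map_smul, map_sub, map_smul, map_smul, map_sub,
      inner_smul_left, frobNorm_eq_norm, frobNorm_eq_norm]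
    exact mul_pos (hμm.trans_le hx.1)
      (inner_radial_pos hδ one_pos hα hr fun h => hne (matVec_injective h))
  · obtain ⟨C, hC, h⟩ := exists_le_radialWeight_mul_sq (r := r) hδ one_pos hα hr
    refine ⟨μm, μp * C, hμm, ?_⟩
    filter_upwards [hμae] with x hx τ _
    have h0 : 0 ≤ frobNorm τ := Real.sqrt_nonneg _
    have h1 := radialWeight_nonneg (α := α) (r := r) hδ one_pos h0
    have h2 := h _ h0
    rw [hCY, frobInner_eq_inner, map_smul, map_smul, inner_smul_left, inner_smul_left,
      real_inner_self_eq_norm_sq, ← frobNorm_eq_norm]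
    simp only [conj_trivial]
    have h3 : μm * frobNorm τ ^ 2 ≤ μ x * frobNorm τ ^ 2 := by gcongr; exact hx.1
    have h4 : μ x * C ≤ μp * C := by gcongr; exact hx.2
    have h5 := mul_le_mul_of_nonneg_left h2 (hμm.le.trans hx.1)
    linarith

lemma StressLaw.isMonotoneLaw {Ω : Set Plane} {r δ σc σm : ℝ}
    {σ : Plane → Matrix (Fin 2) (Fin 2) ℝ → Matrix (Fin 2) (Fin 2) ℝ} (hr : 2 ≤ r) (hδ : 0 ≤ δ)
    (hσc : 0 < σc) (hσm : 0 < σm) (h : StressLaw Ω r δ σc σm σ) : IsMonotoneLaw Ω σ := by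
  have he : 0 ≤ (r - 2) / r := div_nonneg (by linarith) (by linarith)
  have hn : ∀ τ, 0 ≤ frobNorm τ := fun _ => Real.sqrt_nonneg _
  have h0s : (0 : Matrix (Fin 2) (Fin 2) ℝ).IsSymm := Matrix.isSymm_zero
  refine ⟨h.measurable, h.continuous, fun M => ?_, ?_, ?_⟩
  · refine ⟨σc * (δ ^ r + (max M 0) ^ r + frobNorm 0 ^ r) ^ ((r - 2) / r) * max M 0, ?_⟩
    filter_upwards [h.zero, h.holder] with x hx0 hx τ hτ hM
    have h1 := hx τ 0 hτ h0s
    rw [hx0, sub_zero, sub_zero] at h1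
    refine h1.trans ?_
    have := hn τ
    have := hn 0
    have hM' := hM.trans (le_max_left M 0)
    gcongr
  · filter_upwards [h.monotone] with x hx τ η hτ hη hne
    refine lt_of_lt_of_le ?_ (hx τ η hτ hη)
    have hpos : ∀ τ, τ ≠ 0 → 0 < frobNorm τ := fun τ hτ => by
      rw [frobNorm_eq_norm, norm_pos_iff]
      exact fun h => hτ (matVec_injective (h.trans (map_zero _).symm))
    have h1 := hpos _ (sub_ne_zero.2 hne)
    have h2 : 0 < δ ^ r + frobNorm τ ^ r + frobNorm η ^ r := by
      have a1 := hn τ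
      have a2 := hn η
      by_cases hτ0 : τ = 0
      · have := hpos η fun h => hne (hτ0.trans h.symm)
        positivity
      · have := hpos τ hτ0
        positivity
    positivity
  · refine ⟨σm, σm, hσm, ?_⟩
    filter_upwards [h.zero, h.monotone] with x hx0 hx τ hτ
    have h1 := hx τ 0 hτ h0s
    rw [hx0, sub_zero, sub_zero] at h1
    refine le_trans ?_ h1
    have a1 := hn τ
    have a2 := hn 0
    rw [mul_assoc, ← mul_sub_one]
    refine mul_le_mul_of_nonneg_left ?_ hσm.le
    by_cases h2 : 1 ≤ frobNorm τ
    · have h3 : 1 ≤ (δ ^ r + frobNorm τ ^ r + frobNorm 0 ^ r) ^ ((r - 2) / r) := by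
        refine Real.one_le_rpow ?_ he
        have := Real.one_le_rpow h2 (by linarith : 0 ≤ r)
        have : 0 ≤ δ ^ r := by positivity
        have : 0 ≤ frobNorm 0 ^ r := by positivity
        linarith
      nlinarith [sq_nonneg (frobNorm τ)]
    · push Not at h2
      have h3 : frobNorm τ ^ 2 ≤ 1 := pow_le_one₀ a1 h2.le
      have : 0 ≤ (δ ^ r + frobNorm τ ^ r + frobNorm 0 ^ r) ^ ((r - 2) / r) * frobNorm τ ^ 2 := by
        positivity
      linarith

/-- Superposition of a Carathéodory law with a continuous symmetric tensor field is measurable: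
replace the tensor field by simple functions. -/
lemma IsMonotoneLaw.aestronglyMeasurable_comp {Ω E : Set Plane}
    {σ : Plane → Matrix (Fin 2) (Fin 2) ℝ → Matrix (Fin 2) (Fin 2) ℝ} (hσ : IsMonotoneLaw Ω σ)
    (hE : E ⊆ Ω) {S : Plane → Matrix (Fin 2) (Fin 2) ℝ} (hS : Continuous S)
    (hsymm : ∀ x, (S x).IsSymm) (i j : Fin 2) :
    AEStronglyMeasurable (fun x => σ x (S x) i j) (volume.restrict E) := by
  -- coordinates on the symmetric matrices, so that the simple functions have symmetric values
  let m : (Fin 3 → ℝ) → Matrix (Fin 2) (Fin 2) ℝ := fun p => !![p 0, p 1; p 1, p 2]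
  have hm : Continuous m := by
    refine continuous_matrix fun a b => ?_
    fin_cases a <;> fin_cases b <;> exact continuous_apply _
  have hms : ∀ p, (m p).IsSymm := fun p => by
    ext a b
    fin_cases a <;> fin_cases b <;> rfl
  let p : Plane → Fin 3 → ℝ := fun x => ![S x 0 0, S x 0 1, S x 1 1]
  have hp : Continuous p := by
    refine continuous_pi fun a => ?_
    fin_cases a
    · exact hS.matrix_elem 0 0
    · exact hS.matrix_elem 0 1
    · exact hS.matrix_elem 1 1
  have hmp : ∀ x, m (p x) = S x := fun x => by
    ext a b
    fin_cases a <;> fin_cases b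
    · rfl
    · rfl
    · exact ((hsymm x).apply 1 0)
    · rfl
  have hps : StronglyMeasurable p := hp.stronglyMeasurable
  refine aestronglyMeasurable_of_tendsto_ae atTop
    (f := fun n x => σ x (m (hps.approx n x)) i j) (fun n => ?_) ?_
  · have e : (fun x => σ x (m (hps.approx n x)) i j)
        = ∑ q ∈ (hps.approx n).range,
          ((hps.approx n) ⁻¹' {q}).indicator fun x => σ x (m q) i j := by
      ext x
      rw [Finset.sum_apply, Finset.sum_eq_single (hps.approx n x)]
      · simp
      · intro q _ hq
        exact indicator_of_notMem (fun h => hq h.symm) _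
      · intro h
        exact absurd (SimpleFunc.mem_range_self _ x) h
    rw [e]
    exact Finset.aestronglyMeasurable_sum _ fun q _ =>
      ((hσ.measurable (m q) (hms q) i j).mono_set hE).indicator (SimpleFunc.measurableSet_fiber _ q)
  · filter_upwards [ae_restrict_of_ae_restrict_of_subset hE hσ.continuous] with x hx
    have h1 : Tendsto (fun n => m (hps.approx n x)) atTop (𝓝[{τ | τ.IsSymm}] (S x)) := by
      refine tendsto_nhdsWithin_iff.2 ⟨?_, .of_forall fun n => hms _⟩
      rw [← hmp x]
      exact (hm.tendsto _).comp (hps.tendsto_approx x)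
    have h2 := (hx (S x) (hsymm x)).tendsto.comp h1
    exact ((continuous_apply_apply i j).tendsto _).comp h2

/-! ### The local forms -/

lemma abs_frobInner_le (A B : Matrix (Fin 2) (Fin 2) ℝ) :
    |frobInner A B| ≤ frobNorm A * frobNorm B := by
  rw [frobInner_eq_inner, frobNorm_eq_norm, frobNorm_eq_norm]
  exact abs_real_inner_le_norm _ _

lemma frobInner_smul_add_right (A B B' : Matrix (Fin 2) (Fin 2) ℝ) (a b : ℝ) :
    frobInner A (a • B + b • B') = a * frobInner A B + b * frobInner A B' := by
  simp only [frobInner_eq_inner, map_add, map_smul, inner_add_right, inner_smul_right]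

lemma IsBddOpen.exists_frobNorm_le {E : Set Plane} (hE : IsBddOpen E)
    {S : Plane → Matrix (Fin 2) (Fin 2) ℝ} (hS : Continuous S) :
    ∃ M, ∀ x ∈ E, frobNorm (S x) ≤ M := by
  obtain ⟨M, hM⟩ := (hE.isCompact_closure.bddAbove_image
    (continuous_frobNorm.comp hS).continuousOn)
  exact ⟨M, fun x hx => hM (mem_image_of_mem _ (subset_closure hx))⟩

section Law

variable {Ω E : Set Plane} {σ : Plane → Matrix (Fin 2) (Fin 2) ℝ → Matrix (Fin 2) (Fin 2) ℝ}

lemma IsMonotoneLaw.aestronglyMeasurable_frobInner (hσ : IsMonotoneLaw Ω σ) (hEΩ : E ⊆ Ω)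
    {S W : Plane → Matrix (Fin 2) (Fin 2) ℝ}
    (hS : Continuous S) (hsymm : ∀ x, (S x).IsSymm) (hW : Continuous W) :
    AEStronglyMeasurable (fun x => frobInner (σ x (S x)) (W x)) (volume.restrict E) := by
  unfold frobInner
  exact Finset.aestronglyMeasurable_fun_sum _ fun i _ => Finset.aestronglyMeasurable_fun_sum _
    fun j _ => (hσ.aestronglyMeasurable_comp hEΩ hS hsymm i j).mul
      (hW.matrix_elem i j).aestronglyMeasurable

lemma IsMonotoneLaw.integrableOn (hσ : IsMonotoneLaw Ω σ) (hE : IsBddOpen E) (hEΩ : E ⊆ Ω)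
    {S W : Plane → Matrix (Fin 2) (Fin 2) ℝ}
    (hS : Continuous S) (hsymm : ∀ x, (S x).IsSymm) (hW : Continuous W) :
    IntegrableOn (fun x => frobInner (σ x (S x)) (W x)) E := by
  obtain ⟨M, hM⟩ := hE.exists_frobNorm_le hS
  obtain ⟨N, hN⟩ := hE.exists_frobNorm_le hW
  obtain ⟨B, hB⟩ := hσ.bounded M
  have := hE.isFiniteMeasure
  refine (integrable_const (B * N)).mono'
    (hσ.aestronglyMeasurable_frobInner hEΩ hS hsymm hW) ?_
  filter_upwards [ae_restrict_of_ae_restrict_of_subset hEΩ hB,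
    ae_restrict_mem hE.measurableSet] with x hx hxE
  have h1 := hx (S x) (hsymm x) (hM x hxE)
  exact (abs_frobInner_le _ _).trans (mul_le_mul h1 (hN x hxE) (Real.sqrt_nonneg _)
    ((Real.sqrt_nonneg _).trans h1))

/-- Dominated convergence along a continuous family of tensor fields. -/
lemma IsMonotoneLaw.continuous_integral (hσ : IsMonotoneLaw Ω σ) (hE : IsBddOpen E) (hEΩ : E ⊆ Ω)
    {X : Type*} [TopologicalSpace X] [LocallyCompactSpace X]
    [FirstCountableTopology X] {S : X → Plane → Matrix (Fin 2) (Fin 2) ℝ}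
    (hS : Continuous fun p : X × Plane => S p.1 p.2) (hsymm : ∀ c x, (S c x).IsSymm)
    {W : Plane → Matrix (Fin 2) (Fin 2) ℝ} (hW : Continuous W) :
    Continuous fun c => ∫ x in E, frobInner (σ x (S c x)) (W x) := by
  refine continuous_iff_continuousAt.2 fun c₀ => ?_
  obtain ⟨Q, hQ, hc₀⟩ := exists_compact_mem_nhds c₀
  obtain ⟨M, hM⟩ := (hQ.prod hE.isCompact_closure).bddAbove_image
    (continuous_frobNorm.comp hS).continuousOn
  obtain ⟨N, hN⟩ := hE.exists_frobNorm_le hW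
  obtain ⟨B, hB⟩ := hσ.bounded M
  have := hE.isFiniteMeasure
  have hSc : ∀ c, Continuous (S c) := fun c => hS.comp (by fun_prop : Continuous fun x => (c, x))
  refine continuousAt_of_dominated (bound := fun _ => B * N) (.of_forall fun c =>
    hσ.aestronglyMeasurable_frobInner hEΩ (hSc c) (hsymm c) hW) ?_ (integrable_const _) ?_
  · filter_upwards [hc₀] with c hc
    filter_upwards [ae_restrict_of_ae_restrict_of_subset hEΩ hB,
      ae_restrict_mem hE.measurableSet] with x hx hxE
    have h1 := hx (S c x) (hsymm c x)
      (hM (mem_image_of_mem (x := (c, x)) _ ⟨hc, subset_closure hxE⟩))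
    exact (abs_frobInner_le _ _).trans (mul_le_mul h1 (hN x hxE) (Real.sqrt_nonneg _)
      ((Real.sqrt_nonneg _).trans h1))
  · filter_upwards [ae_restrict_of_ae_restrict_of_subset hEΩ hσ.continuous] with x hx
    have h1 : Continuous fun c => σ x (S c x) :=
      hx.comp_continuous (hS.comp (by fun_prop : Continuous fun c => (c, x))) fun c => hsymm c x
    unfold frobInner
    exact (continuous_finsetSum _ fun i _ => continuous_finsetSum _ fun j _ =>
      (h1.matrix_elem i j).mul continuous_const).continuousAt

/-- The integrated law is monotone, and strictly so since continuous tensor fields that agree almost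
everywhere on an open set agree there. -/
lemma IsMonotoneLaw.integral_sub_nonneg (hσ : IsMonotoneLaw Ω σ) (hE : IsBddOpen E) (hEΩ : E ⊆ Ω)
    {S S' : Plane → Matrix (Fin 2) (Fin 2) ℝ}
    (hS : Continuous S) (hsymm : ∀ x, (S x).IsSymm) (hS' : Continuous S')
    (hsymm' : ∀ x, (S' x).IsSymm) :
    0 ≤ (∫ x in E, frobInner (σ x (S x)) (S x - S' x))
        - ∫ x in E, frobInner (σ x (S' x)) (S x - S' x) ∧
      ((∫ x in E, frobInner (σ x (S x)) (S x - S' x))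
        - ∫ x in E, frobInner (σ x (S' x)) (S x - S' x) = 0 → ∀ x ∈ E, S x = S' x) := by
  have hW : Continuous fun x => S x - S' x := hS.sub hS'
  have hI := hσ.integrableOn hE hEΩ hS hsymm hW
  have hI' := hσ.integrableOn hE hEΩ hS' hsymm' hW
  have hmono := ae_restrict_of_ae_restrict_of_subset hEΩ hσ.strictMono
  have hsub : ∀ x, frobInner (σ x (S x)) (S x - S' x) - frobInner (σ x (S' x)) (S x - S' x)
      = frobInner (σ x (S x) - σ x (S' x)) (S x - S' x) := fun x => by
    simp only [frobInner_eq_inner, map_sub, inner_sub_left]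
  have h0 : 0 ≤ᵐ[volume.restrict E] fun x =>
      frobInner (σ x (S x)) (S x - S' x) - frobInner (σ x (S' x)) (S x - S' x) := by
    filter_upwards [hmono] with x hx
    rw [hsub]
    by_cases h : S x = S' x
    · simp [h, frobInner]
    · exact (hx _ _ (hsymm x) (hsymm' x) h).le
  rw [← integral_sub hI hI']
  refine ⟨integral_nonneg_of_ae h0, fun h x hx => ?_⟩
  have h1 := (integral_eq_zero_iff_of_nonneg_ae h0 (hI.sub hI')).1 h
  have h2 : ∀ᵐ x ∂volume.restrict E, S x = S' x := by
    filter_upwards [h1, hmono] with x hx hx'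
    by_contra hne
    have := hx' _ _ (hsymm x) (hsymm' x) hne
    rw [← hsub] at this
    exact this.ne' hx
  exact Measure.eqOn_open_of_ae_eq h2 hE.isOpen hS.continuousOn hS'.continuousOn hx

end Law

namespace MeshElement

variable {K : MeshElement} {k : ℕ}

lemma stab_eq (μ : Plane → ℝ) (δ α r : ℝ) (v w : Plane → Plane) :
    K.stab k μ δ α r v w = (⨍ x in K.carrier, μ x) *
      inner ℝ (radialWeight δ α r (K.diam ^ (-α)) ‖K.dof k v‖ • K.dof k v) (K.dof k w) := by
  rw [stab, inner_smul_left, radialWeight, conj_trivial, mul_assoc]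

lemma average_pos {Ω : Set Plane} (hKΩ : K.carrier ⊆ Ω) {μ : Plane → ℝ} {μm μp : ℝ} (hμm : 0 < μm)
    (hμ_meas : AEStronglyMeasurable μ (volume.restrict Ω))
    (hμ : ∀ x ∈ Ω, μm ≤ μ x ∧ μ x ≤ μp) : 0 < ⨍ x in K.carrier, μ x := by
  have hE := K.isBddOpen
  have := hE.isFiniteMeasure
  have hI : IntegrableOn μ K.carrier := by
    refine (integrable_const μp).mono' (hμ_meas.mono_set hKΩ) ?_
    filter_upwards [ae_restrict_mem hE.measurableSet] with x hx
    rw [Real.norm_of_nonneg (hμm.le.trans (hμ x (hKΩ hx)).1)]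
    exact (hμ x (hKΩ hx)).2
  rw [setAverage_eq, smul_eq_mul]
  refine mul_pos (inv_pos.2 K.area_pos) ?_
  have h1 : ∫ x in K.carrier, μm ≤ ∫ x in K.carrier, μ x :=
    setIntegral_mono_on (integrable_const μm) hI hE.measurableSet fun x hx => (hμ x (hKΩ hx)).1
  refine lt_of_lt_of_le ?_ h1
  rw [setIntegral_const, smul_eq_mul]
  exact mul_pos K.area_pos hμm

/-- The contribution of one element to the discrete form. -/
def localForm (K : MeshElement) (k : ℕ)
    (σ : Plane → Matrix (Fin 2) (Fin 2) ℝ → Matrix (Fin 2) (Fin 2) ℝ) (μ : Plane → ℝ)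
    (δ α r : ℝ) (v w : Plane → Plane) : ℝ :=
  (∫ x in K.carrier, frobInner (σ x (K.projStrain k v x)) (K.projStrain k w x)) +
    K.stab k μ δ α r (K.defect k v) (K.defect k w)

/-- The squared norm of the projected strain and of the degrees of freedom of the defect. -/
def localEnergy (K : MeshElement) (k : ℕ) (v : Plane → Plane) : ℝ :=
  (∫ x in K.carrier, frobNorm (K.projStrain k v x) ^ 2) + ‖K.dof k (K.defect k v)‖ ^ 2

lemma IsAdmissibleField.defect {v : Plane → Plane} (hv : K.IsAdmissibleField v) :
    K.IsAdmissibleField (K.defect k v) := by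
  obtain ⟨P, -, h⟩ := exists_l2ProjVec_eq K.carrier k v
  convert hv.smul_add (isAdmissibleField_polyField P) 1 (-1) using 1
  ext x i
  simp [MeshElement.defect, h, sub_eq_add_neg]

lemma dof_defect_smul_add {v w : Plane → Plane} (hv : K.IsAdmissibleField v)
    (hw : K.IsAdmissibleField w) (a b : ℝ) :
    K.dof k (K.defect k (a • v + b • w))
      = a • K.dof k (K.defect k v) + b • K.dof k (K.defect k w) := by
  rw [defect_smul_add hv hw, dof_smul_add hv.defect hw.defect]

lemma sub_eq_smul_add (v w : Plane → Plane) : v - w = (1 : ℝ) • v + (-1 : ℝ) • w := by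
  rw [one_smul, neg_one_smul, sub_eq_add_neg]

lemma projStrain_sub {v w : Plane → Plane} (hv : K.IsAdmissibleField v)
    (hw : K.IsAdmissibleField w) (x : Plane) :
    K.projStrain k (v - w) x = K.projStrain k v x - K.projStrain k w x := by
  rw [sub_eq_smul_add, projStrain_smul_add hv hw, one_smul, neg_one_smul, ← sub_eq_add_neg]
  rfl

lemma dof_defect_sub {v w : Plane → Plane} (hv : K.IsAdmissibleField v)
    (hw : K.IsAdmissibleField w) :
    K.dof k (K.defect k (v - w)) = K.dof k (K.defect k v) - K.dof k (K.defect k w) := by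
  rw [sub_eq_smul_add, dof_defect_smul_add hv hw, one_smul, neg_one_smul, ← sub_eq_add_neg]

lemma projStrain_smul {v : Plane → Plane} (hv : K.IsAdmissibleField v) (t : ℝ) (x : Plane) :
    K.projStrain k (t • v) x = t • K.projStrain k v x := by
  have := projStrain_smul_add (k := k) hv hv t 0
  rw [zero_smul, add_zero, zero_smul, add_zero] at this
  rw [this]
  rfl

lemma dof_defect_smul {v : Plane → Plane} (hv : K.IsAdmissibleField v) (t : ℝ) :
    K.dof k (K.defect k (t • v)) = t • K.dof k (K.defect k v) := by
  have := dof_defect_smul_add (k := k) hv hv t 0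
  rwa [zero_smul, add_zero, zero_smul, add_zero] at this

lemma localEnergy_smul {v : Plane → Plane} (hv : K.IsAdmissibleField v) (t : ℝ) :
    K.localEnergy k (t • v) = t ^ 2 * K.localEnergy k v := by
  simp only [localEnergy, projStrain_smul hv, dof_defect_smul hv, frobNorm_eq_norm, map_smul,
    norm_smul, mul_pow, Real.norm_eq_abs, sq_abs, integral_const_mul]
  ring

lemma integrableOn_frobNorm_sq (v : Plane → Plane) :
    IntegrableOn (fun x => frobNorm (K.projStrain k v x) ^ 2) K.carrier :=
  K.isBddOpen.integrableOn_of_continuousOn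
    ((continuous_frobNorm.comp (continuous_projStrain v)).pow 2).continuousOn

lemma localEnergy_nonneg (v : Plane → Plane) : 0 ≤ K.localEnergy k v :=
  add_nonneg (integral_nonneg fun _ => sq_nonneg _) (sq_nonneg _)

lemma eq_zero_of_localEnergy_eq_zero {v : Plane → Plane} (h : K.localEnergy k v = 0) :
    (∀ x ∈ K.carrier, K.projStrain k v x = 0) ∧ K.dof k (K.defect k v) = 0 := by
  have h1 : 0 ≤ ∫ x in K.carrier, frobNorm (K.projStrain k v x) ^ 2 :=
    integral_nonneg fun _ => sq_nonneg _
  have h2 := sq_nonneg ‖K.dof k (K.defect k v)‖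
  unfold localEnergy at h
  refine ⟨fun x hx => ?_, norm_eq_zero.1 (pow_eq_zero_iff two_ne_zero |>.1 (by linarith))⟩
  have h3 := K.isBddOpen.eq_zero_of_integral_eq_zero
    ((continuous_frobNorm.comp (continuous_projStrain v)).pow 2).continuousOn
    (integrableOn_frobNorm_sq v) (fun x => sq_nonneg _)
    (show ∫ x in K.carrier, frobNorm (K.projStrain k v x) ^ 2 = 0 by linarith) x hx
  have h4 := pow_eq_zero_iff two_ne_zero |>.1 h3
  rw [Function.comp_apply, frobNorm_eq_norm, norm_eq_zero] at h4
  exact matVec_injective (h4.trans (map_zero _).symm)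

section Form

variable {Ω : Set Plane} {σ : Plane → Matrix (Fin 2) (Fin 2) ℝ → Matrix (Fin 2) (Fin 2) ℝ}
  {μ : Plane → ℝ} {δ α r : ℝ}

lemma localForm_smul_add_right (hσ : IsMonotoneLaw Ω σ) (hKΩ : K.carrier ⊆ Ω)
    (u : Plane → Plane) {v w : Plane → Plane} (hv : K.IsAdmissibleField v)
    (hw : K.IsAdmissibleField w) (a b : ℝ) :
    K.localForm k σ μ δ α r u (a • v + b • w)
      = a * K.localForm k σ μ δ α r u v + b * K.localForm k σ μ δ α r u w := by
  have I := fun w => hσ.integrableOn K.isBddOpen hKΩ (continuous_projStrain (K := K) (k := k) u)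
    (projStrain_isSymm u) (continuous_projStrain (K := K) (k := k) w)
  simp only [localForm, stab_eq]
  rw [projStrain_smul_add hv hw, dof_defect_smul_add hv hw, inner_add_right, inner_smul_right,
    inner_smul_right]
  simp only [Pi.add_apply, Pi.smul_apply, frobInner_smul_add_right]
  rw [integral_add ((I v).const_mul a) ((I w).const_mul b), integral_const_mul, integral_const_mul]
  ring

lemma localForm_smul_right (hσ : IsMonotoneLaw Ω σ) (hKΩ : K.carrier ⊆ Ω)
    (u : Plane → Plane) {v : Plane → Plane} (hv : K.IsAdmissibleField v) (a : ℝ) :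
    K.localForm k σ μ δ α r u (a • v) = a * K.localForm k σ μ δ α r u v := by
  have := localForm_smul_add_right (k := k) (μ := μ) (δ := δ) (α := α) (r := r) hσ hKΩ u hv hv a 0
  rwa [zero_smul, add_zero, zero_mul, add_zero] at this

/-- The local form is monotone; equality forces the projected strain and the degrees of freedom of
the defect of the difference to vanish. -/
lemma localForm_sub_nonneg (hσ : IsMonotoneLaw Ω σ) (hKΩ : K.carrier ⊆ Ω)
    (hμ : 0 < ⨍ x in K.carrier, μ x) (hδ : 0 ≤ δ) (hα : 0 < α) (hr : 2 ≤ r)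
    {v w : Plane → Plane} (hv : K.IsAdmissibleField v) (hw : K.IsAdmissibleField w) :
    0 ≤ K.localForm k σ μ δ α r v (v - w) - K.localForm k σ μ δ α r w (v - w) ∧
      (K.localForm k σ μ δ α r v (v - w) - K.localForm k σ μ δ α r w (v - w) = 0 →
        (∀ x ∈ K.carrier, K.projStrain k (v - w) x = 0) ∧ K.dof k (K.defect k (v - w)) = 0) := by
  obtain ⟨h1, h2⟩ := hσ.integral_sub_nonneg K.isBddOpen hKΩ (continuous_projStrain (k := k) v)
    (projStrain_isSymm v) (continuous_projStrain (k := k) w) (projStrain_isSymm w)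
  have hc : 0 < K.diam ^ (-α) := Real.rpow_pos_of_pos K.diam_pos _
  simp only [localForm, stab_eq, projStrain_sub hv hw, dof_defect_sub hv hw]
  set I := ∫ x in K.carrier, frobInner (σ x (K.projStrain k v x))
    (K.projStrain k v x - K.projStrain k w x)
  set J := ∫ x in K.carrier, frobInner (σ x (K.projStrain k w x))
    (K.projStrain k v x - K.projStrain k w x)
  set d := K.dof k (K.defect k v)
  set e := K.dof k (K.defect k w)
  set m := ⨍ x in K.carrier, μ x
  set p : ℝ := inner ℝ (radialWeight δ α r (K.diam ^ (-α)) ‖d‖ • d) (d - e) with hp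
  set q : ℝ := inner ℝ (radialWeight δ α r (K.diam ^ (-α)) ‖e‖ • e) (d - e) with hq
  have h3 : 0 ≤ p - q ∧ (p - q = 0 → d - e = 0) := by
    rw [hp, hq, ← inner_sub_left]
    by_cases hde : d = e
    · simp [hde]
    · have := inner_radial_pos (r := r) hδ hc hα hr hde
      exact ⟨this.le, fun h => absurd h this.ne'⟩
  have h4 : I + m * p - (J + m * q) = (I - J) + m * (p - q) := by ring
  have h5 := mul_nonneg hμ.le h3.1
  rw [h4]
  refine ⟨add_nonneg h1 h5, fun h => ⟨fun x hx => sub_eq_zero.2 (h2 (by linarith) x hx), ?_⟩⟩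
  exact h3.2 ((mul_eq_zero.1 (by linarith)).resolve_left hμ.ne')

/-- The local form dominates a multiple of the energy up to a constant. As the energy is quadratic,
this is all the coercivity that existence needs, whatever the growth exponent. -/
lemma exists_localEnergy_le_localForm (hσ : IsMonotoneLaw Ω σ) (hKΩ : K.carrier ⊆ Ω)
    (hμ : 0 < ⨍ x in K.carrier, μ x) (hδ : 0 ≤ δ) (hα : 0 < α) (hr : 2 ≤ r) :
    ∃ c C : ℝ, 0 < c ∧ ∀ v, c * K.localEnergy k v - C ≤ K.localForm k σ μ δ α r v v := by
  have hc : 0 < K.diam ^ (-α) := Real.rpow_pos_of_pos K.diam_pos _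
  obtain ⟨c, C, hc0, hcoer⟩ := hσ.coercive
  obtain ⟨D, hD, hrad⟩ := exists_le_radialWeight_mul_sq (r := r) hδ hc hα hr
  set m := ⨍ x in K.carrier, μ x with hm
  have := K.isBddOpen.isFiniteMeasure
  refine ⟨min c m, C * K.area + m * D, lt_min hc0 hμ, fun v => ?_⟩
  have h1 : c * (∫ x in K.carrier, frobNorm (K.projStrain k v x) ^ 2) - C * K.area
      ≤ ∫ x in K.carrier, frobInner (σ x (K.projStrain k v x)) (K.projStrain k v x) := by
    have e : ∫ x in K.carrier, (c * frobNorm (K.projStrain k v x) ^ 2 - C)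
        = c * (∫ x in K.carrier, frobNorm (K.projStrain k v x) ^ 2) - C * K.area := by
      rw [integral_sub ((integrableOn_frobNorm_sq v).const_mul c) (integrable_const C),
        integral_const_mul, setIntegral_const, smul_eq_mul, mul_comm C]
      rfl
    rw [← e]
    refine integral_mono_ae (((integrableOn_frobNorm_sq v).const_mul c).sub (integrable_const C))
      (hσ.integrableOn K.isBddOpen hKΩ (continuous_projStrain v) (projStrain_isSymm v)
        (continuous_projStrain v)) ?_
    filter_upwards [ae_restrict_of_ae_restrict_of_subset hKΩ hcoer] with x hx
    exact hx _ (projStrain_isSymm v x)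
  have h2 := mul_le_mul_of_nonneg_left (hrad _ (norm_nonneg (K.dof k (K.defect k v)))) hμ.le
  have h3 : 0 ≤ ∫ x in K.carrier, frobNorm (K.projStrain k v x) ^ 2 :=
    integral_nonneg fun _ => sq_nonneg _
  have h4 := mul_le_mul_of_nonneg_right (min_le_left c m) h3
  have h5 := mul_le_mul_of_nonneg_right (min_le_right c m)
    (sq_nonneg ‖K.dof k (K.defect k v)‖)
  simp only [localForm, stab_eq, localEnergy, inner_smul_left, real_inner_self_eq_norm_sq,
    conj_trivial]
  rw [← hm]
  linarith

lemma continuous_localForm (hσ : IsMonotoneLaw Ω σ) (hKΩ : K.carrier ⊆ Ω) (hα : 0 < α)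
    (hr : 2 ≤ r) {n : ℕ} (e : EuclideanSpace ℝ (Fin n) →ₗ[ℝ] Plane → Plane)
    (he : ∀ c, K.IsAdmissibleField (e c)) (w : Plane → Plane) :
    Continuous fun c => K.localForm k σ μ δ α r (e c) w := by
  let LS : EuclideanSpace ℝ (Fin n) →ₗ[ℝ] Plane → Matrix (Fin 2) (Fin 2) ℝ :=
    { toFun := fun c => K.projStrain k (e c)
      map_add' := fun c d => by
        have := projStrain_smul_add (k := k) (he c) (he d) 1 1
        simpa only [one_smul, ← map_add] using this
      map_smul' := fun t c => by
        ext1 x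
        rw [map_smul]
        exact projStrain_smul (he c) t x }
  let LD : EuclideanSpace ℝ (Fin n) →ₗ[ℝ] EuclideanSpace ℝ (K.DofIndex k) :=
    { toFun := fun c => K.dof k (K.defect k (e c))
      map_add' := fun c d => by
        have := dof_defect_smul_add (k := k) (he c) (he d) 1 1
        simpa only [one_smul, ← map_add] using this
      map_smul' := fun t c => by
        rw [map_smul]
        exact dof_defect_smul (he c) t }
  have hLD : Continuous LD := LinearMap.continuous_of_finiteDimensional LD
  have hLS : Continuous fun p : EuclideanSpace ℝ (Fin n) × Plane => LS p.1 p.2 := by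
    have h1 : ∀ c, LS c = ∑ m, c m • LS (EuclideanSpace.single m 1) := fun c => by
      have h2 : c = ∑ m, c m • EuclideanSpace.single m (1 : ℝ) := by
        ext l; simp [Finset.sum_apply, Pi.single_apply]
      conv_lhs => rw [h2]
      simp only [map_sum, map_smul]
    have h3 : (fun p : EuclideanSpace ℝ (Fin n) × Plane => LS p.1 p.2)
        = fun p => ∑ m, p.1 m • LS (EuclideanSpace.single m 1) p.2 := by
      ext1 p
      rw [h1, Finset.sum_apply]
      rfl
    rw [h3]
    refine continuous_finsetSum _ fun m _ => ?_
    have h4 : Continuous fun p : EuclideanSpace ℝ (Fin n) × Plane => p.1 m :=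
      (EuclideanSpace.proj (𝕜 := ℝ) m).continuous.comp continuous_fst
    have h5 : Continuous (LS (EuclideanSpace.single m 1)) := continuous_projStrain _
    exact h4.smul (h5.comp continuous_snd)
  have h4 := hσ.continuous_integral K.isBddOpen hKΩ hLS (fun c x => projStrain_isSymm (e c) x)
    (continuous_projStrain (K := K) (k := k) w)
  have h5 : Continuous fun c => (⨍ x in K.carrier, μ x) * (inner ℝ
      (radialWeight δ α r (K.diam ^ (-α)) ‖LD c‖ • LD c) (K.dof k (K.defect k w)) : ℝ) :=
    continuous_const.mul (((((continuous_radialWeight hα hr).comp hLD.norm).smul hLD)).inner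
      continuous_const)
  have h6 := h4.add h5
  refine h6.congr fun c => ?_
  rw [localForm, stab_eq]
  rfl

end Form

end MeshElement

/-! ### The discrete problem on the kernel -/

section Global

variable {Ω ΓD ΓN : Set Plane} {ι : Type*} [Fintype ι] {T : ι → MeshElement} {k : ℕ} {r : ℝ}

lemma edgeLength_pos_of_isRegular {K : MeshElement} {ρ : ℝ} (hρ : 0 < ρ) (h : K.IsRegular ρ)
    (j : Fin K.n) : 0 < K.edgeLength j := (mul_pos hρ K.diam_pos).trans_le (h.2 j)

lemma formB_smul_add {v w : Plane → Plane} (hv : ∀ i, (T i).IsAdmissibleField v)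
    (hw : ∀ i, (T i).IsAdmissibleField w) {q : Plane → ℝ}
    (hq : ∀ i, ∃ p : Poly, p.totalDegree ≤ k - 1 ∧ EqOn q (polyFun p) (T i).carrier) (a b : ℝ) :
    formB T (a • v + b • w) q = a * formB T v q + b * formB T w q := by
  have key : ∀ i, ∫ x in (T i).carrier, weakDiv (T i).carrier (a • v + b • w) x * q x
      = a * (∫ x in (T i).carrier, weakDiv (T i).carrier v x * q x)
        + b * ∫ x in (T i).carrier, weakDiv (T i).carrier w x * q x := by
    intro i
    have hE := (T i).isBddOpen
    obtain ⟨p, -, hp⟩ := hq i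
    have I : ∀ {v : Plane → Plane}, (T i).IsAdmissibleField v → IntegrableOn (fun x =>
        weakDiv (T i).carrier v x * q x) (T i).carrier := fun hv => by
      have h1 := (hE.integrableOn_of_memLp hv.memLp_weakDiv).mul_continuousOn_of_subset
        (continuous_polyFun p).continuousOn hE.measurableSet hE.isCompact_closure subset_closure
      exact h1.congr_fun (fun x hx => by simp only [hp hx]) hE.measurableSet
    rw [← integral_const_mul, ← integral_const_mul, ← integral_add ((I (hv i)).const_mul a)
      ((I (hw i)).const_mul b)]
    refine integral_congr_ae ?_
    filter_upwards [weakDiv_smul_add (hv i) (hw i) a b] with x hx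
    rw [hx]
    ring
  simp only [formB, key, Finset.sum_add_distrib, ← Finset.mul_sum]
  ring

lemma isAdmissibleField_of_mem_discreteKernel {v : Plane → Plane}
    (hv : v ∈ discreteKernel Ω ΓD ΓN T k r) (i : ι) : (T i).IsAdmissibleField v :=
  (hv.1.2.2.2 i).isAdmissibleField

lemma smul_add_mem_discreteKernel (hK : ∀ i j, 0 < (T i).edgeLength j) {v w : Plane → Plane}
    (hv : v ∈ discreteKernel Ω ΓD ΓN T k r) (hw : w ∈ discreteKernel Ω ΓD ΓN T k r) (a b : ℝ) :
    a • v + b • w ∈ discreteKernel Ω ΓD ΓN T k r := by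
  refine ⟨⟨fun x hx => ?_, ?_, ?_, fun i => (hv.1.2.2.2 i).smul_add (hK i) (hw.1.2.2.2 i) a b⟩,
    fun q hq => ?_⟩
  · simp [hv.1.1 x hx, hw.1.1 x hx]
  · exact (hv.1.2.1.const_smul a).add (hw.1.2.1.const_smul b)
  · filter_upwards [hv.1.2.2.1, hw.1.2.2.1] with x h1 h2
    simp [h1, h2]
  · rw [formB_smul_add (isAdmissibleField_of_mem_discreteKernel hv)
      (isAdmissibleField_of_mem_discreteKernel hw) hq.2, hv.2 q hq, hw.2 q hq]
    simp

lemma zero_mem_discreteKernel (hK : ∀ i j, 0 < (T i).edgeLength j) :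
    0 ∈ discreteKernel Ω ΓD ΓN T k r := by
  have h0 : (0 : Plane → Plane) = polyField 0 := by
    ext x i
    simp [polyField]
  have h1 : ∀ i, (T i).InLocalSpace k 0 := fun i => by
    rw [h0]
    exact inLocalSpace_polyField (hK i) (by simp)
  refine ⟨⟨fun x _ => rfl, continuousOn_const, .of_forall fun x => rfl, h1⟩, fun q hq => ?_⟩
  have := formB_smul_add (fun i => (h1 i).isAdmissibleField) (fun i => (h1 i).isAdmissibleField)
    hq.2 0 0
  simpa using this

/-- The discrete kernel as a subspace of the vector fields on the plane. -/
def kernelSubmodule (Ω ΓD ΓN : Set Plane) (k : ℕ) (r : ℝ)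
    (hK : ∀ i j, 0 < (T i).edgeLength j) : Submodule ℝ (Plane → Plane) where
  carrier := discreteKernel Ω ΓD ΓN T k r
  zero_mem' := zero_mem_discreteKernel hK
  add_mem' := fun {v w} hv hw => by
    simpa using smul_add_mem_discreteKernel hK hv hw 1 1
  smul_mem' := fun a v hv => by
    simpa using smul_add_mem_discreteKernel hK hv hv a 0

/-- The discrete kernel is finite-dimensional because the degrees of freedom are unisolvent. -/
lemma finiteDimensional_kernelSubmodule (hT : IsDecomposition Ω T) (hk : 1 ≤ k)
    (hK : ∀ i j, 0 < (T i).edgeLength j) :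
    FiniteDimensional ℝ (kernelSubmodule Ω ΓD ΓN k r hK) := by
  let D : kernelSubmodule Ω ΓD ΓN k r hK →ₗ[ℝ] (i : ι) → EuclideanSpace ℝ ((T i).DofIndex k) :=
    { toFun := fun v i => (T i).dof k v.1
      map_add' := fun v w => by
        ext1 i
        have := dof_smul_add (k := k) (isAdmissibleField_of_mem_discreteKernel v.2 i)
          (isAdmissibleField_of_mem_discreteKernel w.2 i) 1 1
        simp only [one_smul] at this
        exact this
      map_smul' := fun a v => by
        ext1 i
        have := dof_smul_add (k := k) (isAdmissibleField_of_mem_discreteKernel v.2 i)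
          (isAdmissibleField_of_mem_discreteKernel v.2 i) a 0
        simp only [zero_smul, add_zero] at this
        exact this }
  refine Module.Finite.of_injective D
    (LinearMap.ker_eq_bot.1 (LinearMap.ker_eq_bot'.2 fun v hv => ?_))
  ext1
  ext1 x
  by_cases hx : x ∈ closure Ω
  · rw [hT.cover] at hx
    obtain ⟨i, hi⟩ := mem_iUnion.1 hx
    exact (v.2.1.2.2.2 i).eq_zero_of_dof_eq_zero hk (hK i) (congrFun hv i) x hi
  · exact v.2.1.1 x hx

lemma one_le_conjugate (hr : 2 ≤ r) : 1 ≤ ENNReal.ofReal (r / (r - 1)) := by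
  rw [ENNReal.one_le_ofReal, le_div_iff₀ (by linarith)]
  linarith

/-- The load is a linear functional on the discrete kernel; the Neumann part has finite length. -/
lemma load_smul_add (hΩ : IsOpen Ω) (hΩb : Bornology.IsBounded Ω) (hT : IsDecomposition Ω T)
    (hΓ : ΓN ⊆ frontier Ω) (hΓm : MeasurableSet ΓN) (hr : 2 ≤ r) (f : Plane → Plane)
    {g : Plane → Plane} (hg : MemLp g (ENNReal.ofReal (r / (r - 1))) ((μH[1]).restrict ΓN))
    {v w : Plane → Plane}
    (hv : v ∈ discreteKernel Ω ΓD ΓN T k r) (hw : w ∈ discreteKernel Ω ΓD ΓN T k r) (a b : ℝ) :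
    load ΓN T k f g (a • v + b • w) = a * load ΓN T k f g v + b * load ΓN T k f g w := by
  have hin : ∀ z x, inner ℝ z ((a • v + b • w) x) = a * inner ℝ z (v x) + b * inner ℝ z (w x) :=
    fun z x => by
      simp only [Pi.add_apply, Pi.smul_apply, inner_add_right, inner_smul_right]
  have hfin : IsFiniteMeasure ((μH[1] : Measure Plane).restrict ΓN) := ⟨by
    rw [Measure.restrict_apply_univ]
    exact (measure_mono hΓ).trans_lt (hausdorffMeasure_frontier_lt_top hΩ hT)⟩
  have hgI : Integrable g ((μH[1]).restrict ΓN) := hg.integrable (one_le_conjugate hr)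
  have hΓc : ΓN ⊆ closure Ω := hΓ.trans frontier_subset_closure
  have IN : ∀ {v}, v ∈ discreteKernel Ω ΓD ΓN T k r →
      Integrable (fun x => (inner ℝ (g x) (v x) : ℝ)) ((μH[1]).restrict ΓN) := fun {v} hv => by
    obtain ⟨M, hM⟩ := hΩb.isCompact_closure.bddAbove_image hv.1.2.1.norm
    have hvm : AEStronglyMeasurable v ((μH[1]).restrict ΓN) :=
      (hv.1.2.1.mono hΓc).aestronglyMeasurable hΓm
    refine (hgI.norm.mul_const M).mono' (hgI.aestronglyMeasurable.inner hvm) ?_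
    filter_upwards [ae_restrict_mem hΓm] with x hx
    exact (norm_inner_le_norm _ _).trans (mul_le_mul_of_nonneg_left
      (hM (mem_image_of_mem _ (hΓc hx))) (norm_nonneg _))
  have IE : ∀ {v}, v ∈ discreteKernel Ω ΓD ΓN T k r → ∀ i,
      IntegrableOn (fun x => (inner ℝ (l2ProjVec (T i).carrier k f x) (v x) : ℝ)) (T i).carrier :=
    fun {v} hv i => by
      obtain ⟨P, -, hP⟩ := exists_l2ProjVec_eq (T i).carrier k f
      rw [hP]
      exact (T i).isBddOpen.integrableOn_of_continuousOn
        ((continuous_polyField P).continuousOn.inner (hv.1.2.2.2 i).continuousOn)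
  have key : ∀ i, ∫ x in (T i).carrier,
        (inner ℝ (l2ProjVec (T i).carrier k f x) ((a • v + b • w) x) : ℝ)
      = a * (∫ x in (T i).carrier, inner ℝ (l2ProjVec (T i).carrier k f x) (v x))
        + b * ∫ x in (T i).carrier, inner ℝ (l2ProjVec (T i).carrier k f x) (w x) := fun i => by
    simp only [hin]
    rw [integral_add ((IE hv i).const_mul a) ((IE hw i).const_mul b), integral_const_mul,
      integral_const_mul]
  simp only [load, key, Finset.sum_add_distrib, ← Finset.mul_sum]
  simp only [hin]
  rw [integral_add ((IN hv).const_mul a) ((IN hw).const_mul b), integral_const_mul,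
    integral_const_mul]
  ring

/-- The linear functional given by a map that respects linear combinations. -/
def linearMapOfSmulAdd {V : Type*} [AddCommGroup V] [Module ℝ V] (F : V → ℝ)
    (h : ∀ (a b : ℝ) (v w : V), F (a • v + b • w) = a * F v + b * F w) : V →ₗ[ℝ] ℝ where
  toFun := F
  map_add' v w := by simpa using h 1 1 v w
  map_smul' a v := by simpa using h a 0 v v

/-- Well-posedness of the discrete kernel problem for monotone Carathéodory laws. -/
theorem existsUnique_solvesKernelProblem (hΩ : IsOpen Ω) (hΩb : Bornology.IsBounded Ω)
    (hΩc : IsConnected Ω) (hΓD : ΓD ⊆ frontier Ω) (hΓN : ΓN ⊆ frontier Ω)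
    (hΓDm : MeasurableSet ΓD) (hΓNm : MeasurableSet ΓN) (hΓD_pos : 0 < μH[1] ΓD)
    (hT : IsDecomposition Ω T) (hK : ∀ i j, 0 < (T i).edgeLength j) (hk : 1 ≤ k) (hr : 2 ≤ r)
    {δ α : ℝ} (hδ : 0 ≤ δ) (hα : 0 < α) {μ : Plane → ℝ} (hμ : ∀ i, 0 < ⨍ x in (T i).carrier, μ x)
    (f : Plane → Plane) {g : Plane → Plane}
    (hg : MemLp g (ENNReal.ofReal (r / (r - 1))) ((μH[1]).restrict ΓN))
    {σ : Plane → Matrix (Fin 2) (Fin 2) ℝ → Matrix (Fin 2) (Fin 2) ℝ} (hσ : IsMonotoneLaw Ω σ) :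
    ∃! u, SolvesKernelProblem Ω ΓD ΓN T k σ μ δ α r f g u := by
  set V := kernelSubmodule Ω ΓD ΓN k r hK with hV
  have hfd : FiniteDimensional ℝ V := finiteDimensional_kernelSubmodule hT hk hK
  have hadm : ∀ (v : V) i, (T i).IsAdmissibleField v.1 := fun v i =>
    isAdmissibleField_of_mem_discreteKernel v.2 i
  -- by unisolvence and the rigidity argument, the local energies separate the kernel
  have hzero : ∀ v : V, (∀ i, (∀ x ∈ (T i).carrier, (T i).projStrain k v.1 x = 0) ∧
      (T i).dof k ((T i).defect k v.1) = 0) → v = 0 := fun v hv => by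
    have h1 := eq_zero_of_piecewise_rigid hΩ hΩc hT hΓD hΓDm hΓD_pos v.2.1.2.1 v.2.1.2.2.1
      fun i => (v.2.1.2.2.2 i).exists_isRigid hk (hK i) (hv i).1 (hv i).2
    ext1
    ext1 x
    by_cases hx : x ∈ closure Ω
    · exact h1 x hx
    · exact v.2.1.1 x hx
  let A : V → V →ₗ[ℝ] ℝ := fun u => linearMapOfSmulAdd
    (fun w => formA T k σ μ δ α r u.1 w.1) fun a b v w => by
      change ∑ i, (T i).localForm k σ μ δ α r u.1 (a • v.1 + b • w.1)
        = a * ∑ i, (T i).localForm k σ μ δ α r u.1 v.1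
          + b * ∑ i, (T i).localForm k σ μ δ α r u.1 w.1
      simp only [fun i => localForm_smul_add_right (k := k) (μ := μ) (δ := δ) (α := α) (r := r) hσ
        (hT.subset i) u.1 (hadm v i) (hadm w i) a b, Finset.sum_add_distrib, ← Finset.mul_sum]
  have hA : ∀ u w, A u w = ∑ i, (T i).localForm k σ μ δ α r u.1 w.1 := fun u w => rfl
  let ℓ : V →ₗ[ℝ] ℝ := linearMapOfSmulAdd (fun v => load ΓN T k f g v.1) fun a b v w =>
    load_smul_add hΩ hΩb hT hΓN hΓNm hr f hg v.2 w.2 a b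
  have hmain : ∃! u : V, ∀ w, A u w = ℓ w := by
    refine existsUnique_of_strictMono_form A ℓ (fun n e w => ?_) (fun u v huv => ?_) fun u hu => ?_
    · simp only [hA]
      exact continuous_finsetSum _ fun i _ => continuous_localForm hσ (hT.subset i) hα hr
        (V.subtype ∘ₗ e) (fun c => hadm (e c) i) w.1
    · have hloc := fun i => localForm_sub_nonneg (k := k) hσ (hT.subset i) (hμ i) hδ hα hr
        (hadm u i) (hadm v i)
      have e : A u (u - v) - A v (u - v) = ∑ i, ((T i).localForm k σ μ δ α r u.1 (u.1 - v.1)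
          - (T i).localForm k σ μ δ α r v.1 (u.1 - v.1)) := by
        rw [Finset.sum_sub_distrib]
        rfl
      rw [e]
      refine lt_of_le_of_ne (Finset.sum_nonneg fun i _ => (hloc i).1) fun h => huv ?_
      have h1 := (Finset.sum_eq_zero_iff_of_nonneg fun i _ => (hloc i).1).1 h.symm
      exact sub_eq_zero.1 (hzero (u - v) fun i => (hloc i).2 (h1 i (Finset.mem_univ i)))
    · choose c C hc hcC using fun i => exists_localEnergy_le_localForm (k := k) hσ (hT.subset i)
        (hμ i) hδ hα hr
      set N := ∑ i, c i * (T i).localEnergy k u.1 with hN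
      have hnn : ∀ i, 0 ≤ c i * (T i).localEnergy k u.1 := fun i =>
        mul_nonneg (hc i).le (localEnergy_nonneg _)
      have hNpos : 0 < N := by
        refine lt_of_le_of_ne (Finset.sum_nonneg fun i _ => hnn i) fun h => hu ?_
        have h1 := (Finset.sum_eq_zero_iff_of_nonneg fun i _ => hnn i).1 h.symm
        exact hzero u fun i => eq_zero_of_localEnergy_eq_zero
          ((mul_eq_zero.1 (h1 i (Finset.mem_univ i))).resolve_left (hc i).ne')
      set D := |∑ i, C i| with hD
      -- along the ray through `u` the form grows linearly, with slope `N`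
      set t := max 1 ((|ℓ u| + D + 1) / N) with ht
      have ht1 : 1 ≤ t := le_max_left _ _
      have htN : |ℓ u| + D + 1 ≤ t * N := (div_le_iff₀ hNpos).1 (le_max_right _ _)
      refine ⟨t, by linarith, ?_⟩
      have h1 : t ^ 2 * N - D ≤ t * A (t • u) u := by
        have h2 : ∀ i, t ^ 2 * (c i * (T i).localEnergy k u.1) - C i
            ≤ t * (T i).localForm k σ μ δ α r (t • u.1) u.1 := fun i => by
          have h3 := hcC i (t • u.1)
          rw [localEnergy_smul (hadm u i), localForm_smul_right hσ (hT.subset i) _ (hadm u i)] at h3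
          linarith
        have h3 := Finset.sum_le_sum fun i (_ : i ∈ Finset.univ) => h2 i
        rw [Finset.sum_sub_distrib, ← Finset.mul_sum, ← Finset.mul_sum] at h3
        have h4 : ∑ i, C i ≤ D := le_abs_self _
        have h5 : A (t • u) u = ∑ i, (T i).localForm k σ μ δ α r (t • u.1) u.1 := rfl
        rw [h5]
        linarith
      have h2 : 0 ≤ D := abs_nonneg _
      have h3 := le_abs_self (ℓ u)
      have h4 : t * (t * N - D) ≤ t * A (t • u) u := by nlinarith
      have h5 := le_of_mul_le_mul_left h4 (by linarith)
      linarith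
  obtain ⟨u, hu, huniq⟩ := hmain
  refine ⟨u.1, ⟨u.2, fun v hv => hu ⟨v, hv⟩⟩, fun w hw => ?_⟩
  exact congrArg Subtype.val (huniq ⟨w, hw.1⟩ fun v => hw.2 v.1 v.2)

end Global

end VEM

end

theorem mainTheorem7
    (Ω ΓD ΓN : Set VEM.Plane)
    (hΩ_open : IsOpen Ω) (hΩ_bdd : Bornology.IsBounded Ω) (hΩ_conn : IsConnected Ω)
    (hΓ_union : ΓD ∪ ΓN = frontier Ω) (hΓ_disj : Disjoint ΓD ΓN)
    (hΓD_meas : MeasurableSet ΓD) (hΓN_meas : MeasurableSet ΓN)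
    (hΓD_pos : 0 < MeasureTheory.Measure.hausdorffMeasure 1 ΓD)
    {ι : Type*} [Fintype ι] (T : ι → VEM.MeshElement) (hT : VEM.IsDecomposition Ω T)
    (ρ : ℝ) (hρ : 0 < ρ) (hT_reg : ∀ i, (T i).IsRegular ρ)
    (k : ℕ) (hk : 1 ≤ k)
    (r : ℝ) (hr : 2 ≤ r) (δ : ℝ) (hδ : 0 ≤ δ) (α : ℝ) (hα : 0 < α)
    (μ : VEM.Plane → ℝ) (μm μp : ℝ) (hμm : 0 < μm)
    (hμ_meas : MeasureTheory.AEStronglyMeasurable μ (MeasureTheory.volume.restrict Ω))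
    (hμ : ∀ x ∈ Ω, μm ≤ μ x ∧ μ x ≤ μp)
    (f g : VEM.Plane → VEM.Plane)
    (hf : MeasureTheory.MemLp f (ENNReal.ofReal (r / (r - 1))) (MeasureTheory.volume.restrict Ω))
    (hg : MeasureTheory.MemLp g (ENNReal.ofReal (r / (r - 1)))
      ((MeasureTheory.Measure.hausdorffMeasure 1).restrict ΓN)) :
    (∃! u : VEM.Plane → VEM.Plane,
      VEM.SolvesKernelProblem Ω ΓD ΓN T k (VEM.carreauYasuda μ δ α r) μ δ α r f g u) ∧
    (∀ (σ : VEM.Plane → Matrix (Fin 2) (Fin 2) ℝ → Matrix (Fin 2) (Fin 2) ℝ) (σc σm : ℝ),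
      0 < σc → 0 < σm → VEM.StressLaw Ω r δ σc σm σ →
      ∃! u : VEM.Plane → VEM.Plane,
        VEM.SolvesKernelProblem Ω ΓD ΓN T k σ μ δ α r f g u) := by
  have hK : ∀ i j, 0 < (T i).edgeLength j := fun i j =>
    VEM.edgeLength_pos_of_isRegular hρ (hT_reg i) j
  have hΓD : ΓD ⊆ frontier Ω := hΓ_union ▸ Set.subset_union_left
  have hΓN : ΓN ⊆ frontier Ω := hΓ_union ▸ Set.subset_union_right
  have main := fun (σ : VEM.Plane → Matrix (Fin 2) (Fin 2) ℝ → Matrix (Fin 2) (Fin 2) ℝ)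
      (hσ : VEM.IsMonotoneLaw Ω σ) =>
    VEM.existsUnique_solvesKernelProblem hΩ_open hΩ_bdd hΩ_conn hΓD hΓN hΓD_meas hΓN_meas hΓD_pos
      hT hK hk hr hδ hα
      (fun i => VEM.MeshElement.average_pos (hT.subset i) hμm hμ_meas hμ) f hg hσ
  exact ⟨main _ (VEM.isMonotoneLaw_carreauYasuda hΩ_open.measurableSet hμm hμ_meas hμ hδ hα hr),
    fun σ σc σm hσc hσm hσ => main σ (hσ.isMonotoneLaw hr hδ hσc hσm)⟩
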